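/- Let $\mathbb T^d=\mathbb R^d/2\pi\mathbb Z^d$ with the metric inherited from the Euclidean one, and identify every tangent space with $\mathbb R^d$. Let $A_0:\mathbb T^d\to\mathbb T^d$ be an analytic Anosov diffeomorphism: it has a dense orbit $\{A_0^m\psi: m\in\mathbb Z\}$, and there are a continuous splitting $\mathrm T_\psi\mathbb T^d=W^s(\psi)\oplus W^u(\psi)$ into subspaces of constant dimensions with $DA_0(\psi)W^{s,u}(\psi)=W^{s,u}(A_0\psi)$ and constants $\Theta>0$, $0<\lambda<1$ such that $\|DA_0^n w\|\le\Theta\lambda^n\|w\|$ for $w\in W^s(\psi)$ and $\|DA_0^{-n}w\|\le\Theta\lambda^n\|w\|$ for $w\in W^u(\psi)$, for all $n\ge 0$ and $\psi$. Let $\widetilde A_0$ be a lift of $A_0$ to $\mathbb R^d$, let $F:\mathbb T^d\to\mathbb R^d$ be analytic, and put $A_\varepsilon(\psi)=\widetilde A_0(\psi)+\varepsilon F(\psi) \bmod 2\pi$. For a function $f$ on $\mathbb T^d$ write $\|f\|_\beta=\sup_\psi\|f(\psi)\|+\sup_{\psi\neq\psi'}\|f(\psi)-f(\psi')\|/\delta(\psi,\psi')^\beta$.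 Suppose that for every $\psi$ there are nonzero subspaces $V_1(\psi),\dots,V_k(\psi)$ of constant dimensions $d_1,\dots,d_k$, Hölder continuous in $\psi$ with some exponent, such that $\mathrm T_\psi\mathbb T^d=\bigoplus_{i=1}^kV_i(\psi)$ and $DA_0(\psi)V_i(\psi)=V_i(A_0\psi)$. Let $P_i(\psi)$ be the projector onto $V_i(\psi)$ associated with this decomposition, $\mathcal L_i(\psi)=P_i(A_0\psi)DA_0(\psi)|_{V_i(\psi)}$ and $\mathcal L_i^{[n]}(\psi)=\mathcal L_i(A_0^{n-1}\psi)\cdots\mathcal L_i(A_0\psi)\mathcal L_i(\psi)$. Suppose that there is $N_0$ such that for all $n>N_0$, all $\psi$ and $i=1,\dots,k-1$ $$\|\mathcal L_i^{[n]}(\psi)\|\,\|(\mathcal L_{i+1}^{[n]}(\psi))^{-1}\|<1 .$$ Then the following holds. (a) There are $\varepsilon_0>0$ and, for $|\varepsilon|<\varepsilon_0$, Hölder continuous homeomorphisms $H_\varepsilon$ of $\mathbb T^d$ with $H_\varepsilon\circ A_0=A_\varepsilon\circ H_\varepsilon$ and $H_\varepsilon(\psi)=\psi+\sum_{n\ge1}\varepsilon^nh^{(n)}(\psi)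 \bmod 2\pi$, where for every sufficiently small $\beta>0$ there is $C_\beta>0$ with $\|h^{(n)}\|_\beta\le C_\beta^n$ for all $n\ge1$. (b) For this $H_\varepsilon$ there is $\bar\beta>0$ such that for every $0<\beta<\bar\beta$ there is $\bar\varepsilon(\beta)\in(0,\varepsilon_0]$ and, for $|\varepsilon|<\bar\varepsilon(\beta)$ and $\psi\in\mathbb T^d$, there are invertible linear maps $\mathcal V_\varepsilon(\psi):\mathrm T_\psi\mathbb T^d\to\mathrm T_\psi\mathbb T^d$ and $\mathcal L_\varepsilon(\psi):\mathrm T_\psi\mathbb T^d\to\mathrm T_{A_0\psi}\mathbb T^d$, analytic in $\varepsilon$ and $\beta$-Hölder continuous in $\psi$ (that is, $\mathcal V_\varepsilon=\sum_{n\ge0}\varepsilon^n\mathcal V^{(n)}$ and $\mathcal L_\varepsilon=\sum_{n\ge0}\varepsilon^n\mathcal L^{(n)}$ for $|\varepsilon|<\bar\varepsilon(\beta)$, with $\|\mathcal V^{(n)}\|_\beta,\|\mathcal L^{(n)}\|_\beta\le C\,\bar\varepsilon(\beta)^{-n}$ for some constant $C$), such that for all $i\ne j$ and all $\psi$ $$P_i(A_0\psi)\,\mathcal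 L_\varepsilon(\psi)|_{V_j(\psi)}=0,\qquad P_i(\psi)\,\mathcal V_0(\psi)|_{V_j(\psi)}=0,$$ and $$DA_\varepsilon(H_\varepsilon(\psi))\,\mathcal V_\varepsilon(\psi)=\mathcal V_\varepsilon(A_0\psi)\,\mathcal L_\varepsilon(\psi).$$ -/

import Mathlib

open scoped NNReal ENNReal

noncomputable section

namespace AnosovTorus

/-- Euclidean space `ℝ^d`; also the tangent space of the torus at each of its points. -/
abbrev E (d : ℕ) : Type := EuclideanSpace ℝ (Fin d)

/-- The lattice `2πℤ^d`. -/
def lattice (d : ℕ) : AddSubgroup (E d) where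
  carrier := {x | ∀ i, ∃ m : ℤ, x i = 2 * Real.pi * m}
  zero_mem' := fun i => ⟨0, by simp⟩
  add_mem' := by
    intro x y hx hy i
    obtain ⟨m, hm⟩ := hx i
    obtain ⟨n, hn⟩ := hy i
    exact ⟨m + n, by simp only [PiLp.add_apply, hm, hn]; push_cast; ring⟩
  neg_mem' := by
    intro x hx i
    obtain ⟨m, hm⟩ := hx i
    exact ⟨-m, by simp only [PiLp.neg_apply, hm]; push_cast; ring⟩

/-- The torus `𝕋^d = ℝ^d / 2πℤ^d`. Its distance is the one of the quotient norm, that is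
`δ(ψ, ψ') = inf ‖x - x'‖` over representatives `x` of `ψ` and `x'` of `ψ'`. -/
abbrev Torus (d : ℕ) : Type := E d ⧸ lattice d

/-- The projection `ℝ^d → 𝕋^d` (reduction mod `2π`). -/
def proj (d : ℕ) : E d →+ Torus d := QuotientAddGroup.mk' (lattice d)

/-- The differential at `ψ` of the torus map that has the lift `f : ℝ^d → ℝ^d`: the derivative
of `f` at a point above `ψ`. For lifts of torus maps, the point above `ψ` is immaterial
(`torusDeriv_proj`). -/
def torusDeriv {d : ℕ} (f : E d → E d) (ψ : Torus d) : E d →L[ℝ] E d :=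
  fderiv ℝ f (Quotient.out ψ)

theorem torusDeriv_proj {d : ℕ} (f : E d → E d) (hf : Continuous f) (g : Torus d → Torus d)
    (hfg : ∀ x, proj d (f x) = g (proj d x)) (x : E d) :
    torusDeriv f (proj d x) = fderiv ℝ f x := by
  unfold torusDeriv
  set y : E d := Quotient.out (proj d x) with hy
  have hyx : proj d y = proj d x := Quotient.out_eq _
  set l : E d := y - x with hl
  have hlat : ∀ z, f (z + l) - f z ∈ lattice d := by
    intro z
    have h1 : proj d (f (z + l) - f z) = 0 := by
      rw [map_sub, hfg, hfg, map_add, hl, map_sub, hyx, sub_self, add_zero, sub_self]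
    exact (QuotientAddGroup.eq_zero_iff _).1 h1
  have hconst : ∀ z, f (z + l) - f z = f (x + l) - f x := by
    intro z
    ext i
    choose m hm using fun z => hlat z i
    have hc : Continuous fun z => ((m z : ℤ) : ℝ) := by
      have h2 : (fun z => ((m z : ℤ) : ℝ)) = fun z => (f (z + l) - f z) i / (2 * Real.pi) := by
        funext z
        rw [hm z]
        field_simp
      rw [h2]
      fun_prop
    have hc' : Continuous m := Int.isClosedEmbedding_coe_real.isInducing.continuous_iff.2 hc
    have h3 : m z = m x := PreconnectedSpace.constant inferInstance hc'
    rw [hm z, hm x, h3]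
  have h4 : (fun z => f (z + l)) = fun z => f z + (f (x + l) - f x) := by
    funext z
    rw [← hconst z]
    abel
  have h5 : fderiv ℝ (fun z => f (z + l)) x = fderiv ℝ f (x + l) := fderiv_comp_add_right l
  rw [h4, fderiv_add_const] at h5
  rw [h5, hl]
  congr 1
  abel

/-- An analytic diffeomorphism of `𝕋^d`, given together with analytic lifts to `ℝ^d` of the map
and of its inverse. -/
structure AnalyticDiffeo (d : ℕ) where
  /-- the map of the torus -/
  toPerm : Equiv.Perm (Torus d)
  /-- a lift of the map -/
  lift : E d → E d
  /-- a lift of the inverse map -/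
  liftInv : E d → E d
  proj_lift : ∀ x, proj d (lift x) = toPerm (proj d x)
  proj_liftInv : ∀ x, proj d (liftInv x) = toPerm.symm (proj d x)
  analytic_lift : AnalyticOnNhd ℝ lift Set.univ
  analytic_liftInv : AnalyticOnNhd ℝ liftInv Set.univ

/-- The differential `DA(ψ)`. -/
def AnalyticDiffeo.D {d : ℕ} (A : AnalyticDiffeo d) (ψ : Torus d) : E d →L[ℝ] E d :=
  torusDeriv A.lift ψ

/-- `A` is an Anosov diffeomorphism: it has a dense orbit and a continuous invariant hyperbolic
splitting `W^s ⊕ W^u` of the tangent bundle. Continuity of a field of subspaces is continuity of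
the field of orthogonal projections. -/
def IsAnosov {d : ℕ} (A : AnalyticDiffeo d) : Prop :=
  (∃ ψ : Torus d, Dense (Set.range fun m : ℤ => (A.toPerm ^ m) ψ)) ∧
  ∃ (Ws Wu : Torus d → Submodule ℝ (E d)) (ds du : ℕ),
    (∀ ψ, IsCompl (Ws ψ) (Wu ψ)) ∧
    (∀ ψ, Module.finrank ℝ (Ws ψ) = ds) ∧
    (∀ ψ, Module.finrank ℝ (Wu ψ) = du) ∧
    (∀ ψ, (Ws ψ).map (A.D ψ : E d →ₗ[ℝ] E d) = Ws (A.toPerm ψ)) ∧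
    (∀ ψ, (Wu ψ).map (A.D ψ : E d →ₗ[ℝ] E d) = Wu (A.toPerm ψ)) ∧
    (Continuous fun ψ => (Ws ψ).starProjection) ∧
    (Continuous fun ψ => (Wu ψ).starProjection) ∧
    ∃ Θ lam : ℝ, 0 < Θ ∧ 0 < lam ∧ lam < 1 ∧
      (∀ (n : ℕ) (ψ : Torus d), ∀ w ∈ Ws ψ, ‖torusDeriv (A.lift^[n]) ψ w‖ ≤ Θ * lam ^ n * ‖w‖) ∧
      (∀ (n : ℕ) (ψ : Torus d), ∀ w ∈ Wu ψ, ‖torusDeriv (A.liftInv^[n]) ψ w‖ ≤ Θ * lam ^ n * ‖w‖)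

/-- The lift `x ↦ Ã₀(x) + εF(x)` of the perturbed map. -/
def perturbedLift {d : ℕ} (A : AnalyticDiffeo d) (F : Torus d → E d) (ε : ℝ) (x : E d) : E d :=
  A.lift x + ε • F (proj d x)

/-- The perturbed map `A_ε(ψ) = Ã₀(ψ) + εF(ψ) mod 2π`. -/
def perturbed {d : ℕ} (A : AnalyticDiffeo d) (F : Torus d → E d) (ε : ℝ) (ψ : Torus d) :
    Torus d :=
  A.toPerm ψ + proj d (ε • F ψ)

theorem proj_perturbedLift {d : ℕ} (A : AnalyticDiffeo d) (F : Torus d → E d) (ε : ℝ) (x : E d) :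
    proj d (perturbedLift A F ε x) = perturbed A F ε (proj d x) := by
  rw [perturbedLift, perturbed, map_add, A.proj_lift]

/-- The Hölder norm `‖f‖_β = ‖f‖_∞ + |f|_β`, with values in `[0, ∞]`. -/
def holderENorm {d : ℕ} {G : Type*} [NormedAddCommGroup G] (β : ℝ≥0) (f : Torus d → G) : ℝ≥0∞ :=
  (⨆ ψ, ‖f ψ‖ₑ) + eHolderNorm β f

/-- The family `f_ε`, `|ε| < r`, is analytic in `ε` as a family of `β`-Hölder functions:
`f_ε(ψ) = ∑ ε^n f^(n)(ψ)` for `|ε| < r`, with `‖f^(n)‖_β ≤ C r^(-n)`. -/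
def IsAnalyticHolder {d : ℕ} {G : Type*} [NormedAddCommGroup G] [NormedSpace ℝ G]
    (β : ℝ≥0) (r : ℝ) (f : ℝ → Torus d → G) : Prop :=
  ∃ (c : ℕ → Torus d → G) (C : ℝ),
    (∀ n, holderENorm β (c n) ≤ ENNReal.ofReal (C / r ^ n)) ∧
    ∀ ε : ℝ, |ε| < r → ∀ ψ, HasSum (fun n => ε ^ n • c n ψ) (f ε ψ)

/-- `H_ε`, `|ε| < ε₀`, is the structural-stability conjugacy between `A` and `A_ε`:
each `H_ε` is a Hölder continuous homeomorphism with `H_ε ∘ A = A_ε ∘ H_ε`, and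
`H_ε(ψ) = ψ + ∑_{n ≥ 1} ε^n h^(n)(ψ)`, where for all small `β` one has `‖h^(n)‖_β ≤ C_β^n`. -/
def IsConjugacy {d : ℕ} (A : AnalyticDiffeo d) (F : Torus d → E d) (ε₀ : ℝ)
    (H : ℝ → Torus d → Torus d) : Prop :=
  (∀ ε : ℝ, |ε| < ε₀ → IsHomeomorph (H ε) ∧ (∃ β : ℝ≥0, 0 < β ∧ MemHolder β (H ε)) ∧
    ∀ ψ, H ε (A.toPerm ψ) = perturbed A F ε (H ε ψ)) ∧
  ∃ h : ℕ → Torus d → E d,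
    h 0 = 0 ∧
    (∀ ε : ℝ, |ε| < ε₀ → ∀ ψ, ∃ s : E d,
      HasSum (fun n => ε ^ n • h n ψ) s ∧ H ε ψ = ψ + proj d s) ∧
    ∃ β₁ : ℝ≥0, 0 < β₁ ∧ ∀ β : ℝ≥0, 0 < β → β < β₁ → ∃ C : ℝ, 0 < C ∧
      ∀ n, 1 ≤ n → holderENorm β (h n) ≤ ENNReal.ofReal (C ^ n)

/-- A Hölder continuous splitting `T_ψ 𝕋^d = V_1(ψ) ⊕ ⋯ ⊕ V_k(ψ)` into nonzero subspaces of
constant dimensions, invariant under `DA`. Hölder continuity of a field of subspaces is Hölder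
continuity of the field of orthogonal projections. -/
structure InvariantSplitting {d : ℕ} (A : AnalyticDiffeo d) (k : ℕ) where
  /-- the subspaces -/
  V : Fin k → Torus d → Submodule ℝ (E d)
  /-- their dimensions -/
  dim : Fin k → ℕ
  dim_pos : ∀ i, 0 < dim i
  finrank_eq : ∀ i ψ, Module.finrank ℝ (V i ψ) = dim i
  isInternal : ∀ ψ, DirectSum.IsInternal fun i => V i ψ
  invariant : ∀ i ψ, (V i ψ).map (A.D ψ : E d →ₗ[ℝ] E d) = V i (A.toPerm ψ)
  holder : ∃ β : ℝ≥0, 0 < β ∧ ∀ i, MemHolder β fun ψ => (V i ψ).starProjection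

namespace InvariantSplitting

variable {d k : ℕ} {A : AnalyticDiffeo d} (S : InvariantSplitting A k)

theorem isCompl (i : Fin k) (ψ : Torus d) : IsCompl (S.V i ψ) (⨆ j ≠ i, S.V j ψ) := by
  refine ⟨(S.isInternal ψ).submodule_iSupIndep i, codisjoint_iff_le_sup.2 ?_⟩
  rw [← (S.isInternal ψ).submodule_iSup_eq_top]
  refine iSup_le fun j => ?_
  by_cases h : j = i
  · subst h
    exact le_sup_left
  · exact le_sup_of_le_right (le_iSup₂_of_le j h le_rfl)

/-- The projector `P_i(ψ) : T_ψ 𝕋^d → V_i(ψ)` associated with the decomposition. -/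
def P (i : Fin k) (ψ : Torus d) : E d →L[ℝ] S.V i ψ :=
  LinearMap.toContinuousLinearMap ((S.V i ψ).projectionOnto (⨆ j ≠ i, S.V j ψ) (S.isCompl i ψ))

/-- The block `P_i(φ) M|_{V_j(ψ)}` of a linear map `M : T_ψ 𝕋^d → T_φ 𝕋^d`. -/
def block (i j : Fin k) (ψ φ : Torus d) (M : E d →L[ℝ] E d) : S.V j ψ →L[ℝ] S.V i φ :=
  S.P i φ ∘L M ∘L (S.V j ψ).subtypeL

/-- `𝓛_i(ψ) = P_i(A(ψ)) DA(ψ)|_{V_i(ψ)}`. -/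
def restr (i : Fin k) (ψ : Torus d) : S.V i ψ →L[ℝ] S.V i (A.toPerm ψ) :=
  S.block i i ψ (A.toPerm ψ) (A.D ψ)

/-- `𝓛_i^[n](ψ) = 𝓛_i(A^(n-1)(ψ)) ⋯ 𝓛_i(A(ψ)) 𝓛_i(ψ)`. -/
def restrPow (i : Fin k) : (n : ℕ) → (ψ : Torus d) → S.V i ψ →L[ℝ] S.V i (A.toPerm^[n] ψ)
  | 0, ψ => ContinuousLinearMap.id ℝ (S.V i ψ)
  | n + 1, ψ => (restrPow i n (A.toPerm ψ)) ∘L S.restr i ψ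

/-- The gap condition: there is `N₀` such that for `n > N₀`, all `ψ` and `i = 1, …, k - 1`,
`‖𝓛_i^[n](ψ)‖ ‖(𝓛_{i+1}^[n](ψ))⁻¹‖ < 1`. -/
def HasGaps : Prop :=
  ∃ N₀ : ℕ, ∀ n : ℕ, N₀ < n → ∀ (i : ℕ) (hi : i + 1 < k) (ψ : Torus d),
    ‖S.restrPow ⟨i, Nat.lt_of_succ_lt hi⟩ n ψ‖ *
      ‖(S.restrPow ⟨i + 1, hi⟩ n ψ).inverse‖ < 1

end InvariantSplitting

end AnosovTorus

end

open AnosovTorus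

/-! Both parts reduce to an analytic equation `Φ (ε, y) = 0` in a Banach space `Hol` of Hölder
functions on the torus. The analytic implicit function theorem (`exists_analytic_curve`) then yields
Hölder regularity, analyticity in `ε` and geometric bounds on the coefficients at once. What has to
be shown each time is that `Φ` is analytic and that its linearization is invertible.

For (a), let `H_ε = id + h`. On lifts the conjugacy equation reads `Ã(x + h) - Ã(x) + εF(x + h) - h
∘ A = 0`. Substitution of `h` into an analytic lift is analytic in `h`, because Taylor series
converge uniformly over the compact torus (`exists_nemytskii`). The linearization is `w ↦ DA w - w ∘
A`, which is invertible by `exists_equiv_of_dichotomy`. There `M` denotes the transfer operator `w ↦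
(a w) ∘ A⁻¹`. After `N` steps hyperbolicity makes `M ^ N P` and `M⁻¹ ^ N (1 - P)` small, hence `P -
M⁻¹ ^ N (1 - P)` nearly inverts `1 - M ^ N`. Composition with `A^{±N}` multiplies Hölder seminorms
by at most `K ^ (βN)`, which is at most `2` for small `β`, and this does not spoil the smallness.
Only smallness is used, not invariance of `P`, so a merely continuous `P` may be replaced by a
Lipschitz approximation.

That `H_ε` is a homeomorphism (`IsAnosov.exists_isHomeomorph`) follows from the same dichotomy on
bounded functions: there is a semiconjugacy `J` near the identity in the opposite direction, and a
map near the identity that commutes with `A` or with `A_ε` is the identity. Hence `J` inverts `H_ε`.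

For (b), let `B_ε` be `DA_ε` along `H_ε`, let `od` and `dg` be the off-diagonal and diagonal parts
for the splitting, `𝓥 = 1 + od v` and `w = B_ε 𝓥 DA⁻¹`. If `w = (𝓥 ∘ A) (dg w)`, then `𝓛 = (dg w)
DA` is block diagonal and satisfies the required identity. This is the equation `od w = (od v ∘ A)
(dg w)`. The diagonal part of `v` does not occur in it and is fixed by the additional equation `dg
(c DA v DA⁻¹ - v ∘ A) = 0`. At `ε = 0` the sum of both is exactly linear, namely `v ↦ ad_c v - v ∘
A`, where `ad_c` is conjugation by `DA` with the diagonal blocks multiplied by `c`. By the gap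
condition the blocks `V_j → V_i` are contracted for `i < j` and expanded for `i > j`, and a small
`c` contracts the diagonal ones (`HasGaps.exists_hasDichotomy`). So the invertibility result of part
(a) applies again. -/

open scoped NNReal ENNReal
noncomputable section
namespace AnosovTorus

/-! ### Banach spaces of bounded functions with a generalized Hölder condition -/

section HolderSpace

set_option linter.unusedSectionVars false

variable {X : Type*} {G G₁ G₂ G₃ : Type*}
  [NormedAddCommGroup G] [NormedSpace ℝ G] [NormedAddCommGroup G₁] [NormedSpace ℝ G₁]
  [NormedAddCommGroup G₂] [NormedSpace ℝ G₂] [NormedAddCommGroup G₃] [NormedSpace ℝ G₃]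

/-- Bounded functions `f` with `‖f x - f y‖ ≤ C ω(x, y)`. -/
def IsHol (ω : X → X → ℝ≥0) (f : X → G) : Prop :=
  ∃ C : ℝ, (∀ x, ‖f x‖ ≤ C) ∧ ∀ x y, ‖f x - f y‖ ≤ C * ω x y

/-- The functions with finite `ω`-Hölder norm, realized inside a product of two `ℓ^∞` spaces by
means of the function and its difference quotients. -/
def holSubmodule (ω : X → X → ℝ≥0) (G : Type*) [NormedAddCommGroup G] [NormedSpace ℝ G] :
    Submodule ℝ (lp (fun _ : X => G) ∞ × lp (fun _ : X × X => G) ∞) where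
  -- The two equations are equivalent unless `ω x y = 0`. There the first gives the quotient the
  -- value zero and the second forces `p.1 x = p.1 y`.
  carrier := {p | ∀ x y, p.2 (x, y) = ((ω x y : ℝ)⁻¹) • (p.1 x - p.1 y) ∧
    (ω x y : ℝ) • p.2 (x, y) = p.1 x - p.1 y}
  zero_mem' := fun x y => by simp
  add_mem' := by
    intro p q hp hq x y
    obtain ⟨h1, h2⟩ := hp x y
    obtain ⟨h3, h4⟩ := hq x y
    have e : p.1 x + q.1 x - (p.1 y + q.1 y) = (p.1 x - p.1 y) + (q.1 x - q.1 y) := by abel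
    constructor
    · simp only [Prod.snd_add, Prod.fst_add, lp.coeFn_add, Pi.add_apply]
      rw [e, h1, h3, smul_add]
    · simp only [Prod.snd_add, Prod.fst_add, lp.coeFn_add, Pi.add_apply]
      rw [e, smul_add, h2, h4]
  smul_mem' := by
    intro c p hp x y
    obtain ⟨h1, h2⟩ := hp x y
    constructor
    · simp only [Prod.smul_snd, Prod.smul_fst, lp.coeFn_smul, Pi.smul_apply]
      rw [h1, ← smul_sub, smul_comm]
    · simp only [Prod.smul_snd, Prod.smul_fst, lp.coeFn_smul, Pi.smul_apply]
      rw [← smul_sub, smul_comm, h2]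

/-- The Banach space of functions with finite `ω`-Hölder norm. -/
abbrev Hol (ω : X → X → ℝ≥0) (G : Type*) [NormedAddCommGroup G] [NormedSpace ℝ G] : Type _ :=
  ↥(holSubmodule ω G)

namespace Hol

variable {ω : X → X → ℝ≥0}

/-- The underlying function of an element of `Hol ω G`. -/
def toFun (u : Hol ω G) (x : X) : G := u.1.1 x

instance : CoeFun (Hol ω G) (fun _ => X → G) := ⟨toFun⟩

theorem quotient_eq (u : Hol ω G) (x y : X) :
    u.1.2 (x, y) = ((ω x y : ℝ)⁻¹) • (u x - u y) := (u.2 x y).1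

theorem smul_quotient_eq (u : Hol ω G) (x y : X) :
    (ω x y : ℝ) • (show G from u.1.2 (x, y)) = u x - u y := (u.2 x y).2

/-- The supremum norm of a Hölder function. -/
def sup (u : Hol ω G) : ℝ := ‖u.1.1‖

/-- The Hölder seminorm of a Hölder function. -/
def semi (u : Hol ω G) : ℝ := ‖u.1.2‖

theorem norm_eq (u : Hol ω G) : ‖u‖ = max u.sup u.semi := rfl

theorem sup_nonneg (u : Hol ω G) : 0 ≤ u.sup := norm_nonneg _

theorem semi_nonneg (u : Hol ω G) : 0 ≤ u.semi := norm_nonneg _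

theorem sup_le_norm (u : Hol ω G) : u.sup ≤ ‖u‖ := le_max_left _ _

theorem semi_le_norm (u : Hol ω G) : u.semi ≤ ‖u‖ := le_max_right _ _

theorem norm_apply_le_sup (u : Hol ω G) (x : X) : ‖u x‖ ≤ u.sup :=
  lp.norm_apply_le_norm (by simp) u.1.1 x

theorem norm_apply_le (u : Hol ω G) (x : X) : ‖u x‖ ≤ ‖u‖ :=
  (u.norm_apply_le_sup x).trans u.sup_le_norm

theorem norm_sub_le_semi (u : Hol ω G) (x y : X) : ‖u x - u y‖ ≤ u.semi * ω x y := by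
  rw [← u.smul_quotient_eq, norm_smul, mul_comm, NNReal.norm_eq]
  exact mul_le_mul_of_nonneg_right (lp.norm_apply_le_norm (by simp) u.1.2 (x, y)) (ω x y).2

theorem norm_sub_le (u : Hol ω G) (x y : X) : ‖u x - u y‖ ≤ ‖u‖ * ω x y :=
  (u.norm_sub_le_semi x y).trans (mul_le_mul_of_nonneg_right u.semi_le_norm (ω x y).coe_nonneg)

theorem sup_le {u : Hol ω G} {C : ℝ} (hC : 0 ≤ C) (h : ∀ x, ‖u x‖ ≤ C) : u.sup ≤ C :=
  lp.norm_le_of_forall_le hC h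

theorem semi_le {u : Hol ω G} {C : ℝ} (hC : 0 ≤ C) (h : ∀ x y, ‖u x - u y‖ ≤ C * ω x y) :
    u.semi ≤ C := by
  refine lp.norm_le_of_forall_le hC fun p => ?_
  obtain ⟨x, y⟩ := p
  rw [u.quotient_eq, norm_smul, norm_inv, NNReal.norm_eq]
  rcases (ω x y).coe_nonneg.eq_or_lt with h0 | h0
  · have h1 : ((ω x y : ℝ≥0) : ℝ) = 0 := h0.symm
    rw [h1]
    simpa using hC
  · have h1 : 0 < ((ω x y : ℝ≥0) : ℝ) := h0
    rw [inv_mul_le_iff₀ h1, mul_comm]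
    exact h x y

theorem norm_le {u : Hol ω G} {C : ℝ} (hC : 0 ≤ C) (h : ∀ x, ‖u x‖ ≤ C)
    (h' : ∀ x y, ‖u x - u y‖ ≤ C * ω x y) : ‖u‖ ≤ C :=
  max_le (sup_le hC h) (semi_le hC h')

@[ext] theorem ext {u v : Hol ω G} (h : ∀ x, u x = v x) : u = v := by
  apply Subtype.ext
  apply Prod.ext
  · exact lp.ext (funext h)
  · apply lp.ext
    funext p
    obtain ⟨x, y⟩ := p
    rw [u.quotient_eq, v.quotient_eq, h x, h y]

@[simp] theorem add_apply (u v : Hol ω G) (x : X) : (u + v) x = u x + v x := rfl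
@[simp] theorem sub_apply (u v : Hol ω G) (x : X) : (u - v) x = u x - v x := rfl
@[simp] theorem neg_apply (u : Hol ω G) (x : X) : (-u) x = -u x := rfl
@[simp] theorem zero_apply (x : X) : (0 : Hol ω G) x = 0 := rfl
@[simp] theorem smul_apply (c : ℝ) (u : Hol ω G) (x : X) : (c • u) x = c • u x := rfl

theorem isHol (u : Hol ω G) : IsHol ω u := ⟨‖u‖, u.norm_apply_le, u.norm_sub_le⟩

/-- The Hölder function given by a function with finite Hölder norm. -/
def mk (f : X → G) (hf : IsHol ω f) : Hol ω G :=
  ⟨(⟨f, memℓp_infty (by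
      obtain ⟨C, hC, -⟩ := hf
      exact ⟨C, by rintro _ ⟨x, rfl⟩; exact hC x⟩)⟩,
    ⟨fun p => ((ω p.1 p.2 : ℝ)⁻¹) • (f p.1 - f p.2), memℓp_infty (by
      obtain ⟨C, h0, hC⟩ := hf
      refine ⟨C, ?_⟩
      rintro _ ⟨⟨x, y⟩, rfl⟩
      have hC0 : 0 ≤ C := (norm_nonneg _).trans (h0 x)
      simp only [norm_smul, norm_inv, NNReal.norm_eq]
      rcases (ω x y).coe_nonneg.eq_or_lt with h0 | h0
      · have h1 : ((ω x y : ℝ≥0) : ℝ) = 0 := h0.symm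
        rw [h1]
        simpa using hC0
      · have h1 : 0 < ((ω x y : ℝ≥0) : ℝ) := h0
        rw [inv_mul_le_iff₀ h1, mul_comm]
        exact hC x y)⟩), by
    intro x y
    refine ⟨rfl, ?_⟩
    obtain ⟨C, -, hC⟩ := hf
    change (ω x y : ℝ) • ((ω x y : ℝ)⁻¹ • (f x - f y)) = f x - f y
    by_cases h : ((ω x y : ℝ≥0) : ℝ) = 0
    · have := hC x y
      rw [h, mul_zero, norm_le_zero_iff] at this
      rw [this, smul_zero, smul_zero]
    · rw [smul_smul, mul_inv_cancel₀ h, one_smul]⟩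

@[simp] theorem mk_apply (f : X → G) (hf : IsHol ω f) (x : X) : mk f hf x = f x := rfl

/-- The defining equations compare continuous point evaluations, so the subspace is closed in a
product of two complete `ℓ^∞` spaces. -/
instance [CompleteSpace G] : CompleteSpace (Hol ω G) := by
  have hc : IsClosed (holSubmodule ω G : Set (lp (fun _ : X => G) ∞ × lp (fun _ : X × X => G) ∞)) := by
    have e1 : ∀ x, Continuous fun p : lp (fun _ : X => G) ∞ × lp (fun _ : X × X => G) ∞ => p.1 x :=
      fun x => (lp.evalCLM ℝ (fun _ : X => G) ∞ x).continuous.comp continuous_fst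
    have e2 : ∀ x, Continuous fun p : lp (fun _ : X => G) ∞ × lp (fun _ : X × X => G) ∞ => p.2 x :=
      fun x => (lp.evalCLM ℝ (fun _ : X × X => G) ∞ x).continuous.comp continuous_snd
    have : (holSubmodule ω G : Set (lp (fun _ : X => G) ∞ × lp (fun _ : X × X => G) ∞)) =
        ⋂ x, ⋂ y, ({p | p.2 (x, y) = ((ω x y : ℝ)⁻¹) • (p.1 x - p.1 y)} ∩
          {p | (ω x y : ℝ) • p.2 (x, y) = p.1 x - p.1 y}) := by
      ext p
      simp only [Set.mem_iInter, Set.mem_inter_iff, Set.mem_ofPred_eq]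
      rfl
    rw [this]
    refine isClosed_iInter fun x => isClosed_iInter fun y => IsClosed.inter ?_ ?_
    · exact isClosed_eq (e2 _) (((e1 x).sub (e1 y)).const_smul _)
    · exact isClosed_eq ((e2 _).const_smul _) ((e1 x).sub (e1 y))
  exact hc.completeSpace_coe

/-- Evaluation at a point. -/
def evalCLM (ω : X → X → ℝ≥0) (G : Type*) [NormedAddCommGroup G] [NormedSpace ℝ G] (x : X) :
    Hol ω G →L[ℝ] G :=
  LinearMap.mkContinuous { toFun := fun u => u x, map_add' := fun _ _ => rfl,
                           map_smul' := fun _ _ => rfl } 1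
    fun u => by rw [one_mul]; exact u.norm_apply_le x

@[simp] theorem evalCLM_apply (u : Hol ω G) (x : X) : evalCLM ω G x u = u x := rfl

end Hol

namespace IsHol

variable {ω : X → X → ℝ≥0}

theorem exists_pos {f : X → G} (hf : IsHol ω f) :
    ∃ C : ℝ, 0 < C ∧ (∀ x, ‖f x‖ ≤ C) ∧ ∀ x y, ‖f x - f y‖ ≤ C * ω x y := by
  obtain ⟨C, h1, h2⟩ := hf
  refine ⟨max C 1, by positivity, fun x => (h1 x).trans (le_max_left _ _), fun x y => ?_⟩
  exact (h2 x y).trans (mul_le_mul_of_nonneg_right (le_max_left _ _) (ω x y).coe_nonneg)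

theorem const (c : G) : IsHol ω (fun _ : X => c) :=
  ⟨‖c‖, fun _ => le_rfl, fun x y => by simpa using mul_nonneg (norm_nonneg c) (ω x y).coe_nonneg⟩

theorem bilin_bound (B : G₁ →L[ℝ] G₂ →L[ℝ] G₃) (u v : G₁) (u' v' : G₂) :
    ‖B u u' - B v v'‖ ≤ ‖B‖ * (‖u‖ * ‖u' - v'‖ + ‖u - v‖ * ‖v'‖) := by
  have : B u u' - B v v' = B u (u' - v') + B (u - v) v' := by simp
  rw [this, mul_add, ← mul_assoc, ← mul_assoc]
  exact (norm_add_le _ _).trans (add_le_add (B.le_opNorm₂ _ _) (B.le_opNorm₂ _ _))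

theorem bilin (B : G₁ →L[ℝ] G₂ →L[ℝ] G₃) {f : X → G₁} {g : X → G₂} (hf : IsHol ω f)
    (hg : IsHol ω g) : IsHol ω (fun x => B (f x) (g x)) := by
  obtain ⟨C, hC, h1, h2⟩ := hf.exists_pos
  obtain ⟨D, hD, h3, h4⟩ := hg.exists_pos
  refine ⟨‖B‖ * (2 * (C * D)), fun x => ?_, fun x y => ?_⟩
  · refine (B.le_opNorm₂ _ _).trans ?_
    rw [mul_assoc]
    refine mul_le_mul_of_nonneg_left ?_ (norm_nonneg B)
    have := mul_le_mul (h1 x) (h3 x) (norm_nonneg _) hC.le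
    nlinarith [mul_pos hC hD]
  · refine (bilin_bound B _ _ _ _).trans ?_
    rw [mul_assoc]
    refine mul_le_mul_of_nonneg_left ?_ (norm_nonneg B)
    have e1 := mul_le_mul (h1 x) (h4 x y) (norm_nonneg _) hC.le
    have e2 := mul_le_mul (h2 x y) (h3 y) (norm_nonneg _) (mul_nonneg hC.le (ω x y).coe_nonneg)
    nlinarith

theorem add {f g : X → G} (hf : IsHol ω f) (hg : IsHol ω g) : IsHol ω (fun x => f x + g x) :=
  (Hol.mk f hf + Hol.mk g hg).isHol

theorem sub {f g : X → G} (hf : IsHol ω f) (hg : IsHol ω g) : IsHol ω (fun x => f x - g x) :=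
  (Hol.mk f hf - Hol.mk g hg).isHol

theorem smul (c : ℝ) {f : X → G} (hf : IsHol ω f) : IsHol ω (fun x => c • f x) :=
  (c • Hol.mk f hf).isHol

theorem sum {ι : Type*} (s : Finset ι) {f : ι → X → G} (hf : ∀ i ∈ s, IsHol ω (f i)) :
    IsHol ω (fun x => ∑ i ∈ s, f i x) := by
  classical
  induction s using Finset.induction_on with
  | empty => simpa using const (ω := ω) (X := X) (0 : G)
  | insert i s hi ih =>
    simp only [Finset.sum_insert hi]
    exact (hf i (Finset.mem_insert_self _ _)).add
      (ih fun j hj => hf j (Finset.mem_insert_of_mem hj))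

theorem mul {f : X → G₂ →L[ℝ] G₃} {g : X → G₁ →L[ℝ] G₂} (hf : IsHol ω f) (hg : IsHol ω g) :
    IsHol ω (fun x => f x ∘L g x) :=
  hf.bilin (ContinuousLinearMap.compL ℝ G₁ G₂ G₃) hg

theorem comp {f : X → G} (hf : IsHol ω f) {τ : X → X} {Λ : ℝ≥0}
    (hτ : ∀ x y, ω (τ x) (τ y) ≤ Λ * ω x y) : IsHol ω (fun x => f (τ x)) := by
  obtain ⟨C, hC, h1, h2⟩ := hf.exists_pos
  refine ⟨C * max Λ 1, fun x => ?_, fun x y => ?_⟩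
  · refine (h1 _).trans (le_mul_of_one_le_right hC.le (le_max_right _ _))
  · refine (h2 _ _).trans ?_
    rw [mul_assoc]
    refine mul_le_mul_of_nonneg_left ?_ hC.le
    have : ((ω (τ x) (τ y) : ℝ≥0) : ℝ) ≤ Λ * ω x y := by exact_mod_cast hτ x y
    exact this.trans (mul_le_mul_of_nonneg_right (le_max_left _ _) (ω x y).coe_nonneg)

end IsHol

namespace Hol

variable {ω : X → X → ℝ≥0}

/-- The pointwise application of a bounded bilinear map. -/
def bilin (ω : X → X → ℝ≥0) (B : G₁ →L[ℝ] G₂ →L[ℝ] G₃) : Hol ω G₁ →L[ℝ] Hol ω G₂ →L[ℝ] Hol ω G₃ :=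
  LinearMap.mkContinuous₂
    (LinearMap.mk₂ ℝ (fun u v => mk (fun x => B (u x) (v x)) (u.isHol.bilin B v.isHol))
      (fun u u' v => by ext x; simp) (fun c u v => by ext x; simp)
      (fun u v v' => by ext x; simp) (fun c u v => by ext x; simp)) (2 * ‖B‖) (by
    intro u v
    have hnn : 0 ≤ 2 * ‖B‖ * ‖u‖ * ‖v‖ := by positivity
    refine norm_le hnn (fun x => ?_) (fun x y => ?_)
    · refine (B.le_opNorm₂ _ _).trans ?_
      have := mul_le_mul (u.norm_apply_le x) (v.norm_apply_le x) (norm_nonneg _) (norm_nonneg _)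
      have h2 : 0 ≤ ‖u‖ * ‖v‖ := by positivity
      have h3 := norm_nonneg B
      calc ‖B‖ * ‖u x‖ * ‖v x‖ = ‖B‖ * (‖u x‖ * ‖v x‖) := by ring
        _ ≤ ‖B‖ * (‖u‖ * ‖v‖) := mul_le_mul_of_nonneg_left this h3
        _ ≤ 2 * ‖B‖ * ‖u‖ * ‖v‖ := by nlinarith [mul_nonneg h3 h2]
    · refine (IsHol.bilin_bound B _ _ _ _).trans ?_
      have e1 := mul_le_mul (u.norm_apply_le x) (v.norm_sub_le x y) (norm_nonneg _) (norm_nonneg _)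
      have e2 := mul_le_mul (u.norm_sub_le x y) (v.norm_apply_le y) (norm_nonneg _)
        (mul_nonneg (norm_nonneg _) (ω x y).coe_nonneg)
      calc ‖B‖ * (‖u x‖ * ‖v x - v y‖ + ‖u x - u y‖ * ‖v y‖)
          ≤ ‖B‖ * (‖u‖ * (‖v‖ * ω x y) + ‖u‖ * ω x y * ‖v‖) :=
            mul_le_mul_of_nonneg_left (add_le_add e1 e2) (norm_nonneg B)
        _ = 2 * ‖B‖ * ‖u‖ * ‖v‖ * ω x y := by ring)

@[simp] theorem bilin_apply (B : G₁ →L[ℝ] G₂ →L[ℝ] G₃) (u : Hol ω G₁) (v : Hol ω G₂) (x : X) :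
    bilin ω B u v x = B (u x) (v x) := rfl

/-- Composition with a map that is Lipschitz for `ω`. -/
def compCLM (G : Type*) [NormedAddCommGroup G] [NormedSpace ℝ G] (τ : X → X) (Λ : ℝ≥0)
    (hτ : ∀ x y, ω (τ x) (τ y) ≤ Λ * ω x y) : Hol ω G →L[ℝ] Hol ω G :=
  LinearMap.mkContinuous
    { toFun := fun u => mk (fun x => u (τ x)) (u.isHol.comp hτ)
      map_add' := fun u v => by ext x; simp
      map_smul' := fun c u => by ext x; simp } (max Λ 1) (by
    intro u
    have h1 : (1 : ℝ) ≤ max Λ 1 := le_max_right _ _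
    refine norm_le (by positivity) (fun x => ?_) (fun x y => ?_)
    · exact (u.norm_apply_le _).trans (le_mul_of_one_le_left (norm_nonneg _) h1)
    · refine (u.norm_sub_le _ _).trans ?_
      have : ((ω (τ x) (τ y) : ℝ≥0) : ℝ) ≤ Λ * ω x y := by exact_mod_cast hτ x y
      calc ‖u‖ * ω (τ x) (τ y) ≤ ‖u‖ * (max Λ 1 * ω x y) :=
            mul_le_mul_of_nonneg_left (this.trans
              (mul_le_mul_of_nonneg_right (le_max_left _ _) (ω x y).coe_nonneg)) (norm_nonneg _)
        _ = max Λ 1 * ‖u‖ * ω x y := by ring)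

@[simp] theorem compCLM_apply (τ : X → X) (Λ : ℝ≥0)
    (hτ : ∀ x y, ω (τ x) (τ y) ≤ Λ * ω x y) (u : Hol ω G) (x : X) :
    compCLM G τ Λ hτ u x = u (τ x) := rfl

/-- Pointwise application of a Hölder field of linear maps. -/
def mulCLM (b : X → G₁ →L[ℝ] G₂) (hb : IsHol ω b) : Hol ω G₁ →L[ℝ] Hol ω G₂ :=
  bilin ω (ContinuousLinearMap.id ℝ (G₁ →L[ℝ] G₂)) (mk b hb)

@[simp] theorem mulCLM_apply (b : X → G₁ →L[ℝ] G₂) (hb : IsHol ω b) (u : Hol ω G₁) (x : X) :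
    mulCLM b hb u x = b x (u x) := rfl

end Hol

end HolderSpace

end AnosovTorus
end

open scoped NNReal ENNReal
noncomputable section
namespace AnosovTorus

/-! ### Invertibility of the cohomological operator of a cocycle with a dichotomy -/

section Dichotomy

/-- The geometric sum commutes with `1 - M`, and their product is `1 - M ^ N`; a factor of a unit in
a commuting product is a unit. -/
theorem isUnit_one_sub_of_pow {R : Type*} [Ring R] {M : R} (N : ℕ) (h : IsUnit (1 - M ^ N)) :
    IsUnit (1 - M) := by
  have hc : Commute (1 - M) (∑ i ∈ Finset.range N, M ^ i) :=
    (mul_neg_geom_sum M N).trans (geom_sum_mul_neg M N).symm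
  rw [← mul_neg_geom_sum] at h
  exact (hc.isUnit_mul_iff.1 h).1

theorem isUnit_of_isUnit_mul_of_isUnit_mul {R : Type*} [Monoid R] {a b c : R}
    (hr : IsUnit (a * b)) (hl : IsUnit (c * a)) : IsUnit a := by
  obtain ⟨u, hu⟩ := hr
  obtain ⟨v, hv⟩ := hl
  have e1 : a * (b * ↑u⁻¹) = 1 := by rw [← mul_assoc, ← hu, Units.mul_inv]
  have e2 : ↑v⁻¹ * c * a = 1 := by rw [mul_assoc, ← hv, Units.inv_mul]
  have e3 := left_inv_eq_right_inv e2 e1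
  exact ⟨⟨a, b * ↑u⁻¹, e1, by rw [← e3]; exact e2⟩, rfl⟩

/-- An approximate dichotomy for the powers of an invertible element `M` makes `1 - M`
invertible. -/
theorem isUnit_one_sub_of_dichotomy {R : Type*} [Ring R] {M M' P : R} (h1 : M * M' = 1)
    (h2 : M' * M = 1) (N : ℕ) (hr : IsUnit (1 - (M ^ N * P + M' ^ N * (1 - P))))
    (hl : IsUnit (1 - (P * M ^ N + (1 - P) * M' ^ N))) : IsUnit (1 - M) := by
  have hc : Commute M M' := h1.trans h2.symm
  have e1 : M ^ N * M' ^ N = 1 := by rw [← hc.mul_pow, h1, one_pow]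
  have e2 : M' ^ N * M ^ N = 1 := by rw [← hc.symm.mul_pow, h2, one_pow]
  apply isUnit_one_sub_of_pow N
  -- Where `M ^ N` is small, `1 - M ^ N` is close to `1`; where `M' ^ N` is small, `1 - M ^ N = -M ^
  -- N (1 - M' ^ N)` has approximate inverse `-M' ^ N`. As `P` need not commute with `M`, the
  -- approximate inverses on the right and on the left differ.
  apply isUnit_of_isUnit_mul_of_isUnit_mul (b := P - M' ^ N * (1 - P))
    (c := P - (1 - P) * M' ^ N)
  · have : (1 - M ^ N) * (P - M' ^ N * (1 - P)) = 1 - (M ^ N * P + M' ^ N * (1 - P)) := by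
      have : (1 - M ^ N) * (P - M' ^ N * (1 - P)) =
        P - M' ^ N * (1 - P) - M ^ N * P + (M ^ N * M' ^ N) * (1 - P) := by noncomm_ring
      rw [this, e1]
      noncomm_ring
    rwa [this]
  · have : (P - (1 - P) * M' ^ N) * (1 - M ^ N) = 1 - (P * M ^ N + (1 - P) * M' ^ N) := by
      have : (P - (1 - P) * M' ^ N) * (1 - M ^ N) =
        P - (1 - P) * M' ^ N - P * M ^ N + (1 - P) * (M' ^ N * M ^ N) := by noncomm_ring
      rw [this, e2]
      noncomm_ring
    rwa [this]

variable {X : Type*} {G : Type*} [NormedAddCommGroup G] [NormedSpace ℝ G]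
  {ω : X → X → ℝ≥0}

/-- An inequality of Doeblin–Fortet type: `T` contracts the sup norm, and contracts the seminorm up
to a multiple of the sup norm. In the equivalent norm `sup + η semi` with small `η` it is then a
strict contraction, and some power of it has norm below one in the original norm. -/
theorem Hol.isUnit_one_sub_of_bounds [CompleteSpace G] (T : Hol ω G →L[ℝ] Hol ω G) {θ K : ℝ}
    (hθ0 : 0 ≤ θ) (hθ : θ < 1) (hK : 0 ≤ K) (h1 : ∀ u, (T u).sup ≤ θ * u.sup)
    (h2 : ∀ u, (T u).semi ≤ θ * u.semi + K * u.sup) : IsUnit (1 - T) := by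
  -- With `η K ≤ (1 - θ) / 2` the cross term raises the contraction rate only from `θ` to `θ' = (1 +
  -- θ) / 2 < 1`.
  set η : ℝ := (1 - θ) / (2 * (K + 1)) with hη
  have hη0 : 0 < η := by apply div_pos <;> linarith
  have hηK : η * K ≤ (1 - θ) / 2 := by
    rw [hη, div_mul_eq_mul_div, div_le_div_iff₀ (by linarith) (by norm_num)]
    nlinarith
  set θ' : ℝ := (1 + θ) / 2 with hθ'
  have hθ'0 : 0 ≤ θ' := by linarith
  have step : ∀ u, (T u).sup + η * (T u).semi ≤ θ' * (u.sup + η * u.semi) := by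
    intro u
    have e1 := h1 u
    have e2 := mul_le_mul_of_nonneg_left (h2 u) hη0.le
    have e3 := mul_le_mul_of_nonneg_right hηK u.sup_nonneg
    have e4 : θ * (η * u.semi) ≤ θ' * (η * u.semi) :=
      mul_le_mul_of_nonneg_right (by linarith) (mul_nonneg hη0.le u.semi_nonneg)
    rw [hθ'] at *
    nlinarith
  have iter : ∀ n u, ((T ^ n) u).sup + η * ((T ^ n) u).semi ≤ θ' ^ n * (u.sup + η * u.semi) := by
    intro n
    induction n with
    | zero => intro u; simp
    | succ n ih =>
      intro u
      rw [pow_succ]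
      change ((T ^ n) (T u)).sup + η * ((T ^ n) (T u)).semi ≤ _
      refine (ih (T u)).trans ?_
      rw [pow_succ, mul_assoc]
      exact mul_le_mul_of_nonneg_left (step u) (pow_nonneg hθ'0 n)
  -- The product of the two constants that compare `max sup semi` with `sup + η semi`.
  set c : ℝ := (1 + η⁻¹) * (1 + η) with hc
  have hc0 : 0 < c := by positivity
  have bound : ∀ n, ‖T ^ n‖ ≤ c * θ' ^ n := by
    intro n
    refine ContinuousLinearMap.opNorm_le_bound _ (by positivity) fun u => ?_
    have e1 := iter n u
    have hs := ((T ^ n) u).sup_nonneg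
    have hs' := ((T ^ n) u).semi_nonneg
    have e2 : ‖(T ^ n) u‖ ≤ (1 + η⁻¹) * (((T ^ n) u).sup + η * ((T ^ n) u).semi) := by
      rw [Hol.norm_eq]
      have : (1 + η⁻¹) * (((T ^ n) u).sup + η * ((T ^ n) u).semi) =
          ((T ^ n) u).sup + η * ((T ^ n) u).semi + η⁻¹ * ((T ^ n) u).sup + ((T ^ n) u).semi := by
        field_simp
        ring
      rw [this]
      have : 0 ≤ η⁻¹ * ((T ^ n) u).sup := by positivity
      have : 0 ≤ η * ((T ^ n) u).semi := by positivity
      exact max_le (by linarith) (by linarith)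
    have e3 : u.sup + η * u.semi ≤ (1 + η) * ‖u‖ := by
      have := u.sup_le_norm
      have := mul_le_mul_of_nonneg_left u.semi_le_norm hη0.le
      linarith
    calc ‖(T ^ n) u‖ ≤ (1 + η⁻¹) * (θ' ^ n * ((1 + η) * ‖u‖)) := by
          refine e2.trans (mul_le_mul_of_nonneg_left (e1.trans ?_) (by positivity))
          exact mul_le_mul_of_nonneg_left e3 (by positivity)
      _ = c * θ' ^ n * ‖u‖ := by rw [hc]; ring
  obtain ⟨n, hn⟩ := exists_pow_lt_of_lt_one (inv_pos.2 hc0) (show θ' < 1 by linarith)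
  refine isUnit_one_sub_of_pow (R := Hol ω G →L[ℝ] Hol ω G) n ?_
  refine isUnit_one_sub_of_norm_lt_one (R := Hol ω G →L[ℝ] Hol ω G) ?_
  refine (bound n).trans_lt ?_
  calc c * θ' ^ n < c * c⁻¹ := mul_lt_mul_of_pos_left hn hc0
    _ = 1 := mul_inv_cancel₀ hc0.ne'

/-- Each term contributes at most `1 / 8 * 2 = 1 / 4` times the seminorm of `u`, so `θ = 1 / 2`
works. The variation of the weights `b₁`, `b₂` only costs a multiple of the sup norm, however large
their Hölder constants. -/
theorem Hol.isUnit_one_sub_of_weighted [CompleteSpace G] (T : Hol ω G →L[ℝ] Hol ω G)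
    {b₁ b₂ : X → G →L[ℝ] G} {τ₁ τ₂ : X → X} (hb₁ : IsHol ω b₁) (hb₂ : IsHol ω b₂)
    (h₁ : ∀ x, ‖b₁ x‖ ≤ 1 / 8) (h₂ : ∀ x, ‖b₂ x‖ ≤ 1 / 8)
    (hτ₁ : ∀ x y, ω (τ₁ x) (τ₁ y) ≤ 2 * ω x y) (hτ₂ : ∀ x y, ω (τ₂ x) (τ₂ y) ≤ 2 * ω x y)
    (hT : ∀ u x, T u x = b₁ x (u (τ₁ x)) + b₂ x (u (τ₂ x))) : IsUnit (1 - T) := by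
  obtain ⟨C, hC, -, hC1⟩ := hb₁.exists_pos
  obtain ⟨D, hD, -, hD1⟩ := hb₂.exists_pos
  have key : ∀ (b : X → G →L[ℝ] G) (τ : X → X) (C : ℝ), 0 < C → (∀ x, ‖b x‖ ≤ 1 / 8) →
      (∀ x y, ω (τ x) (τ y) ≤ 2 * ω x y) → (∀ x y, ‖b x - b y‖ ≤ C * ω x y) →
      ∀ (u : Hol ω G) x y, ‖b x (u (τ x)) - b y (u (τ y))‖ ≤
        (1 / 4 * u.semi + C * u.sup) * ω x y := by
    intro b τ C hC hb hτ hb' u x y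
    have : b x (u (τ x)) - b y (u (τ y)) = b x (u (τ x) - u (τ y)) + (b x - b y) (u (τ y)) := by
      simp
    rw [this]
    have e1 : ‖b x (u (τ x) - u (τ y))‖ ≤ 1 / 8 * (u.semi * (2 * ω x y)) := by
      refine (ContinuousLinearMap.le_of_opNorm_le _ (hb x) _).trans ?_
      refine mul_le_mul_of_nonneg_left ((u.norm_sub_le_semi _ _).trans ?_) (by norm_num)
      exact mul_le_mul_of_nonneg_left (by exact_mod_cast hτ x y) u.semi_nonneg
    have e2 : ‖(b x - b y) (u (τ y))‖ ≤ C * ω x y * u.sup :=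
      (ContinuousLinearMap.le_of_opNorm_le _ (hb' x y) _).trans
        (mul_le_mul_of_nonneg_left (u.norm_apply_le_sup _) (by positivity))
    refine (norm_add_le _ _).trans ((add_le_add e1 e2).trans (le_of_eq ?_))
    ring
  refine Hol.isUnit_one_sub_of_bounds T (θ := 1 / 2) (K := C + D) (by norm_num) (by norm_num)
    (by positivity) (fun u => ?_) (fun u => ?_)
  · refine Hol.sup_le (mul_nonneg (by norm_num) u.sup_nonneg) fun x => ?_
    rw [hT]
    have hb : ∀ (b : X → G →L[ℝ] G) (y z : X), (∀ x, ‖b x‖ ≤ 1 / 8) →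
        ‖b y (u z)‖ ≤ 1 / 8 * u.sup := fun b y z hb =>
      (ContinuousLinearMap.le_of_opNorm_le _ (hb y) _).trans
        (mul_le_mul_of_nonneg_left (u.norm_apply_le_sup _) (by norm_num))
    refine (norm_add_le _ _).trans ((add_le_add (hb b₁ x _ h₁) (hb b₂ x _ h₂)).trans ?_)
    linarith [u.sup_nonneg]
  · refine Hol.semi_le (by have := u.sup_nonneg; have := u.semi_nonneg; positivity)
      fun x y => ?_
    rw [hT, hT, add_sub_add_comm]
    refine (norm_add_le _ _).trans ((add_le_add (key b₁ τ₁ C hC h₁ hτ₁ hC1 u x y)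
      (key b₂ τ₂ D hD h₂ hτ₂ hD1 u x y)).trans (le_of_eq ?_))
    ring

/-- The cocycle `a(σ^(n-1) x) ⋯ a(σ x) a(x)`. -/
def coc (σ : X → X) (a : X → G →L[ℝ] G) : ℕ → X → G →L[ℝ] G
  | 0, _ => ContinuousLinearMap.id ℝ G
  | n + 1, x => coc σ a n (σ x) ∘L a x

/-- The cocycle `a'(x) a'(σ x) ⋯ a'(σ^(n-1) x)`. -/
def cocInv (σ : X → X) (a' : X → G →L[ℝ] G) : ℕ → X → G →L[ℝ] G
  | 0, _ => ContinuousLinearMap.id ℝ G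
  | n + 1, x => a' x ∘L cocInv σ a' n (σ x)

theorem cocInv_comp_coc {σ : X → X} {a a' : X → G →L[ℝ] G}
    (h : ∀ x, a' x ∘L a x = ContinuousLinearMap.id ℝ G) (n : ℕ) (x : X) :
    cocInv σ a' n x ∘L coc σ a n x = ContinuousLinearMap.id ℝ G := by
  induction n generalizing x with
  | zero => rfl
  | succ n ih =>
    ext v
    have := DFunLike.congr_fun (ih (σ x)) (a x v)
    have h2 := DFunLike.congr_fun (h x) v
    simp only [ContinuousLinearMap.comp_apply, ContinuousLinearMap.id_apply] at this h2 ⊢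
    simp only [coc, cocInv, ContinuousLinearMap.comp_apply]
    rw [this, h2]

theorem coc_comp_cocInv {σ : X → X} {a a' : X → G →L[ℝ] G}
    (h : ∀ x, a x ∘L a' x = ContinuousLinearMap.id ℝ G) (n : ℕ) (x : X) :
    coc σ a n x ∘L cocInv σ a' n x = ContinuousLinearMap.id ℝ G := by
  induction n generalizing x with
  | zero => rfl
  | succ n ih =>
    ext v
    have h2 := DFunLike.congr_fun (h x) (cocInv σ a' n (σ x) v)
    have := DFunLike.congr_fun (ih (σ x)) v
    simp only [ContinuousLinearMap.comp_apply, ContinuousLinearMap.id_apply] at this h2 ⊢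
    simp only [coc, cocInv, ContinuousLinearMap.comp_apply]
    rw [h2, this]

theorem IsHol.coc {σ : X → X} {Λ : ℝ≥0} (hσ : ∀ x y, ω (σ x) (σ y) ≤ Λ * ω x y)
    {a : X → G →L[ℝ] G} (ha : IsHol ω a) (n : ℕ) : IsHol ω (coc σ a n) := by
  induction n with
  | zero => exact IsHol.const _
  | succ n ih => exact (ih.comp hσ).mul ha

theorem IsHol.cocInv {σ : X → X} {Λ : ℝ≥0} (hσ : ∀ x y, ω (σ x) (σ y) ≤ Λ * ω x y)
    {a : X → G →L[ℝ] G} (ha : IsHol ω a) (n : ℕ) : IsHol ω (cocInv σ a n) := by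
  induction n with
  | zero => exact IsHol.const _
  | succ n ih => exact ha.mul (ih.comp hσ)

theorem weight_iterate_le {σ : X → X} {Λ : ℝ≥0} (hσ : ∀ x y, ω (σ x) (σ y) ≤ Λ * ω x y) (n : ℕ)
    (x y : X) : ω (σ^[n] x) (σ^[n] y) ≤ Λ ^ n * ω x y := by
  induction n with
  | zero => simp
  | succ n ih =>
    rw [Function.iterate_succ_apply', Function.iterate_succ_apply', pow_succ', mul_assoc]
    exact (hσ _ _).trans (mul_le_mul_right ih _)

/-- For a cocycle over `σ` with a dichotomy, the operator `w ↦ a w - w ∘ σ` is invertible on the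
Hölder functions. -/
theorem exists_equiv_of_dichotomy [CompleteSpace G] (σ : Equiv.Perm X) {Λ : ℝ≥0}
    (hσ : ∀ x y, ω (σ x) (σ y) ≤ Λ * ω x y)
    (hσ' : ∀ x y, ω (σ.symm x) (σ.symm y) ≤ Λ * ω x y) (N : ℕ) (hΛ : Λ ^ N ≤ 2)
    {a a' P : X → G →L[ℝ] G} (ha : IsHol ω a) (ha' : IsHol ω a') (hP : IsHol ω P)
    (inv₁ : ∀ x, a' x ∘L a x = ContinuousLinearMap.id ℝ G)
    (inv₂ : ∀ x, a x ∘L a' x = ContinuousLinearMap.id ℝ G)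
    (h₁ : ∀ x, ‖coc σ a N x ∘L P x‖ ≤ 1 / 8)
    (h₂ : ∀ x, ‖P (σ^[N] x) ∘L coc σ a N x‖ ≤ 1 / 8)
    (h₃ : ∀ x, ‖cocInv σ a' N x ∘L (ContinuousLinearMap.id ℝ G - P (σ^[N] x))‖ ≤ 1 / 8)
    (h₄ : ∀ x, ‖(ContinuousLinearMap.id ℝ G - P x) ∘L cocInv σ a' N x‖ ≤ 1 / 8) :
    ∃ e : Hol ω G ≃L[ℝ] Hol ω G, ∀ w x, e w x = a x (w x) - w (σ x) := by
  set C := Hol.compCLM G σ Λ hσ with hC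
  set C' := Hol.compCLM G σ.symm Λ hσ' with hC'
  -- `M` is the transfer operator `w ↦ (a w) ∘ σ⁻¹` and `M'` its inverse. Then `a w - w ∘ σ = -((1 -
  -- M) w) ∘ σ`, so it suffices to invert `1 - M`.
  set M : Hol ω G →L[ℝ] Hol ω G := C' * Hol.mulCLM a ha with hM
  set M' : Hol ω G →L[ℝ] Hol ω G := Hol.mulCLM a' ha' * C with hM'
  set Q : Hol ω G →L[ℝ] Hol ω G := Hol.mulCLM P hP with hQ
  have hMa : ∀ u x, M u x = a (σ.symm x) (u (σ.symm x)) := fun u x => rfl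
  have hM'a : ∀ u x, M' u x = a' x (u (σ x)) := fun u x => rfl
  have hQa : ∀ u x, Q u x = P x (u x) := fun u x => rfl
  have e1 : M * M' = 1 := by
    ext u x
    change M (M' u) x = u x
    rw [hMa, hM'a, Equiv.apply_symm_apply]
    exact DFunLike.congr_fun (inv₂ _) _
  have e2 : M' * M = 1 := by
    ext u x
    change M' (M u) x = u x
    rw [hM'a, hMa, Equiv.symm_apply_apply]
    exact DFunLike.congr_fun (inv₁ _) _
  have hMn : ∀ n u x, (M ^ n) u x = coc σ a n (σ.symm^[n] x) (u (σ.symm^[n] x)) := by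
    intro n
    induction n with
    | zero => intro u x; rfl
    | succ n ih =>
      intro u x
      rw [pow_succ]
      change (M ^ n) (M u) x = _
      rw [ih, hMa, Function.iterate_succ_apply']
      simp only [coc, ContinuousLinearMap.comp_apply, Equiv.apply_symm_apply]
  have hM'n : ∀ n u x, (M' ^ n) u x = cocInv σ a' n x (u (σ^[n] x)) := by
    intro n
    induction n with
    | zero => intro u x; rfl
    | succ n ih =>
      intro u x
      rw [pow_succ']
      change M' ((M' ^ n) u) x = _
      rw [hM'a, ih, Function.iterate_succ_apply]
      simp only [cocInv, ContinuousLinearMap.comp_apply]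
  have hw : ∀ x y, ω (σ^[N] x) (σ^[N] y) ≤ 2 * ω x y := fun x y =>
    (weight_iterate_le hσ N x y).trans (mul_le_mul_left hΛ _)
  have hw' : ∀ x y, ω (σ.symm^[N] x) (σ.symm^[N] y) ≤ 2 * ω x y := fun x y =>
    (weight_iterate_le hσ' N x y).trans (mul_le_mul_left hΛ _)
  have hback : ∀ x, σ^[N] (σ.symm^[N] x) = x :=
    fun x => (Function.LeftInverse.iterate σ.apply_symm_apply N) x
  have hid : IsHol ω fun _ : X => ContinuousLinearMap.id ℝ G := IsHol.const _
  -- Both error terms of the dichotomy are sums of two weighted compositions, with `σ⁻ᴺ` and with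
  -- `σᴺ`. The weights are the four quantities bounded by `1 / 8`.
  have hunit : IsUnit (1 - M) := by
    apply isUnit_one_sub_of_dichotomy e1 e2 N (P := Q)
    · refine Hol.isUnit_one_sub_of_weighted _ (τ₁ := σ.symm^[N]) (τ₂ := σ^[N])
        (b₁ := fun x => coc σ a N (σ.symm^[N] x) ∘L P (σ.symm^[N] x))
        (b₂ := fun x => cocInv σ a' N x ∘L (ContinuousLinearMap.id ℝ G - P (σ^[N] x)))
        (((ha.coc hσ N).mul hP).comp hw') ((ha'.cocInv hσ N).mul (hid.sub (hP.comp hw)))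
        (fun x => h₁ _) h₃ hw' hw ?_
      intro u x
      change (M ^ N) (Q u) x + (M' ^ N) (u - Q u) x = _
      rw [hMn, hM'n]
      rfl
    · refine Hol.isUnit_one_sub_of_weighted _ (τ₁ := σ.symm^[N]) (τ₂ := σ^[N])
        (b₁ := fun x => P x ∘L coc σ a N (σ.symm^[N] x))
        (b₂ := fun x => (ContinuousLinearMap.id ℝ G - P x) ∘L cocInv σ a' N x)
        (hP.mul ((ha.coc hσ N).comp hw')) ((hid.sub hP).mul (ha'.cocInv hσ N))
        (fun x => ?_) h₄ hw' hw ?_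
      · have := h₂ (σ.symm^[N] x)
        rwa [hback] at this
      · intro u x
        change Q ((M ^ N) u) x + ((M' ^ N) u - Q ((M' ^ N) u)) x = _
        rw [Hol.sub_apply, hQa, hQa, hMn, hM'n]
        rfl
  obtain ⟨U, hU⟩ := hunit
  set Cu : (Hol ω G →L[ℝ] Hol ω G)ˣ := ⟨C, C', by
    ext u x
    change u (σ.symm (σ x)) = u x
    rw [Equiv.symm_apply_apply], by
    ext u x
    change u (σ (σ.symm x)) = u x
    rw [Equiv.apply_symm_apply]⟩ with hCu
  refine ⟨(ContinuousLinearEquiv.unitsEquiv ℝ _ (Cu * U)).trans (ContinuousLinearEquiv.neg ℝ), fun w x => ?_⟩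
  change -((U : Hol ω G →L[ℝ] Hol ω G) w (σ x)) = _
  rw [hU]
  change -((w - M w) (σ x)) = _
  rw [Hol.sub_apply, hMa, Equiv.symm_apply_apply, neg_sub]

theorem norm_coc_le {σ : X → X} {a : X → G →L[ℝ] G} {K : ℝ} (hK : 1 ≤ K)
    (ha : ∀ x, ‖a x‖ ≤ K) (n : ℕ) (x : X) : ‖coc σ a n x‖ ≤ K ^ n := by
  induction n generalizing x with
  | zero => simpa [coc] using ContinuousLinearMap.norm_id_le
  | succ n ih =>
    rw [pow_succ]
    exact (ContinuousLinearMap.opNorm_comp_le _ _).trans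
      (mul_le_mul (ih _) (ha x) (norm_nonneg _) (by positivity))

/-- A bounded function `k` is controlled by `a k - k ∘ σ`. -/
theorem norm_le_of_dichotomy {σ : X → X} (hσ : Function.Surjective σ) {a a' P : X → G →L[ℝ] G}
    {K p : ℝ} (hK : 1 ≤ K) (ha : ∀ x, ‖a x‖ ≤ K) (hp : ∀ x, ‖P x‖ ≤ p)
    (inv₁ : ∀ x, a' x ∘L a x = ContinuousLinearMap.id ℝ G) (N : ℕ)
    (h₂ : ∀ x, ‖P (σ^[N] x) ∘L coc σ a N x‖ ≤ 1 / 8)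
    (h₄ : ∀ x, ‖(ContinuousLinearMap.id ℝ G - P x) ∘L cocInv σ a' N x‖ ≤ 1 / 8)
    {k : X → G} {κ φ : ℝ} (hφ : 0 ≤ φ) (hk : ∀ x, ‖k x‖ ≤ κ)
    (hf : ∀ x, ‖a x (k x) - k (σ x)‖ ≤ φ) (x : X) :
    ‖k x‖ ≤ κ / 4 + (p + 1) * (N * K ^ N) * φ := by
  have hF : ∀ n x, ‖coc σ a n x (k x) - k (σ^[n] x)‖ ≤ n * K ^ n * φ := by
    intro n
    induction n with
    | zero => intro x; simp [coc]
    | succ n ih =>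
      intro x
      have : coc σ a (n + 1) x (k x) - k (σ^[n + 1] x) =
          coc σ a n (σ x) (a x (k x) - k (σ x)) +
            (coc σ a n (σ x) (k (σ x)) - k (σ^[n] (σ x))) := by
        simp [coc, Function.iterate_succ_apply]
      rw [this]
      have e1 : ‖coc σ a n (σ x) (a x (k x) - k (σ x))‖ ≤ K ^ n * φ :=
        (ContinuousLinearMap.le_of_opNorm_le _ (norm_coc_le hK ha n _) _).trans
          (mul_le_mul_of_nonneg_left (hf x) (by positivity))
      refine (norm_add_le _ _).trans ((add_le_add e1 (ih (σ x))).trans ?_)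
      have : K ^ n ≤ K ^ (n + 1) := pow_le_pow_right₀ hK (Nat.le_succ n)
      calc K ^ n * φ + n * K ^ n * φ = (n + 1) * K ^ n * φ := by ring
        _ ≤ (n + 1) * K ^ (n + 1) * φ := by gcongr
        _ = ((n + 1 : ℕ) : ℝ) * K ^ (n + 1) * φ := by push_cast; ring
  set B : ℝ := N * K ^ N * φ with hB
  have hB0 : 0 ≤ B := by positivity
  have hp0 : 0 ≤ p := (norm_nonneg _).trans (hp x)
  -- The part of `k` in the range of `P` is computed from `N` steps in the past, where the cocycle
  -- contracts; the accumulated defect is bounded by `B`.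
  have stable : ∀ y, ‖P y (k y)‖ ≤ κ / 8 + p * B := by
    intro y
    obtain ⟨x, rfl⟩ := (hσ.iterate N) y
    have : P (σ^[N] x) (k (σ^[N] x)) = (P (σ^[N] x) ∘L coc σ a N x) (k x) -
        P (σ^[N] x) (coc σ a N x (k x) - k (σ^[N] x)) := by simp
    rw [this]
    have e1 : ‖(P (σ^[N] x) ∘L coc σ a N x) (k x)‖ ≤ 1 / 8 * κ :=
      (ContinuousLinearMap.le_of_opNorm_le _ (h₂ x) _).trans
        (mul_le_mul_of_nonneg_left (hk x) (by norm_num))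
    have e2 : ‖P (σ^[N] x) (coc σ a N x (k x) - k (σ^[N] x))‖ ≤ p * B :=
      (ContinuousLinearMap.le_of_opNorm_le _ (hp _) _).trans
        (mul_le_mul_of_nonneg_left (hF N x) hp0)
    refine (norm_sub_le _ _).trans ?_
    linarith
  -- The complementary part is computed from `N` steps in the future, where the inverse cocycle
  -- contracts.
  have unstable : ‖k x - P x (k x)‖ ≤ κ / 8 + B := by
    have h0 := DFunLike.congr_fun (cocInv_comp_coc (σ := σ) inv₁ N x) (k x)
    have : k x - P x (k x) = ((ContinuousLinearMap.id ℝ G - P x) ∘L cocInv σ a' N x)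
        (k (σ^[N] x)) + ((ContinuousLinearMap.id ℝ G - P x) ∘L cocInv σ a' N x)
        (coc σ a N x (k x) - k (σ^[N] x)) := by
      rw [← map_add, add_sub_cancel, ContinuousLinearMap.comp_apply]
      rw [ContinuousLinearMap.comp_apply] at h0
      rw [h0]
      simp
    rw [this]
    have e1 := (ContinuousLinearMap.le_of_opNorm_le _ (h₄ x) (k (σ^[N] x))).trans
        (mul_le_mul_of_nonneg_left (hk _) (by norm_num))
    have e2 := (ContinuousLinearMap.le_of_opNorm_le _ (h₄ x)
      (coc σ a N x (k x) - k (σ^[N] x))).trans (mul_le_mul_of_nonneg_left (hF N x) (by norm_num))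
    refine (norm_add_le _ _).trans ?_
    linarith
  have : k x = P x (k x) + (k x - P x (k x)) := by abel
  rw [this]
  refine (norm_add_le _ _).trans ((add_le_add (stable x) unstable).trans (le_of_eq ?_))
  rw [hB]
  ring

end Dichotomy

end AnosovTorus
end

open scoped NNReal ENNReal
noncomputable section
namespace AnosovTorus

/-! ### Taylor expansions of analytic maps, uniform on compact sets -/

section TaylorBounds

open scoped Nat

variable {V G : Type*} [NormedAddCommGroup V] [NormedSpace ℝ V] [NormedAddCommGroup G]
  [NormedSpace ℝ G]

/-- The Taylor series of `f` converges to `f` on balls of radius `ρ` about the points of `s`, with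
coefficients `O(ρ⁻¹ ^ n)` uniformly on `s`. -/
def HasUniformTaylor (f : V → G) (ρ C : ℝ) (s : Set V) : Prop :=
  ∀ y ∈ s, (∀ n, ‖iteratedFDeriv ℝ n f y‖ ≤ C * n ! * ρ⁻¹ ^ n) ∧
    ∀ v, ‖v‖ < ρ → HasSum (fun n => ((n ! : ℝ))⁻¹ • iteratedFDeriv ℝ n f y (fun _ => v)) (f (y + v))

theorem HasUniformTaylor.mono {f : V → G} {ρ ρ' C C' : ℝ} {s t : Set V}
    (h : HasUniformTaylor f ρ C s) (hρ : ρ' ≤ ρ) (hρ' : 0 < ρ') (hC0 : 0 ≤ C) (hC : C ≤ C')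
    (hs : t ⊆ s) : HasUniformTaylor f ρ' C' t := by
  intro y hy
  obtain ⟨h1, h2⟩ := h y (hs hy)
  refine ⟨fun n => (h1 n).trans ?_, fun v hv => h2 v (hv.trans_le hρ)⟩
  have : ρ⁻¹ ^ n ≤ ρ'⁻¹ ^ n :=
    pow_le_pow_left₀ (inv_nonneg.2 (hρ'.le.trans hρ)) (inv_anti₀ hρ' hρ) n
  have h3 : C * n ! ≤ C' * n ! := mul_le_mul_of_nonneg_right hC (by positivity)
  have h4 : (0 : ℝ) ≤ C * n ! := by positivity
  exact mul_le_mul h3 this (pow_nonneg (inv_nonneg.2 (hρ'.le.trans hρ)) n) (h4.trans h3)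

variable [CompleteSpace G]

theorem HasFPowerSeriesOnBall.norm_iteratedFDeriv_le {f : V → G}
    {p : FormalMultilinearSeries ℝ V G} {x : V} {r : ℝ≥0∞} (h : HasFPowerSeriesOnBall f p x r)
    (n : ℕ) : ‖iteratedFDeriv ℝ n f x‖ ≤ n ! * ‖p n‖ := by
  refine ContinuousMultilinearMap.opNorm_le_bound (by positivity) fun v => ?_
  rw [h.iteratedFDeriv_eq_sum_of_completeSpace]
  refine (norm_sum_le _ _).trans ?_
  have : ∀ σ ∈ (Finset.univ : Finset (Equiv.Perm (Fin n))),
      ‖p n fun i => v (σ i)‖ ≤ ‖p n‖ * ∏ i, ‖v i‖ := by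
    intro σ _
    refine ((p n).le_opNorm _).trans (le_of_eq ?_)
    rw [Equiv.prod_comp σ fun i => ‖v i‖]
  refine (Finset.sum_le_card_nsmul _ _ _ this).trans (le_of_eq ?_)
  rw [Finset.card_univ, Fintype.card_perm, Fintype.card_fin, nsmul_eq_mul, mul_assoc]

theorem HasFPowerSeriesOnBall.inv_factorial_smul_iteratedFDeriv {f : V → G}
    {p : FormalMultilinearSeries ℝ V G} {x : V} {r : ℝ≥0∞} (h : HasFPowerSeriesOnBall f p x r)
    (n : ℕ) (v : V) : ((n ! : ℝ))⁻¹ • iteratedFDeriv ℝ n f x (fun _ => v) = p n fun _ => v := by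
  rw [h.iteratedFDeriv_eq_sum_of_completeSpace, Finset.sum_const, Finset.card_univ,
    Fintype.card_perm, Fintype.card_fin, ← Nat.cast_smul_eq_nsmul ℝ, smul_smul,
    inv_mul_cancel₀ (by positivity), one_smul]

/-- Re-expansion of one power series about all points at distance less than `ρ` from the centre.
Since `2 ρ` is below the radius of convergence, the full triple series of the re-expansion is
summable. -/
theorem HasFPowerSeriesOnBall.exists_hasUniformTaylor {f : V → G}
    {p : FormalMultilinearSeries ℝ V G} {x : V} {r : ℝ≥0∞} (h : HasFPowerSeriesOnBall f p x r) :
    ∃ ρ C : ℝ, 0 < ρ ∧ 0 ≤ C ∧ HasUniformTaylor f ρ C (Metric.ball x ρ) := by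
  obtain ⟨ρ, hρ0, hρ⟩ : ∃ ρ : ℝ≥0, 0 < ρ ∧ (ρ : ℝ≥0∞) + ρ < r := by
    obtain ⟨q, hq0, hq⟩ := ENNReal.lt_iff_exists_nnreal_btwn.1 h.r_pos
    refine ⟨q / 2, by simpa using hq0, ?_⟩
    rw [← ENNReal.coe_add, add_halves]
    exact hq
  have hρp : (ρ : ℝ≥0∞) + ρ < p.radius := hρ.trans_le h.r_le
  have hsum := p.changeOriginSeries_summable_aux₁ hρp
  -- This one sum bounds `ρ ^ n` times the `n`-th re-expanded coefficient, for every `n` and every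
  -- new centre.
  set S : ℝ≥0 := ∑' s : Σ k l : ℕ, { s : Finset (Fin (k + l)) // s.card = l },
    ‖p (s.1 + s.2.1)‖₊ * ρ ^ s.2.1 * ρ ^ s.1 with hS
  refine ⟨ρ, S, by exact_mod_cast hρ0, S.coe_nonneg, fun y hy => ?_⟩
  obtain ⟨z, rfl⟩ : ∃ z, y = x + z := ⟨y - x, by abel⟩
  have hz : ‖z‖₊ < ρ := by
    rw [Metric.mem_ball, dist_eq_norm, add_sub_cancel_left] at hy
    exact_mod_cast hy
  have hzr : (‖z‖₊ : ℝ≥0∞) < r := by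
    refine lt_of_lt_of_le (ENNReal.coe_lt_coe.2 hz) (le_self_add.trans hρ.le)
  have hco := h.changeOrigin hzr
  constructor
  · intro n
    refine (HasFPowerSeriesOnBall.norm_iteratedFDeriv_le hco n).trans ?_
    have key : ‖p.changeOrigin z n‖₊ * ρ ^ n ≤ S := by
      have h1 : ‖p.changeOrigin z n‖₊ ≤
          ∑' s : Σ l : ℕ, { s : Finset (Fin (n + l)) // s.card = l },
            ‖p (n + s.1)‖₊ * ρ ^ s.1 := by
        refine (p.nnnorm_changeOrigin_le n (hzr.trans_le h.r_le)).trans ?_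
        refine (p.changeOriginSeries_summable_aux₂ (hzr.trans_le h.r_le) n).tsum_le_tsum ?_
          (p.changeOriginSeries_summable_aux₂ (lt_of_le_of_lt le_self_add hρp) n)
        intro s
        exact mul_le_mul_right (pow_le_pow_left₀ zero_le hz.le _) _
      refine (mul_le_mul_left h1 _).trans ?_
      rw [← NNReal.tsum_mul_right]
      have h2 := (NNReal.summable_sigma.1 hsum)
      rw [hS, hsum.tsum_sigma' h2.1]
      exact h2.2.le_tsum n fun _ _ => zero_le
    have key' : ‖p.changeOrigin z n‖ * (ρ : ℝ) ^ n ≤ S := by exact_mod_cast key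
    have hρn : (0 : ℝ) < (ρ : ℝ) ^ n := pow_pos (by exact_mod_cast hρ0) n
    rw [inv_pow, mul_comm (S : ℝ), mul_assoc]
    refine mul_le_mul_of_nonneg_left ?_ (by positivity)
    rwa [← div_eq_mul_inv, le_div_iff₀ hρn]
  · intro v hv
    simp only [HasFPowerSeriesOnBall.inv_factorial_smul_iteratedFDeriv hco]
    refine hco.hasSum ?_
    rw [mem_eball_zero_iff]
    refine lt_tsub_iff_right.2 (lt_of_le_of_lt ?_ hρ)
    refine add_le_add ?_ (ENNReal.coe_le_coe.2 hz.le)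
    rw [enorm_eq_nnnorm]
    exact ENNReal.coe_le_coe.2 (by exact_mod_cast hv.le)

theorem AnalyticOnNhd.exists_hasUniformTaylor {f : V → G} {K : Set V} (hK : IsCompact K)
    (hf : AnalyticOnNhd ℝ f K) : ∃ ρ C : ℝ, 0 < ρ ∧ 0 ≤ C ∧ HasUniformTaylor f ρ C K := by
  refine hK.induction_on (p := fun s => ∃ ρ C : ℝ, 0 < ρ ∧ 0 ≤ C ∧ HasUniformTaylor f ρ C s)
    ?_ ?_ ?_ ?_
  · exact ⟨1, 0, one_pos, le_rfl, fun y hy => hy.elim⟩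
  · rintro s t hst ⟨ρ, C, hρ, hC, h⟩
    exact ⟨ρ, C, hρ, hC, fun y hy => h y (hst hy)⟩
  · rintro s t ⟨ρ, C, hρ, hC, h⟩ ⟨ρ', C', hρ', hC', h'⟩
    refine ⟨min ρ ρ', max C C', lt_min hρ hρ', hC.trans (le_max_left _ _), ?_⟩
    rintro y (hy | hy)
    · exact h.mono (min_le_left _ _) (lt_min hρ hρ') hC (le_max_left _ _) subset_rfl y hy
    · exact h'.mono (min_le_right _ _) (lt_min hρ hρ') hC' (le_max_right _ _) subset_rfl y hy
  · intro x hx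
    obtain ⟨p, r, hp⟩ := hf x hx
    obtain ⟨ρ, C, hρ, hC, h⟩ := HasFPowerSeriesOnBall.exists_hasUniformTaylor hp
    exact ⟨_, mem_nhdsWithin_of_mem_nhds (Metric.ball_mem_nhds x hρ), ρ, C, hρ, hC, h⟩

end TaylorBounds

/-! ### Geometry of the torus and Hölder weights -/

section Torus

variable {d : ℕ}

theorem proj_surjective (d : ℕ) : Function.Surjective (proj d) := QuotientAddGroup.mk'_surjective _

theorem proj_out (ψ : Torus d) : proj d (Quotient.out ψ) = ψ := Quotient.out_eq _

theorem proj_eq_zero_iff {x : E d} : proj d x = 0 ↔ x ∈ lattice d := QuotientAddGroup.eq_zero_iff _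

theorem proj_eq_proj_iff {x y : E d} : proj d x = proj d y ↔ x - y ∈ lattice d := by
  rw [← proj_eq_zero_iff, map_sub, sub_eq_zero]

theorem continuous_proj (d : ℕ) : Continuous (proj d) := continuous_quot_mk

theorem norm_proj_le (x : E d) : ‖proj d x‖ ≤ ‖x‖ := QuotientAddGroup.norm_mk_le_norm

/-- A compact set that projects onto the torus. -/
theorem exists_isCompact_proj (d : ℕ) : ∃ K : Set (E d), IsCompact K ∧
    ∀ x, ∃ l ∈ lattice d, x + l ∈ K := by
  refine ⟨WithLp.toLp 2 '' Set.pi Set.univ fun _ => Set.Icc 0 (2 * Real.pi), ?_, fun x => ?_⟩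
  · exact (isCompact_univ_pi fun _ => isCompact_Icc).image (PiLp.continuous_toLp 2 _)
  · have hpi : 0 < 2 * Real.pi := Real.two_pi_pos
    refine ⟨WithLp.toLp 2 fun i => 2 * Real.pi * ((-⌊x i / (2 * Real.pi)⌋ : ℤ) : ℝ),
      fun i => ⟨_, rfl⟩, ?_⟩
    refine ⟨fun i => x i - 2 * Real.pi * ⌊x i / (2 * Real.pi)⌋, fun i _ => ?_, ?_⟩
    · have h1 := Int.floor_le (x i / (2 * Real.pi))
      have h2 := Int.lt_floor_add_one (x i / (2 * Real.pi))
      rw [le_div_iff₀ hpi] at h1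
      rw [div_lt_iff₀ hpi] at h2
      constructor <;> simp only <;> nlinarith
    · ext i
      simp
      ring

instance : CompactSpace (Torus d) := by
  obtain ⟨K, hK, h⟩ := exists_isCompact_proj d
  have : proj d '' K = Set.univ := by
    rw [Set.eq_univ_iff_forall]
    intro ψ
    obtain ⟨x, rfl⟩ := proj_surjective d ψ
    obtain ⟨l, hl, hx⟩ := h x
    exact ⟨x + l, hx, by rw [map_add, proj_eq_zero_iff.2 hl, add_zero]⟩
  exact ⟨by rw [← this]; exact hK.image (continuous_proj d)⟩

theorem eq_zero_of_mem_lattice {x : E d} (hx : x ∈ lattice d) (h : ‖x‖ < 2 * Real.pi) : x = 0 := by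
  ext i
  obtain ⟨m, hm⟩ := hx i
  have h1 : |x i| < 2 * Real.pi := (PiLp.norm_apply_le x i).trans_lt h
  rw [hm, abs_mul, abs_of_pos Real.two_pi_pos] at h1
  have h2 : |(m : ℝ)| < 1 := by
    by_contra hcon
    push Not at hcon
    nlinarith [Real.two_pi_pos]
  have h3 : m = 0 := by
    rw [← Int.cast_abs] at h2
    exact Int.abs_lt_one_iff.1 (by exact_mod_cast h2)
  rw [hm, h3]
  simp

instance : IsClosed (lattice d : Set (E d)) := by
  have : (lattice d : Set (E d)) = ⋂ i, (fun x : E d => x i) ⁻¹' 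
      ((fun t : ℝ => t / (2 * Real.pi)) ⁻¹' Set.range ((↑) : ℤ → ℝ)) := by
    ext x
    simp only [Set.mem_iInter, Set.mem_preimage, Set.mem_range]
    refine forall_congr' fun i => exists_congr fun m => ?_
    rw [eq_div_iff Real.two_pi_pos.ne', mul_comm, eq_comm]
  rw [this]
  refine isClosed_iInter fun i => IsClosed.preimage (by fun_prop) (IsClosed.preimage (by fun_prop) ?_)
  exact Int.isClosedEmbedding_coe_real.isClosed_range

instance : T2Space (Torus d) := by
  have : T3Space (Torus d) := inferInstance
  infer_instance

/-- A Lipschitz estimate on `ℝ^d` descends to the torus. -/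
theorem dist_le_of_proj {Y : Type*} [PseudoMetricSpace Y] {f : Torus d → Y} {K : ℝ} (hK : 0 ≤ K)
    (h : ∀ x y, dist (f (proj d x)) (f (proj d y)) ≤ K * ‖x - y‖) (ψ φ : Torus d) :
    dist (f ψ) (f φ) ≤ K * dist ψ φ := by
  obtain ⟨x, rfl⟩ := proj_surjective d ψ
  refine le_of_forall_pos_le_add fun ε hε => ?_
  -- The quotient distance is an infimum over representatives, which is approached up to an error
  -- that the factor `K` keeps below `ε`.
  obtain ⟨m, hm, hm'⟩ := QuotientAddGroup.exists_norm_mk_lt (proj d x - φ)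
    (show 0 < ε / (K + 1) by positivity)
  have hφ : φ = proj d (x - m) := by
    have : proj d m = proj d x - φ := hm
    rw [map_sub, this]
    abel
  have := h x (x - m)
  rw [← hφ, sub_sub_cancel] at this
  refine this.trans ?_
  rw [dist_eq_norm]
  have h2 : K * ‖m‖ ≤ K * (‖proj d x - φ‖ + ε / (K + 1)) := mul_le_mul_of_nonneg_left hm'.le hK
  have h3 : K * (ε / (K + 1)) ≤ ε := by
    rw [mul_div_assoc', div_le_iff₀ (by positivity)]
    nlinarith
  linarith

/-- The weight of Hölder continuity with exponent `β`. -/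
def wt (d : ℕ) (β : ℝ) (ψ φ : Torus d) : ℝ≥0 := nndist ψ φ ^ β

theorem coe_wt (β : ℝ) (ψ φ : Torus d) : (wt d β ψ φ : ℝ) = dist ψ φ ^ β := by
  simp [wt]

theorem exists_dist_bound (d : ℕ) : ∃ D : ℝ, 1 ≤ D ∧ ∀ ψ φ : Torus d, dist ψ φ ≤ D := by
  obtain ⟨C, hC⟩ := Metric.isBounded_iff.1 (isCompact_univ (X := Torus d)).isBounded
  exact ⟨max C 1, le_max_right _ _,
    fun ψ φ => (hC (Set.mem_univ _) (Set.mem_univ _)).trans (le_max_left _ _)⟩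

/-- On the torus, Hölder weights decrease with the exponent, up to a constant. -/
theorem exists_wt_le (d : ℕ) : ∃ D : ℝ, 1 ≤ D ∧ ∀ s t : ℝ, 0 < s → s ≤ t → t ≤ 1 →
    ∀ ψ φ : Torus d, dist ψ φ ^ t ≤ D * dist ψ φ ^ s := by
  obtain ⟨D, hD1, hD⟩ := exists_dist_bound d
  refine ⟨D, hD1, fun s t hs hst ht ψ φ => ?_⟩
  have : dist ψ φ ^ t = dist ψ φ ^ (t - s) * dist ψ φ ^ s := by
    rcases dist_nonneg.eq_or_lt (a := (0 : ℝ)) (b := dist ψ φ) with h0 | h0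
    · rw [← h0, Real.zero_rpow hs.ne', Real.zero_rpow (by linarith), mul_zero]
    · rw [← Real.rpow_add h0, sub_add_cancel]
  rw [this]
  refine mul_le_mul_of_nonneg_right ?_ (by positivity)
  calc dist ψ φ ^ (t - s) ≤ D ^ (t - s) := Real.rpow_le_rpow dist_nonneg (hD _ _) (by linarith)
    _ ≤ D ^ (1 : ℝ) := Real.rpow_le_rpow_of_exponent_le hD1 (by linarith)
    _ = D := Real.rpow_one D

theorem isHol_of_lipschitz {G : Type*} [NormedAddCommGroup G] {f : Torus d → G}
    {K : ℝ} (hK : 0 ≤ K) (h : ∀ ψ φ, ‖f ψ - f φ‖ ≤ K * dist ψ φ) {β : ℝ} (hβ : 0 < β)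
    (hβ1 : β ≤ 1) : IsHol (wt d β) f := by
  obtain ⟨D, hD, hwt⟩ := exists_wt_le d
  obtain ⟨D', hD', hdist⟩ := exists_dist_bound d
  refine ⟨max (K * D) (‖f 0‖ + K * D'), fun ψ => ?_, fun ψ φ => ?_⟩
  · refine le_trans ?_ (le_max_right _ _)
    have : f ψ = f 0 + (f ψ - f 0) := by abel
    rw [this]
    refine (norm_add_le _ _).trans (add_le_add le_rfl ((h _ _).trans ?_))
    exact mul_le_mul_of_nonneg_left (hdist _ _) hK
  · refine (h ψ φ).trans ?_
    rw [coe_wt]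
    have := hwt β 1 hβ hβ1 le_rfl ψ φ
    rw [Real.rpow_one] at this
    refine (mul_le_mul_of_nonneg_left this hK).trans ?_
    rw [← mul_assoc]
    exact mul_le_mul_of_nonneg_right (le_max_left _ _) (by positivity)

/-- Hölder functions are Hölder for smaller exponents. -/
theorem IsHol.of_le {G : Type*} [NormedAddCommGroup G] {f : Torus d → G} {s t : ℝ}
    (hf : IsHol (wt d t) f) (hs : 0 < s) (hst : s ≤ t) (ht : t ≤ 1) : IsHol (wt d s) f := by
  obtain ⟨D, hD, hwt⟩ := exists_wt_le d
  obtain ⟨C, h1, h2⟩ := hf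
  have hC : 0 ≤ C := (norm_nonneg _).trans (h1 0)
  refine ⟨C * D, fun ψ => (h1 ψ).trans (le_mul_of_one_le_right hC hD), fun ψ φ => ?_⟩
  refine (h2 ψ φ).trans ?_
  rw [coe_wt, coe_wt, mul_assoc]
  exact mul_le_mul_of_nonneg_left (hwt s t hs hst ht ψ φ) hC

theorem IsHol.continuous {G : Type*} [NormedAddCommGroup G] {f : Torus d → G} {β : ℝ} (hβ : 0 < β)
    (hf : IsHol (wt d β) f) : Continuous f := by
  obtain ⟨C, h1, h2⟩ := hf
  rw [continuous_iff_continuousAt]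
  intro ψ
  rw [ContinuousAt, tendsto_iff_norm_sub_tendsto_zero]
  refine squeeze_zero (fun _ => norm_nonneg _) (fun φ => h2 φ ψ) ?_
  simp only [coe_wt]
  have : Filter.Tendsto (fun φ => C * dist φ ψ ^ β) (nhds ψ) (nhds (C * dist ψ ψ ^ β)) :=
    (Continuous.tendsto (by fun_prop (disch := exact hβ.le)) ψ)
  rw [dist_self, Real.zero_rpow hβ.ne', mul_zero] at this
  exact this

end Torus

end AnosovTorus
end

open scoped NNReal ENNReal
noncomputable section
namespace AnosovTorus

/-! ### Analytic substitution operators on Hölder spaces -/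

section Nemytskii

variable {X V G : Type*} [NormedAddCommGroup V] [NormedSpace ℝ V] [NormedAddCommGroup G]
  [NormedSpace ℝ G] {ω : X → X → ℝ≥0}

/-- Of the `n + 1` terms, one comes from the variation of the multilinear map and `n` from the
variation of one argument at a time. -/
theorem norm_multilinear_sub_le {n : ℕ} {p : X → V [×n]→L[ℝ] G} {C : ℝ}
    (h1 : ∀ x, ‖p x‖ ≤ C) (h2 : ∀ x y, ‖p x - p y‖ ≤ C * ω x y) (u : Fin n → Hol ω V) (x y : X) :
    ‖p x (fun i => u i x) - p y (fun i => u i y)‖ ≤ (n + 1) * C * (∏ i, ‖u i‖) * ω x y := by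
  have hC : 0 ≤ C := (norm_nonneg _).trans (h1 x)
  have e0 : p x (fun i => u i x) - p y (fun i => u i y) =
      (p x - p y) (fun i => u i x) + (p y (fun i => u i x) - p y (fun i => u i y)) := by simp
  have e1 : ‖(p x - p y) (fun i => u i x)‖ ≤ C * ω x y * ∏ i, ‖u i‖ := by
    refine ((p x - p y).le_opNorm _).trans ?_
    refine mul_le_mul (h2 x y) ?_ (by positivity) (by positivity)
    exact Finset.prod_le_prod (fun _ _ => norm_nonneg _) fun i _ => (u i).norm_apply_le x
  have e2 : ‖p y (fun i => u i x) - p y (fun i => u i y)‖ ≤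
      C * ∑ i : Fin n, ω x y * ∏ j, ‖u j‖ := by
    refine ((p y).norm_image_sub_le' _ _).trans ?_
    refine mul_le_mul (h1 y) (Finset.sum_le_sum fun i _ => ?_)
      (Finset.sum_nonneg fun i _ => Finset.prod_nonneg fun j _ => by split_ifs <;> positivity) hC
    have : ∀ j ∈ Finset.univ, (if j = i then ‖u i x - u i y‖ else max ‖u j x‖ ‖u j y‖) ≤
        (if j = i then (ω x y : ℝ) else 1) * ‖u j‖ := by
      intro j _
      split_ifs with hj
      · subst hj
        rw [mul_comm]
        exact (u j).norm_sub_le x y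
      · rw [one_mul]
        exact max_le ((u j).norm_apply_le x) ((u j).norm_apply_le y)
    refine (Finset.prod_le_prod (fun j _ => by split_ifs <;> positivity) this).trans (le_of_eq ?_)
    rw [Finset.prod_mul_distrib, Finset.prod_ite_eq' Finset.univ i]
    simp
  rw [e0]
  refine (norm_add_le _ _).trans ((add_le_add e1 e2).trans (le_of_eq ?_))
  rw [Finset.sum_const, Finset.card_univ, Fintype.card_fin, nsmul_eq_mul]
  ring

/-- The factor `n + 1` is wasteful here; it matches the bound on the Hölder seminorm, so that one
constant controls the full norm. -/
theorem norm_multilinear_le {n : ℕ} {p : X → V [×n]→L[ℝ] G} {C : ℝ}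
    (h1 : ∀ x, ‖p x‖ ≤ C) (u : Fin n → Hol ω V) (x : X) :
    ‖p x (fun i => u i x)‖ ≤ (n + 1) * C * ∏ i, ‖u i‖ := by
  have hC : 0 ≤ C := (norm_nonneg _).trans (h1 x)
  have e : ‖p x (fun i => u i x)‖ ≤ C * ∏ i, ‖u i‖ := by
    refine ((p x).le_opNorm _).trans (mul_le_mul (h1 x) ?_ (by positivity) hC)
    exact Finset.prod_le_prod (fun _ _ => norm_nonneg _) fun i _ => (u i).norm_apply_le x
  refine e.trans (mul_le_mul_of_nonneg_right ?_ (by positivity))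
  nlinarith [mul_nonneg (Nat.cast_nonneg (α := ℝ) n) hC]

/-- The pointwise application of a Hölder field of multilinear maps. -/
def Hol.multilinear {n : ℕ} (p : X → V [×n]→L[ℝ] G) (C : ℝ) (hC : 0 ≤ C)
    (h1 : ∀ x, ‖p x‖ ≤ C) (h2 : ∀ x y, ‖p x - p y‖ ≤ C * ω x y) :
    (Hol ω V) [×n]→L[ℝ] (Hol ω G) :=
  MultilinearMap.mkContinuous
    { toFun := fun u => Hol.mk (fun x => p x fun i => u i x)
        ⟨_, norm_multilinear_le h1 u, norm_multilinear_sub_le h1 h2 u⟩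
      map_update_add' := by
        intro _ u i v w
        ext x
        have h : ∀ z : Hol ω V, (fun j => Function.update u i z j x) =
            Function.update (fun j => u j x) i (z x) := fun z => by
          funext j
          exact Function.apply_update (fun _ (q : Hol ω V) => q x) u i z j
        change p x (fun j => Function.update u i (v + w) j x) =
          p x (fun j => Function.update u i v j x) + p x (fun j => Function.update u i w j x)
        rw [h, h, h]
        exact (p x).map_update_add (fun j => u j x) i (v x) (w x)
      map_update_smul' := by
        intro _ u i c v
        ext x
        have h : ∀ z : Hol ω V, (fun j => Function.update u i z j x) =
            Function.update (fun j => u j x) i (z x) := fun z => by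
          funext j
          exact Function.apply_update (fun _ (q : Hol ω V) => q x) u i z j
        change p x (fun j => Function.update u i (c • v) j x) =
          c • p x (fun j => Function.update u i v j x)
        rw [h, h]
        exact (p x).map_update_smul (fun j => u j x) i c (v x) }
    ((n + 1) * C) (fun u => Hol.norm_le (by positivity) (norm_multilinear_le h1 u)
      (norm_multilinear_sub_le h1 h2 u))

theorem Hol.multilinear_apply {n : ℕ} (p : X → V [×n]→L[ℝ] G) (C : ℝ) (hC : 0 ≤ C)
    (h1 : ∀ x, ‖p x‖ ≤ C) (h2 : ∀ x y, ‖p x - p y‖ ≤ C * ω x y) (u : Fin n → Hol ω V) (x : X) :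
    Hol.multilinear p C hC h1 h2 u x = p x fun i => u i x := rfl

theorem Hol.norm_multilinear_le {n : ℕ} (p : X → V [×n]→L[ℝ] G) (C : ℝ) (hC : 0 ≤ C)
    (h1 : ∀ x, ‖p x‖ ≤ C) (h2 : ∀ x y, ‖p x - p y‖ ≤ C * ω x y) :
    ‖Hol.multilinear p C hC h1 h2‖ ≤ (n + 1) * C :=
  MultilinearMap.mkContinuous_norm_le _ (by positivity) _

/-- Pointwise power series with Hölder coefficients define an analytic operator between Hölder
spaces. -/
theorem Hol.exists_analyticAt_of_series [CompleteSpace G] (p : ∀ n, X → V [×n]→L[ℝ] G) {C a : ℝ}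
    (hC : 0 ≤ C) (ha : 0 < a) (h1 : ∀ n x, ‖p n x‖ ≤ C * a ^ n)
    (h2 : ∀ n x y, ‖p n x - p n y‖ ≤ C * a ^ n * ω x y) :
    ∃ (N : Hol ω V → Hol ω G) (r : ℝ), 0 < r ∧ AnalyticAt ℝ N 0 ∧
      (∀ u : Hol ω V, ‖u‖ < r → ∀ x, HasSum (fun n => p n x fun _ => u x) (N u x)) ∧
      ∃ N' : Hol ω V →L[ℝ] Hol ω G, HasFDerivAt N N' 0 ∧ ∀ u x, N' u x = p 1 x fun _ => u x := by
  set q : FormalMultilinearSeries ℝ (Hol ω V) (Hol ω G) := fun n =>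
    Hol.multilinear (p n) (C * a ^ n) (by positivity) (h1 n) (h2 n) with hq
  -- Half of `a⁻¹`: the spare `2 ^ n` absorbs the factor `n + 1` in the norm of the `n`-th term.
  set r : ℝ≥0 := ⟨(2 * a)⁻¹, by positivity⟩ with hr
  have hr0 : 0 < r := by
    rw [← NNReal.coe_pos]
    change 0 < (2 * a)⁻¹
    positivity
  have hrad : (r : ℝ≥0∞) ≤ q.radius := by
    refine q.le_radius_of_bound C fun n => ?_
    have e1 : ‖q n‖ ≤ (n + 1) * (C * a ^ n) := Hol.norm_multilinear_le _ _ _ _ _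
    have e2 : (n + 1 : ℝ) ≤ 2 ^ n := by exact_mod_cast Nat.lt_two_pow_self
    have e3 : ((r : ℝ)) ^ n = ((2 * a) ^ n)⁻¹ := by
      change ((2 * a)⁻¹) ^ n = _
      rw [inv_pow]
    rw [e3, ← div_eq_mul_inv, div_le_iff₀ (by positivity), mul_pow]
    refine e1.trans ?_
    calc (n + 1) * (C * a ^ n) ≤ 2 ^ n * (C * a ^ n) :=
          mul_le_mul_of_nonneg_right e2 (by positivity)
      _ = C * (2 ^ n * a ^ n) := by ring
  have hpos : 0 < q.radius := lt_of_lt_of_le (by exact_mod_cast hr0) hrad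
  have hfps := q.hasFPowerSeriesOnBall hpos
  refine ⟨q.sum, r, by exact_mod_cast hr0, hfps.analyticAt, fun u hu x => ?_, _,
    hfps.hasFPowerSeriesAt.hasFDerivAt, fun u x => rfl⟩
  have hmem : u ∈ Metric.eball (0 : Hol ω V) q.radius := by
    rw [mem_eball_zero_iff]
    refine lt_of_lt_of_le ?_ hrad
    rw [enorm_eq_nnnorm]
    exact_mod_cast hu
  have := (Hol.evalCLM ω G x).hasSum (q.hasSum hmem)
  exact this

end Nemytskii

/-! ### Lifts of torus maps and their substitution operators -/

section Quasiperiodic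

set_option linter.unusedSectionVars false

open scoped Nat

variable {d : ℕ} {G : Type*} [NormedAddCommGroup G] [NormedSpace ℝ G]

/-- Translations by lattice vectors change `f` by constants only. -/
def IsQuasiperiodic (f : E d → G) : Prop :=
  ∀ l ∈ lattice d, ∀ x, f (x + l) - f x = f l - f 0

/-- Each coordinate divided by `2π` is a continuous integer-valued function on a connected space. -/
theorem eq_of_mem_lattice {g : E d → E d} (hg : Continuous g) (hlat : ∀ x, g x ∈ lattice d)
    (y z : E d) : g y = g z := by
  ext i
  choose m hm using fun z => hlat z i
  have hc : Continuous fun z => ((m z : ℤ) : ℝ) := by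
    have h2 : (fun z => ((m z : ℤ) : ℝ)) = fun z => g z i / (2 * Real.pi) := by
      funext z
      rw [hm z]
      field_simp
    rw [h2]
    fun_prop
  have hc' : Continuous m := Int.isClosedEmbedding_coe_real.isInducing.continuous_iff.2 hc
  have h3 : m y = m z := PreconnectedSpace.constant inferInstance hc'
  rw [hm y, hm z, h3]

theorem isQuasiperiodic_of_lift {f : E d → E d} (hf : Continuous f) {g : Torus d → Torus d}
    (hfg : ∀ x, proj d (f x) = g (proj d x)) : IsQuasiperiodic f := by
  intro l hl x
  have hlat : ∀ z, f (z + l) - f z ∈ lattice d := by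
    intro z
    rw [← proj_eq_zero_iff, map_sub, hfg, hfg, map_add, proj_eq_zero_iff.2 hl, add_zero, sub_self]
  have key := fun y z => eq_of_mem_lattice (g := fun z => f (z + l) - f z) (by fun_prop) hlat y z
  simpa using key x 0

theorem isQuasiperiodic_comp_proj (F : Torus d → G) : IsQuasiperiodic fun x => F (proj d x) := by
  intro l hl x
  simp [map_add, proj_eq_zero_iff.2 hl]

namespace IsQuasiperiodic

variable {f : E d → G}

theorem comp_add (h : IsQuasiperiodic f) {l : E d} (hl : l ∈ lattice d) :
    (fun x => f (x + l)) = fun x => f x + (f l - f 0) := by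
  funext x
  rw [← h l hl x]
  abel

theorem fderiv_add (h : IsQuasiperiodic f) {l : E d} (hl : l ∈ lattice d) (x : E d) :
    fderiv ℝ f (x + l) = fderiv ℝ f x := by
  rw [← fderiv_comp_add_right, h.comp_add hl, fderiv_add_const]

theorem fderiv (h : IsQuasiperiodic f) : IsQuasiperiodic (fderiv ℝ f) := by
  intro l hl x
  have := h.fderiv_add hl 0
  rw [zero_add] at this
  rw [h.fderiv_add hl, this, sub_self, sub_self]

theorem iteratedFDeriv_add (h : IsQuasiperiodic f) {l : E d} (hl : l ∈ lattice d) (n : ℕ)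
    (x : E d) : iteratedFDeriv ℝ (n + 1) f (x + l) = iteratedFDeriv ℝ (n + 1) f x := by
  rw [iteratedFDeriv_succ_eq_comp_right, Function.comp_apply,
    iteratedFDeriv_succ_eq_comp_right, Function.comp_apply, ← iteratedFDeriv_comp_add_right]
  congr 2
  funext y
  exact h.fderiv_add hl y

/-- A compact set meets every lattice coset, so uniform bounds there suffice: derivatives of order
at least one are periodic. The values of `f` are periodic only up to constants, which is why the
expansion is that of the increment and starts at order one. -/
theorem exists_taylor_bounds [CompleteSpace G] (h : IsQuasiperiodic f)
    (hf : AnalyticOnNhd ℝ f Set.univ) : ∃ ρ C : ℝ, 0 < ρ ∧ 0 ≤ C ∧ ∀ x,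
      (∀ n, ‖iteratedFDeriv ℝ (n + 1) f x‖ ≤ C * (n + 1)! * ρ⁻¹ ^ (n + 1)) ∧
      ∀ v, ‖v‖ < ρ → HasSum
        (fun n => (((n + 1)! : ℝ))⁻¹ • iteratedFDeriv ℝ (n + 1) f x fun _ => v)
        (f (x + v) - f x) := by
  obtain ⟨K, hK, hKp⟩ := exists_isCompact_proj d
  obtain ⟨ρ, C, hρ, hC, hT⟩ := AnalyticOnNhd.exists_hasUniformTaylor hK
    (hf.mono (Set.subset_univ K))
  refine ⟨ρ, C, hρ, hC, fun x => ?_⟩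
  obtain ⟨l, hl, hx⟩ := hKp x
  obtain ⟨h1, h2⟩ := hT _ hx
  refine ⟨fun n => ?_, fun v hv => ?_⟩
  · rw [← h.iteratedFDeriv_add hl]
    exact h1 (n + 1)
  · have e := (hasSum_nat_add_iff' 1).2 (h2 v hv)
    simp only [Finset.range_one, Finset.sum_singleton, Nat.factorial_zero, Nat.cast_one, inv_one,
      iteratedFDeriv_zero_apply, one_smul, h.iteratedFDeriv_add hl] at e
    have e2 := h l hl (x + v)
    have e3 := h l hl x
    have e4 : f (x + l + v) - f (x + l) = f (x + v) - f x := by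
      rw [add_right_comm, sub_eq_sub_iff_sub_eq_sub, e2, e3]
    rwa [e4] at e

/-- The Taylor coefficients of order at least one of a quasiperiodic function, as functions on the
torus. -/
def _root_.AnosovTorus.taylorCoeff (f : E d → G) : (n : ℕ) → Torus d → E d [×n]→L[ℝ] G
  | 0, _ => 0
  | n + 1, ψ => (((n + 1)! : ℝ))⁻¹ • iteratedFDeriv ℝ (n + 1) f (Quotient.out ψ)

theorem taylorCoeff_proj (h : IsQuasiperiodic f) (n : ℕ) (x : E d) :
    taylorCoeff f (n + 1) (proj d x) = (((n + 1)! : ℝ))⁻¹ • iteratedFDeriv ℝ (n + 1) f x := by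
  have hl : Quotient.out (proj d x) - x ∈ lattice d :=
    proj_eq_proj_iff.1 (proj_out (proj d x))
  have := h.iteratedFDeriv_add hl n x
  rw [add_sub_cancel] at this
  rw [taylorCoeff, this]

/-- A Taylor coefficient is Lipschitz by the mean value inequality for the next derivative. This
costs a factor `n + 2` and one more power of `ρ⁻¹`, both absorbed by a larger geometric rate. -/
theorem exists_taylorCoeff_bounds [CompleteSpace G] (h : IsQuasiperiodic f)
    (hf : AnalyticOnNhd ℝ f Set.univ) {β : ℝ} (hβ : 0 < β) (hβ1 : β ≤ 1) :
    ∃ C a : ℝ, 0 ≤ C ∧ 0 < a ∧ (∀ n ψ, ‖taylorCoeff f n ψ‖ ≤ C * a ^ n) ∧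
      ∀ n ψ ψ', ‖taylorCoeff f n ψ - taylorCoeff f n ψ'‖ ≤ C * a ^ n * wt d β ψ ψ' := by
  obtain ⟨ρ, C, hρ, hC, hT⟩ := h.exists_taylor_bounds hf
  obtain ⟨D, hD, hwt⟩ := exists_wt_le d
  have hlip : ∀ n ψ ψ', ‖taylorCoeff f (n + 1) ψ - taylorCoeff f (n + 1) ψ'‖ ≤
      C * (n + 2) * ρ⁻¹ ^ (n + 2) * dist ψ ψ' := by
    intro n ψ ψ'
    have hfac : (((n + 2)! : ℕ) : ℝ) = (n + 2) * (n + 1)! := by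
      rw [Nat.factorial_succ (n + 1)]
      push_cast
      ring
    have := dist_le_of_proj (f := taylorCoeff f (n + 1)) (K := C * (n + 2) * ρ⁻¹ ^ (n + 2))
      (by positivity) ?_ ψ ψ'
    · rwa [dist_eq_norm] at this
    intro x y
    rw [h.taylorCoeff_proj, h.taylorCoeff_proj, dist_eq_norm, ← smul_sub, norm_smul, norm_inv,
      Real.norm_of_nonneg (by positivity), inv_mul_le_iff₀ (by positivity)]
    have hmv := Convex.norm_image_sub_le_of_norm_fderiv_le (𝕜 := ℝ)
      (f := iteratedFDeriv ℝ (n + 1) f) (C := C * (n + 2)! * ρ⁻¹ ^ (n + 2)) (s := Set.univ)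
      (x := y) (y := x)
      (fun z _ => ((hf.iteratedFDeriv (n + 1)) z (Set.mem_univ z)).differentiableAt)
      (fun z _ => by rw [norm_fderiv_iteratedFDeriv]; exact (hT z).1 (n + 1))
      convex_univ (Set.mem_univ _) (Set.mem_univ _)
    refine hmv.trans (le_of_eq ?_)
    rw [hfac]
    ring
  -- The factor `2` absorbs `n + 2 ≤ 2 ^ (n + 2)`; the extra power of `a` goes into the constant `C
  -- * (a * D)`. The maximum with `1` makes this constant dominate `C`.
  set a : ℝ := 2 * max ρ⁻¹ 1 with ha
  have ha1 : 1 ≤ max ρ⁻¹ 1 := le_max_right _ _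
  refine ⟨C * (a * D), a, by positivity, by positivity, fun n ψ => ?_, fun n ψ ψ' => ?_⟩
  · cases n with
    | zero => simp only [taylorCoeff, norm_zero]; positivity
    | succ n =>
      rw [taylorCoeff, norm_smul, norm_inv, Real.norm_of_nonneg (by positivity),
        inv_mul_le_iff₀ (by positivity)]
      refine ((hT _).1 n).trans ?_
      have e1 : ρ⁻¹ ^ (n + 1) ≤ a ^ (n + 1) :=
        pow_le_pow_left₀ (by positivity) (by rw [ha]; linarith [le_max_left ρ⁻¹ 1]) _
      have e2 : (1 : ℝ) ≤ a * D := by nlinarith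
      have e3 : C ≤ C * (a * D) := le_mul_of_one_le_right hC e2
      calc C * (n + 1)! * ρ⁻¹ ^ (n + 1) = (n + 1)! * (C * ρ⁻¹ ^ (n + 1)) := by ring
        _ ≤ (n + 1)! * (C * (a * D) * a ^ (n + 1)) := by gcongr
  · cases n with
    | zero => simp only [taylorCoeff, sub_self, norm_zero]; positivity
    | succ n =>
      refine (hlip n ψ ψ').trans ?_
      have e0 := hwt β 1 hβ hβ1 le_rfl ψ ψ'
      rw [Real.rpow_one] at e0
      rw [coe_wt]
      have e1 : (n + 2 : ℝ) ≤ 2 ^ (n + 2) := by exact_mod_cast (Nat.lt_two_pow_self (n := n + 2)).le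
      have e2 : ρ⁻¹ ^ (n + 2) ≤ (max ρ⁻¹ 1) ^ (n + 2) :=
        pow_le_pow_left₀ (by positivity) (le_max_left _ _) _
      calc C * (n + 2) * ρ⁻¹ ^ (n + 2) * dist ψ ψ'
          ≤ C * 2 ^ (n + 2) * (max ρ⁻¹ 1) ^ (n + 2) * (D * dist ψ ψ' ^ β) := by gcongr
        _ = C * (a * D) * a ^ (n + 1) * dist ψ ψ' ^ β := by rw [ha, mul_pow]; ring

/-- The operator `u ↦ f(x + u(x)) - f(x)` on Hölder functions is analytic at `0`. -/
theorem exists_nemytskii [CompleteSpace G] (h : IsQuasiperiodic f)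
    (hf : AnalyticOnNhd ℝ f Set.univ) {β : ℝ} (hβ : 0 < β) (hβ1 : β ≤ 1) :
    ∃ (N : Hol (wt d β) (E d) → Hol (wt d β) G) (r : ℝ), 0 < r ∧ AnalyticAt ℝ N 0 ∧
      (∀ u, ‖u‖ < r → ∀ x, N u (proj d x) = f (x + u (proj d x)) - f x) ∧
      ∃ N' : Hol (wt d β) (E d) →L[ℝ] Hol (wt d β) G, HasFDerivAt N N' 0 ∧
        ∀ u x, N' u (proj d x) = _root_.fderiv ℝ f x (u (proj d x)) := by
  obtain ⟨C, a, hC, ha, h1, h2⟩ := h.exists_taylorCoeff_bounds hf hβ hβ1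
  obtain ⟨ρ, C', hρ, hC', hT⟩ := h.exists_taylor_bounds hf
  obtain ⟨N, r, hr, hN, hsum, N', hN', hN'a⟩ :=
    Hol.exists_analyticAt_of_series (ω := wt d β) (taylorCoeff f) hC ha h1 h2
  refine ⟨N, min r ρ, lt_min hr hρ, hN, fun u hu x => ?_, N', hN', fun u x => ?_⟩
  · have e1 := hsum u (hu.trans_le (min_le_left _ _)) (proj d x)
    have e2 := (hT x).2 (u (proj d x))
      ((u.norm_apply_le _).trans_lt (hu.trans_le (min_le_right _ _)))
    have e3 := (hasSum_nat_add_iff' 1).2 e1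
    simp only [Finset.range_one, Finset.sum_singleton, h.taylorCoeff_proj] at e3
    have e4 : taylorCoeff f 0 (proj d x) = 0 := rfl
    rw [e4, zero_apply, sub_zero] at e3
    exact e3.unique e2
  · rw [hN'a, ← zero_add 1, h.taylorCoeff_proj]
    simp [iteratedFDeriv_one_apply]

end IsQuasiperiodic

end Quasiperiodic

end AnosovTorus
end

open scoped NNReal ENNReal
noncomputable section
namespace AnosovTorus

/-! ### The analytic implicit function theorem for curves -/

section ImplicitCurve

open Filter Topology
open scoped ContDiff

variable {Y Z : Type*} [NormedAddCommGroup Y] [NormedSpace ℝ Y]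
  [NormedAddCommGroup Z] [NormedSpace ℝ Z]

/-- The analytic implicit function theorem with a real parameter. -/
theorem exists_analytic_curve [CompleteSpace Y] [CompleteSpace Z] {Φ : ℝ × Y → Z}
    (hΦ : AnalyticAt ℝ Φ 0) (h0 : Φ 0 = 0) (e : Y ≃L[ℝ] Z)
    (he : HasFDerivAt (fun y => Φ (0, y)) (e : Y →L[ℝ] Z) 0) :
    ∃ y : ℝ → Y, AnalyticAt ℝ y 0 ∧ y 0 = 0 ∧ ∀ᶠ ε in 𝓝 (0 : ℝ), Φ (ε, y ε) = 0 := by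
  set Φ' := fderiv ℝ Φ 0 with hΦ'
  have hd : HasFDerivAt Φ Φ' 0 := hΦ.differentiableAt.hasFDerivAt
  -- The derivative of `(ε, y) ↦ (ε, Φ (ε, y))` is triangular with diagonal entries `1` and `e`,
  -- hence invertible. The analytic inverse function theorem applies to this map, and the curve is
  -- the image of `(ε, 0)` under the local inverse.
  set L : (ℝ × Y) ≃L[ℝ] (ℝ × Z) := ContinuousLinearEquiv.skewProd (ContinuousLinearEquiv.refl ℝ ℝ) e
    (Φ' ∘L ContinuousLinearMap.inl ℝ ℝ Y) with hL
  have hinr : ∀ w, Φ' (0, w) = e w := by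
    have h1 : HasFDerivAt (fun y => Φ (0, y)) (Φ' ∘L ContinuousLinearMap.inr ℝ ℝ Y) 0 :=
      HasFDerivAt.comp (g := Φ) (f := fun y : Y => ((0 : ℝ), y)) (0 : Y)
        (by exact hd) (ContinuousLinearMap.inr ℝ ℝ Y).hasFDerivAt
    intro w
    have := DFunLike.congr_fun (h1.unique he) w
    simpa using this
  set f : ℝ × Y → ℝ × Z := fun p => (p.1, Φ p) with hf
  have hfd : HasFDerivAt f (L : (ℝ × Y) →L[ℝ] (ℝ × Z)) 0 := by
    have : (L : (ℝ × Y) →L[ℝ] (ℝ × Z)) = (ContinuousLinearMap.fst ℝ ℝ Y).prod Φ' := by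
      ext1
      · ext <;> simp [hL]
      · ext w <;> simp [hL, hinr]
    rw [this]
    exact hasFDerivAt_fst.prodMk hd
  have hfa : ContDiffAt ℝ ω f 0 := contDiffAt_fst.prodMk hΦ.contDiffAt
  have hω : (ω : WithTop ℕ∞) ≠ 0 := by simp
  have hs := hfa.hasStrictFDerivAt' hfd hω
  set g := hfa.localInverse hfd hω with hg
  have hf0 : f 0 = 0 := by rw [hf]; simp [h0]
  have hga : ContDiffAt ℝ ω g 0 := by
    have := hfa.to_localInverse hfd hω
    rwa [hf0] at this
  have hg0 : g 0 = 0 := by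
    have := hfa.localInverse_apply_image hfd hω
    rwa [hf0] at this
  have hright : ∀ᶠ q in 𝓝 (0 : ℝ × Z), f (g q) = q := by
    have := hs.eventually_right_inverse
    rwa [hf0] at this
  refine ⟨fun ε => (g (ε, 0)).2, ?_, ?_, ?_⟩
  · have h2 : ContDiffAt ℝ ω (fun ε : ℝ => (g (ε, 0)).2) 0 := by
      refine contDiffAt_snd.comp _ (ContDiffAt.comp (0 : ℝ) (by exact hga) ?_)
      exact contDiffAt_id.prodMk contDiffAt_const
    exact h2.analyticAt
  · change (g 0).2 = 0
    rw [hg0]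
    rfl
  · have ht : Tendsto (fun ε : ℝ => (ε, (0 : Z))) (𝓝 0) (𝓝 0) := by
      have : Continuous fun ε : ℝ => (ε, (0 : Z)) := by fun_prop
      exact this.tendsto 0
    filter_upwards [ht.eventually hright] with ε hε
    have h1 : (g (ε, 0)).1 = ε := congrArg Prod.fst hε
    have h2 : Φ (g (ε, 0)) = 0 := congrArg Prod.snd hε
    have h3 : (ε, (g (ε, 0)).2) = g (ε, 0) := Prod.ext h1.symm rfl
    rw [h3, h2]

theorem exists_coeff_of_analyticAt {y : ℝ → Y} (hy : AnalyticAt ℝ y 0) :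
    ∃ (c : ℕ → Y) (r C : ℝ), 0 < r ∧ 0 < C ∧ (∀ n, ‖c n‖ ≤ C / r ^ n) ∧
      ∀ ε : ℝ, |ε| < r → HasSum (fun n => ε ^ n • c n) (y ε) := by
  obtain ⟨p, R, hp⟩ := hy
  obtain ⟨r, hr0, hr⟩ := ENNReal.lt_iff_exists_nnreal_btwn.1 hp.r_pos
  have hr0' : 0 < r := by exact_mod_cast hr0
  obtain ⟨C, hC, hCn⟩ := p.norm_mul_pow_le_of_lt_radius (hr.trans_le hp.r_le)
  refine ⟨p.coeff, r, C, by exact_mod_cast hr0', hC, fun n => ?_, fun ε hε => ?_⟩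
  · rw [le_div_iff₀ (by positivity)]
    rw [← FormalMultilinearSeries.norm_apply_eq_norm_coef]
    exact hCn n
  · have hmem : ε ∈ Metric.eball (0 : ℝ) R := by
      rw [mem_eball_zero_iff]
      refine lt_trans ?_ hr
      rw [enorm_eq_nnnorm, ENNReal.coe_lt_coe]
      exact_mod_cast hε
    have := hp.hasSum hmem
    simpa [FormalMultilinearSeries.apply_eq_pow_smul_coeff] using this

end ImplicitCurve

end AnosovTorus
end

open scoped NNReal ENNReal
noncomputable section
namespace AnosovTorus

/-! ### Oblique projectors expressed through orthogonal ones -/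

section ObliqueProjections

variable {V ι : Type*} [NormedAddCommGroup V] [InnerProductSpace ℝ V] [FiniteDimensional ℝ V]
  [Fintype ι]

/-- The sum of the orthogonal projections to a family of subspaces. -/
def projSum (U : ι → Submodule ℝ V) : V →L[ℝ] V := ∑ i, (U i).starProjection

/-- The quadratic form of the sum at `x` is `∑ ‖P_i x‖²`. It vanishes only if `x` is orthogonal to
every `U i`, hence to their span, which is everything. -/
theorem isUnit_projSum {U : ι → Submodule ℝ V} (h : ⨆ i, U i = ⊤) : IsUnit (projSum U) := by
  rw [ContinuousLinearMap.isUnit_iff_bijective]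
  have hinj : Function.Injective (projSum U) := by
    rw [injective_iff_map_eq_zero]
    intro x hx
    have h1 : ∑ i, ‖(U i).starProjection x‖ ^ 2 = 0 := by
      have : inner ℝ (projSum U x) x = 0 := by rw [hx, inner_zero_left]
      rw [projSum, sum_apply, sum_inner] at this
      rw [← this]
      refine Finset.sum_congr rfl fun i _ => ?_
      exact ((U i).re_inner_starProjection_eq_normSq x).symm
    have h2 : ∀ i, (U i).starProjection x = 0 := by
      intro i
      have := (Finset.sum_eq_zero_iff_of_nonneg (fun i _ => by positivity)).1 h1 i (Finset.mem_univ i)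
      simpa using this
    have h3 : ∀ y ∈ ⨆ i, U i, inner ℝ y x = 0 := by
      intro y hy
      have hle : ⨆ i, U i ≤ (ℝ ∙ x)ᗮ := by
        refine iSup_le fun i z hz => ?_
        rw [Submodule.mem_orthogonal_singleton_iff_inner_left]
        exact ((U i).starProjection_apply_eq_zero_iff.1 (h2 i)) z hz
      exact Submodule.mem_orthogonal_singleton_iff_inner_left.1 (hle hy)
    have := h3 x (by rw [h]; trivial)
    exact inner_self_eq_zero.1 this
  exact ⟨hinj, LinearMap.injective_iff_surjective.1
    (show Function.Injective (projSum U : V →ₗ[ℝ] V) from hinj)⟩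

/-- The projector to `U i` associated with a direct sum decomposition `V = ⨁ U i`. -/
def obl (U : ι → Submodule ℝ V) (i : ι) : V →L[ℝ] V :=
  -- These maps take values in the `U i` and add up to the identity, which characterizes the
  -- projectors of a direct sum. In this form they inherit the regularity of the orthogonal
  -- projections, since inversion is locally Lipschitz on units.
  (U i).starProjection ∘L Ring.inverse (projSum U)

theorem obl_mem (U : ι → Submodule ℝ V) (i : ι) (x : V) : obl U i x ∈ U i :=
  (U i).starProjection_apply_mem _

theorem sum_obl {U : ι → Submodule ℝ V} (h : ⨆ i, U i = ⊤) (x : V) : ∑ i, obl U i x = x := by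
  have : projSum U * Ring.inverse (projSum U) = 1 := Ring.mul_inverse_cancel _ (isUnit_projSum h)
  have := DFunLike.congr_fun this x
  rw [mul_apply_eq_comp, projSum, sum_apply] at this
  exact this

theorem obl_apply_of_sum_eq {U : ι → Submodule ℝ V} (hi : iSupIndep U) (h : ⨆ i, U i = ⊤)
    {v : ι → V} (hv : ∀ i, v i ∈ U i) {x : V} (hx : ∑ i, v i = x) (i : ι) : obl U i x = v i := by
  have := (iSupIndep_iff_finsetSum_eq_imp_eq U).1 hi Finset.univ
    (fun i => obl U i x) v (fun i _ => ⟨obl_mem U i x, hv i⟩) (by rw [sum_obl h, hx])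
  exact this i (Finset.mem_univ i)

theorem obl_apply_self {U : ι → Submodule ℝ V} (hi : iSupIndep U) (h : ⨆ i, U i = ⊤) {i : ι}
    {x : V} (hx : x ∈ U i) : obl U i x = x := by
  classical
  have := obl_apply_of_sum_eq hi h (v := fun j => if j = i then x else 0) (x := x)
    (fun j => by
      split_ifs with hj
      · exact hj ▸ hx
      · exact zero_mem _) (by simp) i
  simpa using this

theorem obl_apply_of_ne {U : ι → Submodule ℝ V} (hi : iSupIndep U) (h : ⨆ i, U i = ⊤) {i j : ι}
    (hij : i ≠ j) {x : V} (hx : x ∈ U j) : obl U i x = 0 := by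
  classical
  have := obl_apply_of_sum_eq hi h (v := fun k => if k = j then x else 0) (x := x)
    (fun k => by
      split_ifs with hj
      · exact hj ▸ hx
      · exact zero_mem _) (by simp) i
  simpa [hij] using this

/-- A linear map that respects two decompositions intertwines their projectors. -/
theorem obl_comp_of_map_le {U U' : ι → Submodule ℝ V} (h : ⨆ i, U i = ⊤) (hi' : iSupIndep U')
    (h' : ⨆ i, U' i = ⊤) {L : V →L[ℝ] V} (hL : ∀ i, ∀ x ∈ U i, L x ∈ U' i) (i : ι) :
    obl U' i ∘L L = L ∘L obl U i := by
  ext1 x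
  refine obl_apply_of_sum_eq hi' h' (v := fun i => L (obl U i x)) (fun i => hL i _ (obl_mem U i x))
    ?_ i
  rw [← map_sum, sum_obl h]
  rfl

theorem continuous_ringInverse {X R : Type*} [TopologicalSpace X] [NormedRing R]
    [HasSummableGeomSeries R] {f : X → R} (hf : Continuous f) (hu : ∀ x, IsUnit (f x)) :
    Continuous fun x => Ring.inverse (f x) := by
  rw [continuous_iff_continuousAt]
  intro x
  have := NormedRing.inverse_continuousAt (hu x).unit
  exact ContinuousAt.comp (f := f) (g := Ring.inverse) this hf.continuousAt

theorem continuous_obl {X : Type*} [TopologicalSpace X] {U : ι → X → Submodule ℝ V}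
    (hc : ∀ i, Continuous fun x => (U i x).starProjection) (h : ∀ x, ⨆ i, U i x = ⊤) (i : ι) :
    Continuous fun x => obl (fun j => U j x) i := by
  have h1 : Continuous fun x => projSum fun j => U j x := by
    unfold projSum
    exact continuous_finsetSum _ fun i _ => hc i
  exact (hc i).clm_comp (continuous_ringInverse h1 fun x => isUnit_projSum (h x))

end ObliqueProjections

/-! ### Inversion and Lipschitz approximation of fields on the torus -/

section TorusFields

set_option linter.unusedSectionVars false

variable {d : ℕ} {G : Type*} [NormedAddCommGroup G] [NormedSpace ℝ G]

theorem exists_norm_bound {f : Torus d → G} (hf : Continuous f) : ∃ C : ℝ, 1 ≤ C ∧ ∀ ψ, ‖f ψ‖ ≤ C := by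
  obtain ⟨C, hC⟩ := isCompact_univ.exists_bound_of_continuousOn (f := f) hf.continuousOn
  exact ⟨max C 1, le_max_right _ _, fun ψ => (hC ψ (Set.mem_univ _)).trans (le_max_left _ _)⟩

/-- The identity `f(ψ)⁻¹ - f(φ)⁻¹ = f(ψ)⁻¹ (f(φ) - f(ψ)) f(φ)⁻¹` gives the seminorm; compactness of
the torus bounds the inverses. -/
theorem IsHol.ringInverse [CompleteSpace G] {f : Torus d → G →L[ℝ] G} {β : ℝ} (hβ : 0 < β)
    (hf : IsHol (wt d β) f) (hu : ∀ ψ, IsUnit (f ψ)) :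
    IsHol (wt d β) fun ψ => Ring.inverse (f ψ) := by
  obtain ⟨K, hK, hKb⟩ := exists_norm_bound (continuous_ringInverse (hf.continuous hβ) hu)
  obtain ⟨C, hC, h1, h2⟩ := hf.exists_pos
  refine ⟨K * max 1 (C * K), fun ψ => (hKb ψ).trans
    (le_mul_of_one_le_right (by linarith) (le_max_left _ _)), fun ψ φ => ?_⟩
  have e : Ring.inverse (f ψ) - Ring.inverse (f φ) =
      Ring.inverse (f ψ) * ((f φ - f ψ) * Ring.inverse (f φ)) := by
    rw [sub_mul, mul_sub, Ring.mul_inverse_cancel _ (hu φ), mul_one, ← mul_assoc,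
      Ring.inverse_mul_cancel _ (hu ψ), one_mul]
  rw [e, mul_assoc]
  refine (norm_mul_le _ _).trans (mul_le_mul (hKb ψ) ?_ (norm_nonneg _) (by linarith))
  refine (norm_mul_le _ _).trans ?_
  rw [norm_sub_rev]
  calc ‖f ψ - f φ‖ * ‖Ring.inverse (f φ)‖ ≤ C * wt d β ψ φ * K :=
        mul_le_mul (h2 ψ φ) (hKb φ) (norm_nonneg _) (by positivity)
    _ = C * K * wt d β ψ φ := by ring
    _ ≤ max 1 (C * K) * wt d β ψ φ := mul_le_mul_of_nonneg_right (le_max_right _ _) (by positivity)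

/-- Continuous functions on the torus are uniform limits of Lipschitz functions. -/
theorem exists_lipschitz_approx {f : Torus d → G} (hf : Continuous f) {δ : ℝ} (hδ : 0 < δ) :
    ∃ g : Torus d → G, IsHol (wt d 1) g ∧ ∀ ψ, ‖g ψ - f ψ‖ ≤ δ := by
  obtain ⟨η, hη, hfη⟩ := Metric.uniformContinuous_iff.1
    (CompactSpace.uniformContinuous_of_continuous hf) δ hδ
  obtain ⟨t, -, ht⟩ := (isCompact_univ (X := Torus d)).elim_nhds_subcover
    (fun c => Metric.ball c (η / 2)) (fun c _ => Metric.ball_mem_nhds c (by positivity))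
  have hcov : ∀ ψ : Torus d, ∃ c ∈ t, dist ψ c < η / 2 := by
    intro ψ
    have := ht (Set.mem_univ ψ)
    simpa using this
  -- Tent functions of radius `η` at the points of a finite `η / 2`-net. Their sum is at least `η /
  -- 2`, so dividing by it gives a Lipschitz partition of unity; averaging the values of `f` at the
  -- net points over scale `η` moves `f` by at most `δ`.
  set b : Torus d → Torus d → ℝ := fun c ψ => max (η - dist ψ c) 0 with hb
  have hb0 : ∀ c ψ, 0 ≤ b c ψ := fun c ψ => le_max_right _ _
  have hbL : ∀ c, IsHol (wt d 1) (b c) := by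
    intro c
    refine isHol_of_lipschitz (K := 1) zero_le_one (fun ψ φ => ?_) one_pos le_rfl
    rw [one_mul, Real.norm_eq_abs]
    refine (abs_max_sub_max_le_abs _ _ _).trans ?_
    rw [sub_sub_sub_cancel_left, dist_comm φ c, dist_comm ψ c, dist_comm ψ φ]
    rw [dist_comm c φ, dist_comm c ψ]
    exact abs_dist_sub_le φ ψ c
  set s : Torus d → ℝ := fun ψ => ∑ c ∈ t, b c ψ with hs
  have hsL : IsHol (wt d 1) s := IsHol.sum t fun c _ => hbL c
  have hsm : ∀ ψ, η / 2 ≤ s ψ := by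
    intro ψ
    obtain ⟨c, hc, hcd⟩ := hcov ψ
    have h1 : b c ψ ≤ s ψ := Finset.single_le_sum (f := fun c => b c ψ) (fun c _ => hb0 c ψ) hc
    have h2 : η - dist ψ c ≤ b c ψ := le_max_left _ _
    linarith
  have hspos : ∀ ψ, 0 < s ψ := fun ψ => lt_of_lt_of_le (by positivity) (hsm ψ)
  have hsinv : IsHol (wt d 1) fun ψ => (s ψ)⁻¹ := by
    obtain ⟨C, hC, h1, h2⟩ := hsL.exists_pos
    refine ⟨max (η / 2)⁻¹ (C * ((η / 2)⁻¹ * (η / 2)⁻¹)), fun ψ => ?_, fun ψ φ => ?_⟩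
    · rw [norm_inv, Real.norm_of_nonneg (hspos ψ).le]
      exact (inv_anti₀ (by positivity) (hsm ψ)).trans (le_max_left _ _)
    · have e : (s ψ)⁻¹ - (s φ)⁻¹ = (s φ - s ψ) * ((s ψ)⁻¹ * (s φ)⁻¹) := by
        have := (hspos ψ).ne'
        have := (hspos φ).ne'
        field_simp
      rw [e, norm_mul, norm_sub_rev, norm_mul, norm_inv, norm_inv,
        Real.norm_of_nonneg (hspos ψ).le, Real.norm_of_nonneg (hspos φ).le]
      have e1 := inv_anti₀ (by positivity) (hsm ψ)
      have e2 := inv_anti₀ (by positivity) (hsm φ)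
      calc ‖s ψ - s φ‖ * ((s ψ)⁻¹ * (s φ)⁻¹)
          ≤ C * wt d 1 ψ φ * ((η / 2)⁻¹ * (η / 2)⁻¹) := by
            have := (hspos φ).le
            have := (hspos ψ).le
            exact mul_le_mul (h2 ψ φ) (mul_le_mul e1 e2 (by positivity) (by positivity))
              (by positivity) (by positivity)
        _ = C * ((η / 2)⁻¹ * (η / 2)⁻¹) * wt d 1 ψ φ := by ring
        _ ≤ _ := mul_le_mul_of_nonneg_right (le_max_right _ _) (by positivity)
  refine ⟨fun ψ => (s ψ)⁻¹ • ∑ c ∈ t, b c ψ • f c, ?_, fun ψ => ?_⟩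
  · refine hsinv.bilin (ContinuousLinearMap.lsmul ℝ ℝ) (IsHol.sum t fun c _ => ?_)
    exact (hbL c).bilin (ContinuousLinearMap.lsmul ℝ ℝ) (IsHol.const (f c))
  · have e : (s ψ)⁻¹ • ∑ c ∈ t, b c ψ • f c - f ψ = (s ψ)⁻¹ • ∑ c ∈ t, b c ψ • (f c - f ψ) := by
      simp only [smul_sub, Finset.sum_sub_distrib, ← Finset.sum_smul]
      rw [smul_smul, inv_mul_cancel₀ (hspos ψ).ne', one_smul]
    rw [e, norm_smul, norm_inv, Real.norm_of_nonneg (hspos ψ).le, inv_mul_le_iff₀ (hspos ψ), hs,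
      Finset.sum_mul]
    refine (norm_sum_le _ _).trans (Finset.sum_le_sum fun c _ => ?_)
    rw [norm_smul, Real.norm_of_nonneg (hb0 c ψ)]
    by_cases hcd : dist c ψ < η
    · refine mul_le_mul_of_nonneg_left ?_ (hb0 c ψ)
      have := (hfη hcd).le
      rwa [dist_eq_norm] at this
    · have : b c ψ = 0 := max_eq_right (by rw [dist_comm]; linarith)
      rw [this, zero_mul, zero_mul]

end TorusFields

end AnosovTorus
end

open scoped NNReal ENNReal
noncomputable section
namespace AnosovTorus

/-! ### Derivative cocycles of torus diffeomorphisms, and stability of dichotomies -/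

section Diffeo

variable {d : ℕ}

theorem IsQuasiperiodic.exists_lipschitz {G : Type*} [NormedAddCommGroup G] [NormedSpace ℝ G]
    [CompleteSpace G] {f : E d → G} (h : IsQuasiperiodic f) (hf : AnalyticOnNhd ℝ f Set.univ) :
    ∃ K : ℝ, 0 ≤ K ∧ (∀ x, ‖_root_.fderiv ℝ f x‖ ≤ K) ∧ ∀ x y, ‖f x - f y‖ ≤ K * ‖x - y‖ := by
  obtain ⟨ρ, C, hρ, hC, hT⟩ := h.exists_taylor_bounds hf
  have hb : ∀ x, ‖_root_.fderiv ℝ f x‖ ≤ C * ρ⁻¹ := by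
    intro x
    have := (hT x).1 0
    rw [zero_add, norm_iteratedFDeriv_one] at this
    simpa using this
  refine ⟨C * ρ⁻¹, by positivity, hb, fun x y => ?_⟩
  exact Convex.norm_image_sub_le_of_norm_fderiv_le (𝕜 := ℝ) (s := Set.univ)
    (fun z _ => (hf z (Set.mem_univ z)).differentiableAt) (fun z _ => hb z) convex_univ
    (Set.mem_univ _) (Set.mem_univ _)

namespace AnalyticDiffeo

variable (A : AnalyticDiffeo d)

theorem continuous_lift : Continuous A.lift := continuousOn_univ.1 A.analytic_lift.continuousOn

theorem continuous_liftInv : Continuous A.liftInv :=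
  continuousOn_univ.1 A.analytic_liftInv.continuousOn

theorem differentiable_lift : Differentiable ℝ A.lift :=
  fun x => (A.analytic_lift x (Set.mem_univ x)).differentiableAt

theorem differentiable_liftInv : Differentiable ℝ A.liftInv :=
  fun x => (A.analytic_liftInv x (Set.mem_univ x)).differentiableAt

theorem isQuasiperiodic_lift : IsQuasiperiodic A.lift :=
  isQuasiperiodic_of_lift A.continuous_lift A.proj_lift

theorem isQuasiperiodic_liftInv : IsQuasiperiodic A.liftInv :=
  isQuasiperiodic_of_lift A.continuous_liftInv A.proj_liftInv

theorem D_proj (x : E d) : A.D (proj d x) = fderiv ℝ A.lift x :=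
  torusDeriv_proj _ A.continuous_lift _ A.proj_lift x

/-- The inverse of the differential `DA(ψ)`. -/
def Dinv (ψ : Torus d) : E d →L[ℝ] E d := torusDeriv A.liftInv (A.toPerm ψ)

theorem torusDeriv_liftInv_proj (x : E d) :
    torusDeriv A.liftInv (proj d x) = fderiv ℝ A.liftInv x :=
  torusDeriv_proj _ A.continuous_liftInv _ A.proj_liftInv x

/-- A lift of the identity differs from the identity by a continuous lattice-valued map, that is, by
a constant. Applied to the composites of `A.lift` and `A.liftInv`, which need not be inverse to each
other on `ℝ^d`. -/
theorem fderiv_of_proj_eq {f : E d → E d} (hf : Continuous f) (h : ∀ x, proj d (f x) = proj d x)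
    (x : E d) : fderiv ℝ f x = ContinuousLinearMap.id ℝ (E d) := by
  have hc := eq_of_mem_lattice (g := fun x => f x - x) (by fun_prop)
    (fun x => proj_eq_proj_iff.1 (h x))
  have : f = fun x => x + (f 0 - 0) := by
    funext y
    rw [← hc y 0]
    abel
  rw [this, fderiv_add_const]
  exact fderiv_fun_id

theorem Dinv_comp_D (ψ : Torus d) : A.Dinv ψ ∘L A.D ψ = ContinuousLinearMap.id ℝ (E d) := by
  obtain ⟨x, rfl⟩ := proj_surjective d ψ
  rw [Dinv, ← A.proj_lift, A.torusDeriv_liftInv_proj, A.D_proj,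
    ← fderiv_comp x (A.differentiable_liftInv _) (A.differentiable_lift _)]
  refine fderiv_of_proj_eq (A.continuous_liftInv.comp A.continuous_lift) (fun y => ?_) x
  rw [Function.comp_apply, A.proj_liftInv, A.proj_lift, Equiv.symm_apply_apply]

theorem D_comp_Dinv (ψ : Torus d) : A.D ψ ∘L A.Dinv ψ = ContinuousLinearMap.id ℝ (E d) := by
  obtain ⟨y, hy⟩ := proj_surjective d (A.toPerm ψ)
  have hψ : ψ = proj d (A.liftInv y) := by rw [A.proj_liftInv, hy, Equiv.symm_apply_apply]
  rw [Dinv, ← hy, A.torusDeriv_liftInv_proj, hψ, A.D_proj,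
    ← fderiv_comp y (A.differentiable_lift _) (A.differentiable_liftInv _)]
  refine fderiv_of_proj_eq (A.continuous_lift.comp A.continuous_liftInv) (fun y => ?_) y
  rw [Function.comp_apply, A.proj_lift, A.proj_liftInv, Equiv.apply_symm_apply]

theorem proj_lift_iterate (n : ℕ) (x : E d) :
    proj d (A.lift^[n] x) = A.toPerm^[n] (proj d x) := by
  induction n generalizing x with
  | zero => rfl
  | succ n ih => rw [Function.iterate_succ_apply, ih, A.proj_lift, Function.iterate_succ_apply]

theorem proj_liftInv_iterate (n : ℕ) (x : E d) :
    proj d (A.liftInv^[n] x) = A.toPerm.symm^[n] (proj d x) := by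
  induction n generalizing x with
  | zero => rfl
  | succ n ih => rw [Function.iterate_succ_apply, ih, A.proj_liftInv, Function.iterate_succ_apply]

theorem torusDeriv_lift_iterate (n : ℕ) (ψ : Torus d) :
    torusDeriv (A.lift^[n]) ψ = coc A.toPerm A.D n ψ := by
  induction n generalizing ψ with
  | zero => exact fderiv_id
  | succ n ih =>
    obtain ⟨x, rfl⟩ := proj_surjective d ψ
    rw [torusDeriv_proj _ (A.continuous_lift.iterate _) _ (A.proj_lift_iterate (n + 1)),
      Function.iterate_succ, fderiv_comp x ((A.differentiable_lift.iterate n) _)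
      (A.differentiable_lift _), coc, ← ih, A.D_proj, ← A.proj_lift,
      torusDeriv_proj _ (A.continuous_lift.iterate _) _ (A.proj_lift_iterate n)]

theorem torusDeriv_liftInv_iterate (n : ℕ) (ψ : Torus d) :
    torusDeriv (A.liftInv^[n]) (A.toPerm^[n] ψ) = cocInv A.toPerm A.Dinv n ψ := by
  induction n generalizing ψ with
  | zero => exact fderiv_id
  | succ n ih =>
    obtain ⟨y, hy⟩ := proj_surjective d (A.toPerm^[n + 1] ψ)
    have h1 : proj d (A.liftInv^[n] y) = A.toPerm ψ := by
      rw [A.proj_liftInv_iterate, hy, Function.iterate_succ_apply]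
      exact (Function.LeftInverse.iterate A.toPerm.symm_apply_apply n) _
    rw [← hy, torusDeriv_proj _ (A.continuous_liftInv.iterate _) _ (A.proj_liftInv_iterate (n + 1)),
      Function.iterate_succ', fderiv_comp y (A.differentiable_liftInv _)
      ((A.differentiable_liftInv.iterate n) _), cocInv, ← ih, Dinv, ← h1,
      A.torusDeriv_liftInv_proj, h1, ← Function.iterate_succ_apply, ← hy,
      torusDeriv_proj _ (A.continuous_liftInv.iterate _) _ (A.proj_liftInv_iterate n)]

theorem exists_lipschitz : ∃ K : ℝ≥0, 1 ≤ K ∧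
    (∀ ψ φ, dist (A.toPerm ψ) (A.toPerm φ) ≤ K * dist ψ φ) ∧
    ∀ ψ φ, dist (A.toPerm.symm ψ) (A.toPerm.symm φ) ≤ K * dist ψ φ := by
  obtain ⟨K, hK, -, h⟩ := A.isQuasiperiodic_lift.exists_lipschitz A.analytic_lift
  obtain ⟨K', hK', -, h'⟩ := A.isQuasiperiodic_liftInv.exists_lipschitz A.analytic_liftInv
  obtain ⟨L, hL⟩ : ∃ L : ℝ≥0, (L : ℝ) = max 1 (max K K') :=
    ⟨(max 1 (max K K')).toNNReal, Real.coe_toNNReal _ (by positivity)⟩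
  refine ⟨L, by rw [← NNReal.coe_le_coe, hL]; exact le_max_left _ _, fun ψ φ => ?_, fun ψ φ => ?_⟩
  · refine dist_le_of_proj (by positivity) (fun x y => ?_) ψ φ
    rw [← A.proj_lift, ← A.proj_lift, dist_eq_norm, ← map_sub]
    refine (norm_proj_le _).trans ((h x y).trans ?_)
    rw [hL]
    exact mul_le_mul_of_nonneg_right ((le_max_left _ _).trans (le_max_right _ _)) (norm_nonneg _)
  · refine dist_le_of_proj (by positivity) (fun x y => ?_) ψ φ
    rw [← A.proj_liftInv, ← A.proj_liftInv, dist_eq_norm, ← map_sub]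
    refine (norm_proj_le _).trans ((h' x y).trans ?_)
    rw [hL]
    exact mul_le_mul_of_nonneg_right ((le_max_right _ _).trans (le_max_right _ _)) (norm_nonneg _)

theorem continuous_toPerm : Continuous A.toPerm := by
  obtain ⟨K, -, h, -⟩ := A.exists_lipschitz
  exact (LipschitzWith.of_dist_le_mul h).continuous

theorem exists_D_lipschitz : ∃ K : ℝ, 0 ≤ K ∧ ∀ ψ φ, ‖A.D ψ - A.D φ‖ ≤ K * dist ψ φ := by
  obtain ⟨K, hK, -, h⟩ := A.isQuasiperiodic_lift.fderiv.exists_lipschitz A.analytic_lift.fderiv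
  refine ⟨K, hK, fun ψ φ => ?_⟩
  rw [← dist_eq_norm]
  refine dist_le_of_proj hK (fun x y => ?_) ψ φ
  rw [A.D_proj, A.D_proj, dist_eq_norm]
  exact h x y

theorem isHol_D {β : ℝ} (hβ : 0 < β) (hβ1 : β ≤ 1) : IsHol (wt d β) A.D := by
  obtain ⟨K, hK, h⟩ := A.exists_D_lipschitz
  exact isHol_of_lipschitz hK h hβ hβ1

theorem isHol_Dinv {β : ℝ} (hβ : 0 < β) (hβ1 : β ≤ 1) : IsHol (wt d β) A.Dinv := by
  obtain ⟨K, hK, -, h⟩ :=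
    A.isQuasiperiodic_liftInv.fderiv.exists_lipschitz A.analytic_liftInv.fderiv
  obtain ⟨K', -, hA, -⟩ := A.exists_lipschitz
  refine isHol_of_lipschitz (K := K * K') (by positivity) (fun ψ φ => ?_) hβ hβ1
  have := dist_le_of_proj (f := torusDeriv A.liftInv) hK (fun x y => by
    rw [A.torusDeriv_liftInv_proj, A.torusDeriv_liftInv_proj, dist_eq_norm]
    exact h x y) (A.toPerm ψ) (A.toPerm φ)
  rw [dist_eq_norm] at this
  refine this.trans ?_
  rw [mul_assoc]
  exact mul_le_mul_of_nonneg_left (hA ψ φ) hK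

end AnalyticDiffeo

theorem wt_le_of_lipschitz {f : Torus d → Torus d} {K : ℝ≥0}
    (h : ∀ ψ φ, dist (f ψ) (f φ) ≤ K * dist ψ φ) {β : ℝ} (hβ : 0 < β) (ψ φ : Torus d) :
    wt d β (f ψ) (f φ) ≤ K ^ β * wt d β ψ φ := by
  rw [wt, wt, ← NNReal.mul_rpow]
  refine NNReal.rpow_le_rpow ?_ hβ.le
  exact_mod_cast h ψ φ

/-- This limits the Hölder exponent: `N` steps multiply distances by at most `K ^ N`, hence weights
by at most `K ^ (β N)`, which tends to `1` as `β → 0`. -/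
theorem exists_rpow_pow_le_two {K : ℝ≥0} (hK : 1 ≤ K) (N : ℕ) :
    ∃ β₁ : ℝ, 0 < β₁ ∧ ∀ β : ℝ, 0 < β → β ≤ β₁ → (K ^ β) ^ N ≤ 2 := by
  have hK0 : (K : ℝ) ≠ 0 := by exact_mod_cast (one_pos.trans_le hK).ne'
  have hc : Filter.Tendsto (fun β : ℝ => ((K : ℝ) ^ β) ^ N) (nhds 0)
      (nhds (((K : ℝ) ^ (0 : ℝ)) ^ N)) := ((Real.continuousAt_const_rpow hK0).pow N).tendsto
  rw [Real.rpow_zero, one_pow] at hc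
  have := hc.eventually (gt_mem_nhds (show (1 : ℝ) < 2 by norm_num))
  obtain ⟨r, hr, h⟩ := Metric.eventually_nhds_iff.1 this
  refine ⟨r / 2, by positivity, fun β hβ hβr => ?_⟩
  have : ((K : ℝ) ^ β) ^ N < 2 := by
    refine h ?_
    rw [Real.dist_0_eq_abs, abs_of_pos hβ]
    linarith
  exact_mod_cast this.le

variable {G : Type*} [NormedAddCommGroup G] [NormedSpace ℝ G]

/-- The four bounds that express a dichotomy of the cocycle `a` over `σ` after `N` steps. -/
structure HasDichotomy {X : Type*} (σ : X → X) (a a' P : X → G →L[ℝ] G) (N : ℕ) (c : ℝ) :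
    Prop where
  -- Since `P` is not required to be invariant, the bounds with `P` applied before and after the
  -- cocycle are independent. The first and third serve the right approximate inverse, the second
  -- and fourth the left one.
  coc_comp : ∀ x, ‖coc σ a N x ∘L P x‖ ≤ c
  comp_coc : ∀ x, ‖P (σ^[N] x) ∘L coc σ a N x‖ ≤ c
  cocInv_comp : ∀ x, ‖cocInv σ a' N x ∘L (ContinuousLinearMap.id ℝ G - P (σ^[N] x))‖ ≤ c
  comp_cocInv : ∀ x, ‖(ContinuousLinearMap.id ℝ G - P x) ∘L cocInv σ a' N x‖ ≤ c

/-- A dichotomy persists if the cocycle and the projectors change little. -/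
theorem HasDichotomy.of_close {X Y : Type*} {σ : X → X} {τ : Y → Y} {a a' P : X → G →L[ℝ] G}
    {b b' Q : Y → G →L[ℝ] G} {N : ℕ} {c κ δ : ℝ} (h : HasDichotomy σ a a' P N c) (π : Y → X)
    (hκ : 0 ≤ κ)
    (h1 : ∀ y, ‖coc σ a N (π y)‖ ≤ κ) (h2 : ∀ y, ‖cocInv σ a' N (π y)‖ ≤ κ)
    (h3 : ∀ y, ‖Q y‖ ≤ κ) (h3' : ∀ y, ‖ContinuousLinearMap.id ℝ G - Q y‖ ≤ κ)
    (h4 : ∀ y, ‖coc τ b N y - coc σ a N (π y)‖ ≤ δ)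
    (h5 : ∀ y, ‖cocInv τ b' N y - cocInv σ a' N (π y)‖ ≤ δ)
    (h6 : ∀ y, ‖Q y - P (π y)‖ ≤ δ) (h7 : ∀ y, ‖Q (τ^[N] y) - P (σ^[N] (π y))‖ ≤ δ) :
    HasDichotomy τ b b' Q N (c + 2 * (κ * δ)) := by
  -- The two ways to split a difference of products are arranged so that only the unperturbed
  -- cocycle and the perturbed projector need to be bounded by `κ`.
  have key : ∀ (S S' R R' : G →L[ℝ] G), ‖S' ∘L R'‖ ≤ c → ‖S - S'‖ * ‖R‖ ≤ κ * δ →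
      ‖S'‖ * ‖R - R'‖ ≤ κ * δ → ‖S ∘L R‖ ≤ c + 2 * (κ * δ) := by
    intro S S' R R' e1 e2 e3
    have : S ∘L R = S' ∘L R' + ((S - S') ∘L R + S' ∘L (R - R')) := by
      simp only [ContinuousLinearMap.sub_comp, ContinuousLinearMap.comp_sub]
      abel
    rw [this]
    refine (norm_add_le _ _).trans (add_le_add e1 ((norm_add_le _ _).trans ?_))
    rw [two_mul]
    exact add_le_add ((ContinuousLinearMap.opNorm_comp_le _ _).trans e2)
      ((ContinuousLinearMap.opNorm_comp_le _ _).trans e3)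
  have key' : ∀ (S S' R R' : G →L[ℝ] G), ‖S' ∘L R'‖ ≤ c → ‖S‖ * ‖R - R'‖ ≤ κ * δ →
      ‖S - S'‖ * ‖R'‖ ≤ κ * δ → ‖S ∘L R‖ ≤ c + 2 * (κ * δ) := by
    intro S S' R R' e1 e2 e3
    have : S ∘L R = S' ∘L R' + (S ∘L (R - R') + (S - S') ∘L R') := by
      simp only [ContinuousLinearMap.sub_comp, ContinuousLinearMap.comp_sub]
      abel
    rw [this]
    refine (norm_add_le _ _).trans (add_le_add e1 ((norm_add_le _ _).trans ?_))
    rw [two_mul]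
    exact add_le_add ((ContinuousLinearMap.opNorm_comp_le _ _).trans e2)
      ((ContinuousLinearMap.opNorm_comp_le _ _).trans e3)
  have hid : ∀ R R' : G →L[ℝ] G, ‖(ContinuousLinearMap.id ℝ G - R) -
      (ContinuousLinearMap.id ℝ G - R')‖ = ‖R - R'‖ := fun R R' => by
    rw [sub_sub_sub_cancel_left, norm_sub_rev]
  have comm : ∀ {s t : ℝ}, 0 ≤ s → 0 ≤ t → s ≤ κ → t ≤ δ → t * s ≤ κ * δ ∧ s * t ≤ κ * δ := by
    intro s t hs ht h h'
    have : s * t ≤ κ * δ := mul_le_mul h h' ht hκ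
    exact ⟨by rwa [mul_comm], this⟩
  constructor
  · intro y
    refine key _ (coc σ a N (π y)) _ (P (π y)) (h.coc_comp _) ?_ ?_
    · exact (comm (norm_nonneg _) (norm_nonneg _) (h3 y) (h4 y)).1
    · exact (comm (norm_nonneg _) (norm_nonneg _) (h1 y) (h6 y)).2
  · intro y
    have e := h.comp_coc (π y)
    refine key' _ (P (σ^[N] (π y))) _ (coc σ a N (π y)) e ?_ ?_
    · exact (comm (norm_nonneg _) (norm_nonneg _) (h3 _) (h4 y)).2
    · exact (comm (norm_nonneg _) (norm_nonneg _) (h1 y) (h7 y)).1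
  · intro y
    refine key _ (cocInv σ a' N (π y)) _ (ContinuousLinearMap.id ℝ G - P (σ^[N] (π y)))
      (h.cocInv_comp _) ?_ ?_
    · exact (comm (norm_nonneg _) (norm_nonneg _) (h3' _) (h5 y)).1
    · rw [hid]
      exact (comm (norm_nonneg _) (norm_nonneg _) (h2 y) (h7 y)).2
  · intro y
    refine key' _ (ContinuousLinearMap.id ℝ G - P (π y)) _ (cocInv σ a' N (π y))
      (h.comp_cocInv _) ?_ ?_
    · exact (comm (norm_nonneg _) (norm_nonneg _) (h3' _) (h5 y)).2
    · rw [hid]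
      exact (comm (norm_nonneg _) (norm_nonneg _) (h2 y) (h6 y)).1

end Diffeo

end AnosovTorus
end

open scoped NNReal ENNReal
noncomputable section
namespace AnosovTorus

/-! ### The analytic curve of solutions of the conjugacy equation -/

section ConjugacyCurve

variable {d : ℕ} {G : Type*} [NormedAddCommGroup G] [NormedSpace ℝ G]

theorem coc_equivariant {X : Type*} {σ : X → X} {a P : X → G →L[ℝ] G}
    (h : ∀ x, P (σ x) ∘L a x = a x ∘L P x) (n : ℕ) (x : X) :
    P (σ^[n] x) ∘L coc σ a n x = coc σ a n x ∘L P x := by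
  induction n generalizing x with
  | zero => rfl
  | succ n ih =>
    rw [Function.iterate_succ_apply, coc, ← ContinuousLinearMap.comp_assoc, ih,
      ContinuousLinearMap.comp_assoc, h, ContinuousLinearMap.comp_assoc]

theorem cocInv_equivariant {X : Type*} {σ : X → X} {a a' P : X → G →L[ℝ] G}
    (inv₁ : ∀ x, a' x ∘L a x = ContinuousLinearMap.id ℝ G)
    (inv₂ : ∀ x, a x ∘L a' x = ContinuousLinearMap.id ℝ G)
    (h : ∀ x, P (σ x) ∘L a x = a x ∘L P x) (n : ℕ) (x : X) :
    P x ∘L cocInv σ a' n x = cocInv σ a' n x ∘L P (σ^[n] x) := by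
  have e1 := cocInv_comp_coc (σ := σ) inv₁ n x
  have e2 := coc_comp_cocInv (σ := σ) inv₂ n x
  calc P x ∘L cocInv σ a' n x
      = (cocInv σ a' n x ∘L coc σ a n x) ∘L P x ∘L cocInv σ a' n x := by
        rw [e1, ContinuousLinearMap.id_comp]
    _ = cocInv σ a' n x ∘L (coc σ a n x ∘L P x) ∘L cocInv σ a' n x := by
        simp only [ContinuousLinearMap.comp_assoc]
    _ = cocInv σ a' n x ∘L P (σ^[n] x) ∘L (coc σ a n x ∘L cocInv σ a' n x) := by
        rw [← coc_equivariant h]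
        simp only [ContinuousLinearMap.comp_assoc]
    _ = cocInv σ a' n x ∘L P (σ^[n] x) := by rw [e2, ContinuousLinearMap.comp_id]

/-- An invariant projector passes through the cocycle and its inverse, so the bounds on one side
give those on the other. -/
theorem HasDichotomy.of_equivariant {X : Type*} {σ : X → X} {a a' P : X → G →L[ℝ] G} {N : ℕ}
    {c : ℝ} (inv₁ : ∀ x, a' x ∘L a x = ContinuousLinearMap.id ℝ G)
    (inv₂ : ∀ x, a x ∘L a' x = ContinuousLinearMap.id ℝ G)
    (h : ∀ x, P (σ x) ∘L a x = a x ∘L P x) (h₁ : ∀ x, ‖coc σ a N x ∘L P x‖ ≤ c)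
    (h₂ : ∀ x, ‖cocInv σ a' N x ∘L (ContinuousLinearMap.id ℝ G - P (σ^[N] x))‖ ≤ c) :
    HasDichotomy σ a a' P N c where
  coc_comp := h₁
  comp_coc x := by rw [coc_equivariant h]; exact h₁ x
  cocInv_comp := h₂
  comp_cocInv x := by
    rw [ContinuousLinearMap.sub_comp, cocInv_equivariant inv₁ inv₂ h, ContinuousLinearMap.id_comp]
    have := h₂ x
    rwa [ContinuousLinearMap.comp_sub, ContinuousLinearMap.comp_id] at this

/-- The operator `w ↦ a w - w ∘ A` of a cocycle with a dichotomy is invertible on Hölder functions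
with small exponents. -/
theorem exists_equiv_of_hasDichotomy [CompleteSpace G] (A : AnalyticDiffeo d)
    {a a' P : Torus d → G →L[ℝ] G} {α : ℝ} (hα : 0 < α) (hα1 : α ≤ 1) (ha : IsHol (wt d α) a)
    (ha' : IsHol (wt d α) a') (hP : Continuous P)
    (inv₁ : ∀ ψ, a' ψ ∘L a ψ = ContinuousLinearMap.id ℝ G)
    (inv₂ : ∀ ψ, a ψ ∘L a' ψ = ContinuousLinearMap.id ℝ G) {N : ℕ}
    (h : HasDichotomy A.toPerm a a' P N (1 / 16)) :
    ∃ β₁ : ℝ, 0 < β₁ ∧ β₁ ≤ α ∧ ∀ β : ℝ, 0 < β → β ≤ β₁ →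
      ∃ e : Hol (wt d β) G ≃L[ℝ] Hol (wt d β) G,
        ∀ w ψ, e w ψ = a ψ (w ψ) - w (A.toPerm ψ) := by
  obtain ⟨K, hK1, hAL, hAL'⟩ := A.exists_lipschitz
  obtain ⟨β₂, hβ₂, hpow⟩ := exists_rpow_pow_le_two hK1 N
  obtain ⟨C₁, hC₁, hb₁, -⟩ := (ha.coc (wt_le_of_lipschitz hAL hα) N).exists_pos
  obtain ⟨C₂, hC₂, hb₂, -⟩ := (ha'.cocInv (wt_le_of_lipschitz hAL hα) N).exists_pos
  obtain ⟨p, hp, hPb⟩ := exists_norm_bound hP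
  set κ : ℝ := C₁ + C₂ + p + 2 with hκ
  have hκ2 : 2 ≤ κ := by linarith
  -- A projector field that is only continuous does not act on Hölder functions. Its Lipschitz
  -- approximation does, and changes the four bounds by at most `2 κ / (32 κ) = 1 / 16`, from `1 /
  -- 16` to `1 / 8`.
  obtain ⟨Q, hQ, hQP⟩ := exists_lipschitz_approx hP (δ := 1 / (32 * κ)) (by positivity)
  have hδ1 : 1 / (32 * κ) ≤ 1 := by
    rw [div_le_one (by positivity)]
    linarith
  have hQb : ∀ ψ, ‖Q ψ‖ ≤ p + 1 := by
    intro ψ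
    have : Q ψ = P ψ + (Q ψ - P ψ) := by abel
    rw [this]
    exact (norm_add_le _ _).trans (add_le_add (hPb ψ) ((hQP ψ).trans hδ1))
  have hd : HasDichotomy A.toPerm a a' Q N (1 / 16 + 2 * (κ * (1 / (32 * κ)))) := by
    refine h.of_close (π := id) (by linarith) (fun ψ => (hb₁ ψ).trans (by linarith))
      (fun ψ => (hb₂ ψ).trans (by linarith)) (fun ψ => (hQb ψ).trans (by linarith))
      (fun ψ => ?_) (fun ψ => ?_) (fun ψ => ?_) hQP (fun ψ => hQP _)
    · refine (norm_sub_le _ _).trans ?_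
      have := ContinuousLinearMap.norm_id_le (𝕜 := ℝ) (E := G)
      have := hQb ψ
      linarith
    · simp only [id, sub_self, norm_zero]
      positivity
    · simp only [id, sub_self, norm_zero]
      positivity
  have hc : 1 / 16 + 2 * (κ * (1 / (32 * κ))) = 1 / 8 := by
    have : κ ≠ 0 := by positivity
    field_simp
    norm_num
  rw [hc] at hd
  refine ⟨min β₂ α, lt_min hβ₂ hα, min_le_right _ _, fun β hβ hβ1 => ?_⟩
  have hβα : β ≤ α := hβ1.trans (min_le_right _ _)
  exact exists_equiv_of_dichotomy A.toPerm (Λ := K ^ β) (wt_le_of_lipschitz hAL hβ)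
    (wt_le_of_lipschitz hAL' hβ) N (hpow β hβ (hβ1.trans (min_le_left _ _)))
    (ha.of_le hβ hβα hα1) (ha'.of_le hβ hβα hα1) (hQ.of_le hβ (hβα.trans hα1) le_rfl) inv₁ inv₂
    hd.coc_comp hd.comp_coc hd.cocInv_comp hd.comp_cocInv

/-- The derivative cocycle of an Anosov diffeomorphism has a dichotomy. -/
theorem IsAnosov.exists_hasDichotomy {A : AnalyticDiffeo d} (hA : IsAnosov A) :
    ∃ (P : Torus d → E d →L[ℝ] E d) (N : ℕ), Continuous P ∧
      HasDichotomy A.toPerm A.D A.Dinv P N (1 / 16) := by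
  obtain ⟨-, Ws, Wu, ds, du, hcompl, -, -, hinvs, hinvu, hcs, hcu, Θ, lam, hΘ, hlam, hlam1, hs,
    hu⟩ := hA
  set U : Bool → Torus d → Submodule ℝ (E d) := fun b ψ => if b then Ws ψ else Wu ψ with hU
  have hint : ∀ ψ, DirectSum.IsInternal fun b => U b ψ := by
    intro ψ
    rw [DirectSum.isInternal_submodule_iff_isCompl (fun b => U b ψ) (i := true) (j := false)
      (by simp) (by ext b; cases b <;> simp)]
    exact hcompl ψ
  have hind := fun ψ => (hint ψ).submodule_iSupIndep
  have htop := fun ψ => (hint ψ).submodule_iSup_eq_top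
  have hcont : ∀ b, Continuous fun ψ => (U b ψ).starProjection := by
    intro b
    cases b
    · exact hcu
    · exact hcs
  have hmap : ∀ ψ b, ∀ x ∈ U b ψ, A.D ψ x ∈ U b (A.toPerm ψ) := by
    intro ψ b x hx
    cases b
    · change A.D ψ x ∈ Wu (A.toPerm ψ)
      rw [← hinvu ψ]
      exact Submodule.mem_map_of_mem (f := (A.D ψ : E d →ₗ[ℝ] E d)) hx
    · change A.D ψ x ∈ Ws (A.toPerm ψ)
      rw [← hinvs ψ]
      exact Submodule.mem_map_of_mem (f := (A.D ψ : E d →ₗ[ℝ] E d)) hx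
  set P : Bool → Torus d → E d →L[ℝ] E d := fun b ψ => obl (fun b => U b ψ) b with hP
  have hPc : ∀ b, Continuous (P b) := fun b => continuous_obl hcont htop b
  have hsum : ∀ ψ, ContinuousLinearMap.id ℝ (E d) - P true ψ = P false ψ := by
    intro ψ
    ext1 x
    have := sum_obl (htop ψ) x
    rw [Fintype.sum_bool] at this
    change x - P true ψ x = P false ψ x
    rw [sub_eq_iff_eq_add']
    exact this.symm
  obtain ⟨p, hp, hpb⟩ := exists_norm_bound (hPc true)
  obtain ⟨q, hq, hqb⟩ := exists_norm_bound (hPc false)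
  -- Here `p` and `q` bound the two oblique projectors, so after `N` steps the contraction beats the
  -- angle between the stable and unstable spaces.
  obtain ⟨N, hN⟩ := exists_pow_lt_of_lt_one (show 0 < 1 / (16 * (Θ * (p + q))) by positivity) hlam1
  have hN' : Θ * lam ^ N * (p + q) ≤ 1 / 16 := by
    rw [lt_div_iff₀ (by positivity)] at hN
    nlinarith
  have hΘN : 0 ≤ Θ * lam ^ N := by positivity
  refine ⟨P true, N, hPc true, HasDichotomy.of_equivariant A.Dinv_comp_D A.D_comp_Dinv
    (fun ψ => obl_comp_of_map_le (htop ψ) (hind _) (htop _) (hmap ψ) true) (fun ψ => ?_)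
    (fun ψ => ?_)⟩
  · refine ContinuousLinearMap.opNorm_le_bound _ (by norm_num) fun x => ?_
    have h1 := hs N ψ (P true ψ x) (obl_mem (fun b => U b ψ) true x)
    rw [A.torusDeriv_lift_iterate] at h1
    refine h1.trans ?_
    have h2 : ‖P true ψ x‖ ≤ (p + q) * ‖x‖ := ContinuousLinearMap.le_of_opNorm_le _
      ((hpb ψ).trans (by linarith)) x
    calc Θ * lam ^ N * ‖P true ψ x‖ ≤ Θ * lam ^ N * ((p + q) * ‖x‖) :=
          mul_le_mul_of_nonneg_left h2 hΘN
      _ = Θ * lam ^ N * (p + q) * ‖x‖ := by ring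
      _ ≤ 1 / 16 * ‖x‖ := mul_le_mul_of_nonneg_right hN' (norm_nonneg _)
  · rw [hsum]
    refine ContinuousLinearMap.opNorm_le_bound _ (by norm_num) fun x => ?_
    set φ := A.toPerm^[N] ψ with hφ
    have h1 := hu N φ (P false φ x) (obl_mem (fun b => U b φ) false x)
    rw [hφ, A.torusDeriv_liftInv_iterate] at h1
    refine h1.trans ?_
    have h2 : ‖P false φ x‖ ≤ (p + q) * ‖x‖ := ContinuousLinearMap.le_of_opNorm_le _
      ((hqb φ).trans (by linarith)) x
    calc Θ * lam ^ N * ‖P false φ x‖ ≤ Θ * lam ^ N * ((p + q) * ‖x‖) :=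
          mul_le_mul_of_nonneg_left h2 hΘN
      _ = Θ * lam ^ N * (p + q) * ‖x‖ := by ring
      _ ≤ 1 / 16 * ‖x‖ := mul_le_mul_of_nonneg_right hN' (norm_nonneg _)

theorem exists_lipschitz_of_analytic [CompleteSpace G] {F : Torus d → G}
    (hF : AnalyticOnNhd ℝ (fun x => F (proj d x)) Set.univ) :
    ∃ K : ℝ, 0 ≤ K ∧ ∀ ψ φ, ‖F ψ - F φ‖ ≤ K * dist ψ φ := by
  obtain ⟨K, hK, -, h⟩ := (isQuasiperiodic_comp_proj F).exists_lipschitz hF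
  refine ⟨K, hK, fun ψ φ => ?_⟩
  rw [← dist_eq_norm]
  refine dist_le_of_proj hK (fun x y => ?_) ψ φ
  rw [dist_eq_norm]
  exact h x y

-- The abstract form of the conjugacy equation: `N₁` is the increment of the lift of `A`, `N₂ + f`
-- is `F` at the displaced point, and `T` is composition with `A`. The terms with the factor `ε` do
-- not contribute to the `y`-derivative at `ε = 0`.
open Filter Topology in
theorem exists_analytic_curve_affine {Y : Type*} [NormedAddCommGroup Y] [NormedSpace ℝ Y]
    [CompleteSpace Y] {N₁ N₂ : Y → Y} (hN₁ : AnalyticAt ℝ N₁ 0) (hN₁0 : N₁ 0 = 0)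
    (hN₂ : AnalyticAt ℝ N₂ 0) {N₁' : Y →L[ℝ] Y} (hN₁' : HasFDerivAt N₁ N₁' 0) (f : Y)
    (T : Y →L[ℝ] Y) (e : Y ≃L[ℝ] Y) (he : (e : Y →L[ℝ] Y) = N₁' - T) :
    ∃ h : ℝ → Y, AnalyticAt ℝ h 0 ∧ h 0 = 0 ∧
      ∀ᶠ ε in 𝓝 (0 : ℝ), N₁ (h ε) + ε • (N₂ (h ε) + f) - T (h ε) = 0 := by
  set Φ : ℝ × Y → Y := fun q => N₁ q.2 + q.1 • (N₂ q.2 + f) - T q.2 with hΦ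
  have hΦa : AnalyticAt ℝ Φ 0 := by
    have e1 : AnalyticAt ℝ (fun q : ℝ × Y => N₁ q.2) 0 :=
      AnalyticAt.comp (g := N₁) (by exact hN₁) analyticAt_snd
    have e2 : AnalyticAt ℝ (fun q : ℝ × Y => N₂ q.2) 0 :=
      AnalyticAt.comp (g := N₂) (by exact hN₂) analyticAt_snd
    have e3 : AnalyticAt ℝ (fun q : ℝ × Y => T q.2) 0 :=
      AnalyticAt.comp (g := T) (T.analyticAt _) analyticAt_snd
    exact (e1.add (analyticAt_fst.smul (e2.add analyticAt_const))).sub e3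
  have hΦ0 : Φ 0 = 0 := by
    simp [hΦ, hN₁0]
  have hderiv : HasFDerivAt (fun y => Φ (0, y)) (e : Y →L[ℝ] Y) 0 := by
    have e2 : (fun y => Φ (0, y)) = fun y => N₁ y - T y := by
      funext y
      simp [hΦ]
    rw [he, e2]
    exact hN₁'.sub T.hasFDerivAt
  exact exists_analytic_curve hΦa hΦ0 e hderiv

open Filter Topology in
/-- The solutions of the conjugacy equation form an analytic curve of Hölder functions. -/
theorem exists_conjugacy_curve (A : AnalyticDiffeo d) (hA : IsAnosov A) (F : Torus d → E d)
    (hF : AnalyticOnNhd ℝ (fun x => F (proj d x)) Set.univ) :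
    ∃ β₁ : ℝ, 0 < β₁ ∧ β₁ ≤ 1 ∧ ∀ β : ℝ, 0 < β → β ≤ β₁ →
      ∃ h : ℝ → Hol (wt d β) (E d), AnalyticAt ℝ h 0 ∧ h 0 = 0 ∧
        ∀ᶠ ε in 𝓝 (0 : ℝ), ∀ x, perturbedLift A F ε (x + h ε (proj d x)) =
          A.lift x + h ε (A.toPerm (proj d x)) := by
  obtain ⟨P, N, hP, hdich⟩ := hA.exists_hasDichotomy
  obtain ⟨β₁, hβ₁, hβ₁1, he⟩ := exists_equiv_of_hasDichotomy A one_pos le_rfl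
    (A.isHol_D one_pos le_rfl) (A.isHol_Dinv one_pos le_rfl) hP A.Dinv_comp_D A.D_comp_Dinv hdich
  refine ⟨β₁, hβ₁, hβ₁1, fun β hβ hβ' => ?_⟩
  have hβ1 := hβ'.trans hβ₁1
  obtain ⟨e, hea⟩ := he β hβ hβ'
  obtain ⟨N₁, r₁, hr₁, hN₁, hN₁a, N₁', hN₁', hN₁'a⟩ :=
    A.isQuasiperiodic_lift.exists_nemytskii A.analytic_lift hβ hβ1
  obtain ⟨N₂, r₂, hr₂, hN₂, hN₂a, -⟩ :=
    (isQuasiperiodic_comp_proj F).exists_nemytskii hF hβ hβ1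
  obtain ⟨K, -, hAL, -⟩ := A.exists_lipschitz
  obtain ⟨KF, hKF, hFL⟩ := exists_lipschitz_of_analytic hF
  set Fh : Hol (wt d β) (E d) := Hol.mk F (isHol_of_lipschitz hKF hFL hβ hβ1) with hFh
  set T : Hol (wt d β) (E d) →L[ℝ] Hol (wt d β) (E d) :=
    Hol.compCLM (E d) A.toPerm (K ^ β) (wt_le_of_lipschitz hAL hβ) with hT
  have hN₁0 : N₁ 0 = 0 := by
    ext1 ψ
    obtain ⟨x, rfl⟩ := proj_surjective d ψ
    rw [hN₁a 0 (by simpa using hr₁)]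
    simp
  -- The linearization at the unperturbed solution is `w ↦ DA w - w ∘ A`, the operator inverted by
  -- the dichotomy.
  have e1 : (e : Hol (wt d β) (E d) →L[ℝ] Hol (wt d β) (E d)) = N₁' - T := by
    ext1 w
    apply Hol.ext
    intro ψ
    obtain ⟨x, rfl⟩ := proj_surjective d ψ
    change e w (proj d x) = N₁' w (proj d x) - w (A.toPerm (proj d x))
    rw [hea, hN₁'a, A.D_proj]
  obtain ⟨h, hha, hh0, hheq⟩ := exists_analytic_curve_affine hN₁ hN₁0 hN₂ hN₁' Fh T e e1
  refine ⟨h, hha, hh0, ?_⟩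
  have hsmall : ∀ᶠ ε in 𝓝 (0 : ℝ), ‖h ε‖ < min r₁ r₂ := by
    have : Tendsto (fun ε => ‖h ε‖) (𝓝 0) (𝓝 ‖h 0‖) := hha.continuousAt.norm
    rw [hh0, norm_zero] at this
    exact this.eventually (gt_mem_nhds (lt_min hr₁ hr₂))
  filter_upwards [hheq, hsmall] with ε h1 h2 x
  have h3 := congrArg (fun u : Hol (wt d β) (E d) => u (proj d x)) h1
  change N₁ (h ε) (proj d x) + ε • (N₂ (h ε) (proj d x) + F (proj d x)) -
    h ε (A.toPerm (proj d x)) = 0 at h3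
  rw [hN₁a _ (h2.trans_le (min_le_left _ _)), hN₂a _ (h2.trans_le (min_le_right _ _)),
    sub_add_cancel] at h3
  rw [perturbedLift]
  rw [sub_eq_zero] at h3
  rw [← h3]
  abel

end ConjugacyCurve

end AnosovTorus
end

open scoped NNReal ENNReal
noncomputable section
namespace AnosovTorus

/-! ### Uniform linear estimates on bounded functions for nearby base maps -/

section StructuralStability

variable {d : ℕ} {G : Type*} [NormedAddCommGroup G] [NormedSpace ℝ G]

/-- The bounded functions with the supremum norm. -/
abbrev Bdd (X G : Type*) [NormedAddCommGroup G] [NormedSpace ℝ G] : Type _ :=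
  -- With the constant weight `2` the Hölder condition follows from the sup bound by the triangle
  -- inequality. Every map of `X` preserves this weight, so the dichotomy theorem holds over an
  -- arbitrary permutation, with `Λ = 1`.
  Hol (fun _ _ : X => (2 : ℝ≥0)) G

theorem norm_sub_le_two_mul {X G : Type*} [NormedAddCommGroup G] {f : X → G} {C : ℝ} (h : ∀ x, ‖f x‖ ≤ C) (x y : X) :
    ‖f x - f y‖ ≤ C * ((2 : ℝ≥0) : ℝ) := by
  refine (norm_sub_le _ _).trans ((add_le_add (h x) (h y)).trans (le_of_eq ?_))
  push_cast
  ring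

theorem isHol_of_bound {X G : Type*} [NormedAddCommGroup G] {f : X → G} {C : ℝ} (h : ∀ x, ‖f x‖ ≤ C) :
    IsHol (fun _ _ : X => (2 : ℝ≥0)) f :=
  ⟨C, h, norm_sub_le_two_mul h⟩

theorem Bdd.norm_le {X : Type*} {u : Bdd X G} {C : ℝ} (hC : 0 ≤ C) (h : ∀ x, ‖u x‖ ≤ C) :
    ‖u‖ ≤ C :=
  Hol.norm_le hC h (norm_sub_le_two_mul h)

/-- Telescoping along the orbit. The constant does not depend on `τ`, which enters only through its
uniform distance to `A`, and no regularity of `τ` is needed. -/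
theorem exists_norm_coc_sub_le (A : AnalyticDiffeo d) {a : Torus d → G →L[ℝ] G}
    (ha : IsHol (wt d 1) a) (n : ℕ) : ∃ C : ℝ, 0 ≤ C ∧ ∀ (τ : Torus d → Torus d) (s : ℝ),
      (∀ ψ, dist (τ ψ) (A.toPerm ψ) ≤ s) →
      ∀ ψ, ‖coc τ a n ψ - coc A.toPerm a n ψ‖ ≤ C * s := by
  obtain ⟨K, -, hAL, -⟩ := A.exists_lipschitz
  induction n with
  | zero => exact ⟨0, le_rfl, fun τ s _ ψ => by simp [coc]⟩
  | succ n ih =>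
    obtain ⟨C, hC, h⟩ := ih
    obtain ⟨B, hB, h1, -⟩ := ha.exists_pos
    obtain ⟨L, hL, -, h2⟩ := (ha.coc (wt_le_of_lipschitz hAL one_pos) n).exists_pos
    refine ⟨(C + L) * B, by positivity, fun τ s hτ ψ => ?_⟩
    have hs : 0 ≤ s := dist_nonneg.trans (hτ ψ)
    have e : coc τ a (n + 1) ψ - coc A.toPerm a (n + 1) ψ =
        ((coc τ a n (τ ψ) - coc A.toPerm a n (τ ψ)) +
          (coc A.toPerm a n (τ ψ) - coc A.toPerm a n (A.toPerm ψ))) ∘L a ψ := by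
      rw [sub_add_sub_cancel, ContinuousLinearMap.sub_comp]
      rfl
    rw [e]
    refine (ContinuousLinearMap.opNorm_comp_le _ _).trans ?_
    have e2 : ‖coc A.toPerm a n (τ ψ) - coc A.toPerm a n (A.toPerm ψ)‖ ≤ L * s := by
      refine (h2 _ _).trans (mul_le_mul_of_nonneg_left ?_ hL.le)
      rw [coe_wt, Real.rpow_one]
      exact hτ ψ
    calc _ ≤ (C * s + L * s) * B := mul_le_mul ((norm_add_le _ _).trans
            (add_le_add (h τ s hτ (τ ψ)) e2)) (h1 ψ) (norm_nonneg _) (by positivity)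
      _ = (C + L) * B * s := by ring

theorem exists_norm_cocInv_sub_le (A : AnalyticDiffeo d) {a : Torus d → G →L[ℝ] G}
    (ha : IsHol (wt d 1) a) (n : ℕ) : ∃ C : ℝ, 0 ≤ C ∧ ∀ (τ : Torus d → Torus d) (s : ℝ),
      (∀ ψ, dist (τ ψ) (A.toPerm ψ) ≤ s) →
      ∀ ψ, ‖cocInv τ a n ψ - cocInv A.toPerm a n ψ‖ ≤ C * s := by
  obtain ⟨K, -, hAL, -⟩ := A.exists_lipschitz
  induction n with
  | zero => exact ⟨0, le_rfl, fun τ s _ ψ => by simp [cocInv]⟩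
  | succ n ih =>
    obtain ⟨C, hC, h⟩ := ih
    obtain ⟨B, hB, h1, -⟩ := ha.exists_pos
    obtain ⟨L, hL, -, h2⟩ := (ha.cocInv (wt_le_of_lipschitz hAL one_pos) n).exists_pos
    refine ⟨B * (C + L), by positivity, fun τ s hτ ψ => ?_⟩
    have hs : 0 ≤ s := dist_nonneg.trans (hτ ψ)
    have e : cocInv τ a (n + 1) ψ - cocInv A.toPerm a (n + 1) ψ =
        a ψ ∘L ((cocInv τ a n (τ ψ) - cocInv A.toPerm a n (τ ψ)) +
          (cocInv A.toPerm a n (τ ψ) - cocInv A.toPerm a n (A.toPerm ψ))) := by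
      rw [sub_add_sub_cancel, ContinuousLinearMap.comp_sub]
      rfl
    rw [e]
    refine (ContinuousLinearMap.opNorm_comp_le _ _).trans ?_
    have e2 : ‖cocInv A.toPerm a n (τ ψ) - cocInv A.toPerm a n (A.toPerm ψ)‖ ≤ L * s := by
      refine (h2 _ _).trans (mul_le_mul_of_nonneg_left ?_ hL.le)
      rw [coe_wt, Real.rpow_one]
      exact hτ ψ
    calc _ ≤ B * (C * s + L * s) := mul_le_mul (h1 ψ) ((norm_add_le _ _).trans
            (add_le_add (h τ s hτ (τ ψ)) e2)) (norm_nonneg _) hB.le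
      _ = B * (C + L) * s := by ring

theorem exists_dist_iterate_le (A : AnalyticDiffeo d) (n : ℕ) : ∃ C : ℝ, 0 ≤ C ∧
    ∀ (τ : Torus d → Torus d) (s : ℝ), (∀ ψ, dist (τ ψ) (A.toPerm ψ) ≤ s) →
      ∀ ψ, dist (τ^[n] ψ) (A.toPerm^[n] ψ) ≤ C * s := by
  obtain ⟨K, -, hAL, -⟩ := A.exists_lipschitz
  induction n with
  | zero => exact ⟨0, le_rfl, fun τ s _ ψ => by simp⟩
  | succ n ih =>
    obtain ⟨C, hC, h⟩ := ih
    refine ⟨1 + K * C, by positivity, fun τ s hτ ψ => ?_⟩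
    rw [Function.iterate_succ_apply', Function.iterate_succ_apply']
    calc _ ≤ dist (τ (τ^[n] ψ)) (A.toPerm (τ^[n] ψ)) +
          dist (A.toPerm (τ^[n] ψ)) (A.toPerm (A.toPerm^[n] ψ)) := dist_triangle _ _ _
      _ ≤ s + K * (C * s) := add_le_add (hτ _)
          ((hAL _ _).trans (mul_le_mul_of_nonneg_left (h τ s hτ ψ) K.coe_nonneg))
      _ = (1 + K * C) * s := by ring

/-- A dichotomy persists under small changes of the base map. -/
theorem HasDichotomy.exists_of_base_close (A : AnalyticDiffeo d) {a a' P : Torus d → G →L[ℝ] G}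
    {N : ℕ} (h : HasDichotomy A.toPerm a a' P N (1 / 16)) (ha : IsHol (wt d 1) a)
    (ha' : IsHol (wt d 1) a') (hP : Continuous P) :
    ∃ s : ℝ, 0 < s ∧ ∀ τ : Torus d → Torus d, (∀ ψ, dist (τ ψ) (A.toPerm ψ) ≤ s) →
      HasDichotomy τ a a' P N (1 / 8) := by
  obtain ⟨K, -, hAL, -⟩ := A.exists_lipschitz
  obtain ⟨C₁, hC₁, hb₁, -⟩ := (ha.coc (wt_le_of_lipschitz hAL one_pos) N).exists_pos
  obtain ⟨C₂, hC₂, hb₂, -⟩ := (ha'.cocInv (wt_le_of_lipschitz hAL one_pos) N).exists_pos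
  obtain ⟨p, hp, hPb⟩ := exists_norm_bound hP
  obtain ⟨B₁, hB₁, h₁⟩ := exists_norm_coc_sub_le A ha N
  obtain ⟨B₂, hB₂, h₂⟩ := exists_norm_cocInv_sub_le A ha' N
  obtain ⟨B₃, hB₃, h₃⟩ := exists_dist_iterate_le A N
  set κ : ℝ := C₁ + C₂ + p + 1 with hκ
  have hκ0 : 0 < κ := by positivity
  set δ : ℝ := 1 / (32 * κ) with hδ
  have hδ0 : 0 < δ := by positivity
  obtain ⟨η, hη, hu⟩ := Metric.uniformContinuous_iff.1
    (CompactSpace.uniformContinuous_of_continuous hP) δ hδ0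
  set B : ℝ := B₁ + B₂ + B₃ + 1 with hB
  have hB0 : 0 < B := by positivity
  refine ⟨min δ (η / 2) / B, by positivity, fun τ hτ => ?_⟩
  have hle : ∀ B', 0 ≤ B' → B' ≤ B → B' * (min δ (η / 2) / B) ≤ min δ (η / 2) := by
    intro B' _ hB'
    rw [mul_div_assoc', div_le_iff₀ hB0, mul_comm]
    exact mul_le_mul_of_nonneg_left hB' (by positivity)
  have := h.of_close (Q := P) (b := a) (b' := a') (τ := τ) (δ := δ) id hκ0.le
    (fun ψ => (hb₁ ψ).trans (by linarith)) (fun ψ => (hb₂ ψ).trans (by linarith))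
    (fun ψ => (hPb ψ).trans (by linarith)) (fun ψ => ?_)
    (fun ψ => (h₁ τ _ hτ ψ).trans ((hle B₁ hB₁ (by linarith)).trans (min_le_left _ _)))
    (fun ψ => (h₂ τ _ hτ ψ).trans ((hle B₂ hB₂ (by linarith)).trans (min_le_left _ _)))
    (fun ψ => by simpa using hδ0.le) (fun ψ => ?_)
  · have hc : 1 / 16 + 2 * (κ * δ) = 1 / 8 := by
      rw [hδ]
      field_simp
      norm_num
    rwa [hc] at this
  · refine (norm_sub_le _ _).trans ?_
    have := ContinuousLinearMap.norm_id_le (𝕜 := ℝ) (E := G)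
    have := hPb ψ
    linarith
  · rw [← dist_eq_norm]
    refine (hu ?_).le
    refine (h₃ τ _ hτ ψ).trans_lt ((hle B₃ hB₃ (by linarith)).trans_lt ?_)
    exact (min_le_right _ _).trans_lt (by linarith)

/-- The operator `k ↦ DA k - k ∘ τ` on bounded functions is invertible, with uniform bounds, for
the permutations `τ` close to the Anosov diffeomorphism `A`. -/
theorem IsAnosov.exists_uniform_equiv {A : AnalyticDiffeo d} (hA : IsAnosov A) :
    ∃ s M : ℝ, 0 < s ∧ 0 < M ∧ ∀ τ : Equiv.Perm (Torus d),
      (∀ ψ, dist (τ ψ) (A.toPerm ψ) ≤ s) →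
      ∃ e : Bdd (Torus d) (E d) ≃L[ℝ] Bdd (Torus d) (E d),
        (∀ k ψ, e k ψ = A.D ψ (k ψ) - k (τ ψ)) ∧ ∀ k, ‖k‖ ≤ M * ‖e k‖ := by
  obtain ⟨P, N, hP, hdich⟩ := hA.exists_hasDichotomy
  have hD := A.isHol_D one_pos le_rfl
  have hD' := A.isHol_Dinv one_pos le_rfl
  obtain ⟨s, hs, h⟩ := hdich.exists_of_base_close A hD hD' hP
  obtain ⟨K, hK, hDb, -⟩ := hD.exists_pos
  obtain ⟨K', hK', hDb', -⟩ := hD'.exists_pos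
  obtain ⟨p, hp, hPb⟩ := exists_norm_bound hP
  refine ⟨s, 2 * ((p + 1) * (N * (K + 1) ^ N)) + 1, hs, by positivity, fun τ hτ => ?_⟩
  have hd := h τ hτ
  -- The cocycle remains `DA`; only the base map is replaced by `τ`.
  obtain ⟨e, he⟩ := exists_equiv_of_dichotomy (ω := fun _ _ : Torus d => (2 : ℝ≥0)) τ (Λ := 1)
    (by simp) (by simp) N (by simp) (isHol_of_bound hDb) (isHol_of_bound hDb')
    (isHol_of_bound hPb) A.Dinv_comp_D A.D_comp_Dinv hd.coc_comp hd.comp_coc hd.cocInv_comp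
    hd.comp_cocInv
  refine ⟨e, he, fun k => ?_⟩
  -- The term `‖k‖ / 4` is absorbed on the left, which bounds `‖k‖` by `4 / 3` of the second term;
  -- `M` is larger than this and does not depend on `τ`.
  have h1 : ‖k‖ ≤ ‖k‖ / 4 + (p + 1) * (N * (K + 1) ^ N) * ‖e k‖ := by
    refine Bdd.norm_le (by positivity) fun ψ => ?_
    refine norm_le_of_dichotomy τ.surjective (by linarith) (fun ψ => (hDb ψ).trans (by linarith))
      hPb A.Dinv_comp_D N hd.comp_coc hd.comp_cocInv (norm_nonneg _) k.norm_apply_le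
      (fun ψ => ?_) ψ
    rw [← he]
    exact (e k).norm_apply_le ψ
  have : 0 ≤ ‖e k‖ := norm_nonneg _
  have : 0 ≤ (p + 1) * (N * (K + 1) ^ N) * ‖e k‖ := by positivity
  nlinarith [norm_nonneg k]

/-- The increment `Ã(x + v) - Ã(x)` of a lift at a point `x` above `ψ`. -/
def AnalyticDiffeo.incr (A : AnalyticDiffeo d) (ψ : Torus d) (v : E d) : E d :=
  A.lift (Quotient.out ψ + v) - A.lift (Quotient.out ψ)

theorem AnalyticDiffeo.proj_incr (A : AnalyticDiffeo d) (ψ : Torus d) (v : E d) :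
    proj d (A.incr ψ v) = A.toPerm (ψ + proj d v) - A.toPerm ψ := by
  rw [incr, map_sub, A.proj_lift, A.proj_lift, map_add, proj_out]

/-- The derivative of `v ↦ incr v - DA v` is a difference of differentials of the lift at points at
distance `‖v‖`, and `DA` is Lipschitz. So the nonlinear remainder has a small Lipschitz constant on
small balls, uniformly in `ψ`. -/
theorem AnalyticDiffeo.exists_incr_bound (A : AnalyticDiffeo d) : ∃ L : ℝ, 0 < L ∧
    (∀ ψ v w, ‖A.incr ψ v - A.incr ψ w‖ ≤ L * ‖v - w‖) ∧
    ∀ ψ (r : ℝ) v w, ‖v‖ ≤ r → ‖w‖ ≤ r →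
      ‖(A.incr ψ v - A.D ψ v) - (A.incr ψ w - A.D ψ w)‖ ≤ L * r * ‖v - w‖ := by
  obtain ⟨K, hK, -, h⟩ := A.isQuasiperiodic_lift.exists_lipschitz A.analytic_lift
  obtain ⟨L, hL, -, h'⟩ :=
    A.isQuasiperiodic_lift.fderiv.exists_lipschitz A.analytic_lift.fderiv
  refine ⟨K + L + 1, by positivity, fun ψ v w => ?_, fun ψ r v w hv hw => ?_⟩
  · rw [incr, incr, sub_sub_sub_cancel_right]
    refine (h _ _).trans ?_
    rw [add_sub_add_left_eq_sub]
    exact mul_le_mul_of_nonneg_right (by linarith) (norm_nonneg _)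
  · set x : E d := Quotient.out ψ with hx
    have hr : 0 ≤ r := (norm_nonneg _).trans hv
    have hDx : A.D ψ = fderiv ℝ A.lift x := rfl
    have hder : ∀ z, HasFDerivAt (fun v => A.incr ψ v - A.D ψ v)
        (fderiv ℝ A.lift (x + z) - fderiv ℝ A.lift x) z := by
      intro z
      have h1 : HasFDerivAt (fun v => A.lift (x + v)) (fderiv ℝ A.lift (x + z)) z :=
        (hasFDerivAt_comp_add_left x).2 (A.differentiable_lift (x + z)).hasFDerivAt
      exact (h1.sub_const _).sub (A.D ψ).hasFDerivAt
    have := Convex.norm_image_sub_le_of_norm_hasFDerivWithin_le (𝕜 := ℝ)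
      (f := fun v => A.incr ψ v - A.D ψ v) (C := (K + L + 1) * r)
      (s := Metric.closedBall (0 : E d) r) (x := w) (y := v)
      (fun z _ => (hder z).hasFDerivWithinAt) (fun z hz => ?_) (convex_closedBall _ _)
      (by simpa using hw) (by simpa using hv)
    · exact this
    · refine (h' _ _).trans ?_
      rw [add_sub_cancel_left]
      have hz' : ‖z‖ ≤ r := by simpa using hz
      exact mul_le_mul (by linarith) hz' (norm_nonneg _) (by positivity)

theorem dist_perturbed_le (A : AnalyticDiffeo d) {F : Torus d → E d} {B : ℝ}
    (hB : ∀ ψ, ‖F ψ‖ ≤ B) (ε : ℝ) (ψ : Torus d) :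
    dist (perturbed A F ε ψ) (A.toPerm ψ) ≤ |ε| * B := by
  rw [perturbed, dist_self_add_left]
  refine (norm_proj_le _).trans ?_
  rw [norm_smul, Real.norm_eq_abs]
  exact mul_le_mul_of_nonneg_left (hB ψ) (abs_nonneg _)

/-- `A_ε = (id + εF ∘ A⁻¹) ∘ A`, and `εF ∘ A⁻¹` has Lipschitz constant at most `1 / 2`. Injectivity
is immediate; for surjectivity the contraction principle is applied on `ℝ^d`, above the torus. -/
theorem exists_perturbed_bijective (A : AnalyticDiffeo d) {F : Torus d → E d} {K : ℝ}
    (hK : 0 ≤ K) (hF : ∀ ψ φ, ‖F ψ - F φ‖ ≤ K * dist ψ φ) :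
    ∃ r : ℝ, 0 < r ∧ ∀ ε : ℝ, |ε| < r → Function.Bijective (perturbed A F ε) := by
  obtain ⟨L, hL1, -, hL⟩ := A.exists_lipschitz
  refine ⟨1 / (2 * (K * L + 1)), by positivity, fun ε hε => ?_⟩
  have hL0 : (0 : ℝ) ≤ L := L.coe_nonneg
  have hKL : 0 ≤ K * L := mul_nonneg hK hL0
  have hε' : |ε| * (K * L) ≤ 1 / 2 := by
    rw [lt_div_iff₀ (by positivity)] at hε
    nlinarith [abs_nonneg ε]
  have hbound : ∀ ψ φ, ‖ε • F (A.toPerm.symm ψ) - ε • F (A.toPerm.symm φ)‖ ≤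
      1 / 2 * dist ψ φ := by
    intro ψ φ
    rw [← smul_sub, norm_smul, Real.norm_eq_abs]
    calc |ε| * ‖F (A.toPerm.symm ψ) - F (A.toPerm.symm φ)‖
        ≤ |ε| * (K * (L * dist ψ φ)) := by
          refine mul_le_mul_of_nonneg_left ((hF _ _).trans ?_) (abs_nonneg _)
          exact mul_le_mul_of_nonneg_left (hL _ _) hK
      _ = |ε| * (K * L) * dist ψ φ := by ring
      _ ≤ 1 / 2 * dist ψ φ := mul_le_mul_of_nonneg_right hε' dist_nonneg
  constructor
  · intro ψ φ h
    apply A.toPerm.injective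
    have h1 : A.toPerm ψ - A.toPerm φ = proj d (ε • F φ - ε • F ψ) := by
      rw [map_sub, sub_eq_sub_iff_add_eq_add]
      rw [add_comm (proj d (ε • F φ))]
      exact h
    have h2 := hbound (A.toPerm φ) (A.toPerm ψ)
    rw [Equiv.symm_apply_apply, Equiv.symm_apply_apply] at h2
    have h3 : dist (A.toPerm ψ) (A.toPerm φ) ≤ 1 / 2 * dist (A.toPerm ψ) (A.toPerm φ) := by
      rw [dist_comm (A.toPerm φ)] at h2
      refine le_trans ?_ h2
      rw [dist_eq_norm, h1]
      exact norm_proj_le _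
    have h4 : dist (A.toPerm ψ) (A.toPerm φ) = 0 := by
      have := dist_nonneg (x := A.toPerm ψ) (y := A.toPerm φ)
      linarith
    exact (Metric.inseparable_iff.2 h4).eq
  · intro φ
    obtain ⟨y, rfl⟩ := proj_surjective d φ
    set f : E d → E d := fun x => y - ε • F (A.toPerm.symm (proj d x)) with hf
    have hc : ContractingWith (1 / 2) f := by
      refine ⟨by norm_num, LipschitzWith.of_dist_le_mul fun x x' => ?_⟩
      rw [hf, dist_sub_left, dist_eq_norm]
      refine (hbound _ _).trans ?_
      rw [dist_eq_norm, ← map_sub, dist_eq_norm]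
      push_cast
      exact mul_le_mul_of_nonneg_left (norm_proj_le _) (by norm_num)
    have hx : f (hc.fixedPoint f) = hc.fixedPoint f := hc.fixedPoint_isFixedPt
    set x := hc.fixedPoint f
    refine ⟨A.toPerm.symm (proj d x), ?_⟩
    rw [perturbed, Equiv.apply_symm_apply, ← map_add]
    congr 1
    exact (eq_sub_iff_add_eq.1 hx.symm)

end StructuralStability

end AnosovTorus
end

open scoped NNReal ENNReal
noncomputable section
namespace AnosovTorus

/-! ### Bijectivity of the conjugacy -/

section Homeomorphism

variable {d : ℕ}

theorem AnalyticDiffeo.incr_zero (A : AnalyticDiffeo d) (ψ : Torus d) : A.incr ψ 0 = 0 := by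
  simp [incr]

theorem lattice_small {x : E d} (hx : proj d x = 0) (h : ‖x‖ ≤ 1) : x = 0 := by
  refine eq_zero_of_mem_lattice (proj_eq_zero_iff.1 hx) (h.trans_lt ?_)
  linarith [Real.pi_gt_three]

/-- A map near the identity that commutes with a small perturbation of an Anosov diffeomorphism is
the identity. -/
theorem IsAnosov.exists_commuting_eq_id {A : AnalyticDiffeo d} (hA : IsAnosov A)
    {F : Torus d → E d} {K B : ℝ} (hK : 0 ≤ K) (hF : ∀ ψ φ, ‖F ψ - F φ‖ ≤ K * dist ψ φ)
    (hB : 0 ≤ B) (hFB : ∀ ψ, ‖F ψ‖ ≤ B) :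
    ∃ r ε₁ : ℝ, 0 < r ∧ 0 < ε₁ ∧ ∀ ε : ℝ, |ε| < ε₁ → ∀ g : Torus d → E d, (∀ ψ, ‖g ψ‖ ≤ r) →
      (∀ ψ, perturbed A F ε (ψ + proj d (g ψ)) =
        perturbed A F ε ψ + proj d (g (perturbed A F ε ψ))) → ∀ ψ, g ψ = 0 := by
  obtain ⟨s, M, hs, hM, hlin⟩ := hA.exists_uniform_equiv
  obtain ⟨ε₂, hε₂, hbij⟩ := exists_perturbed_bijective A hK hF
  obtain ⟨L, hL, hL1, hL2⟩ := A.exists_incr_bound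
  -- The first bound makes the nonlinear remainder at most a quarter after inversion; the second
  -- keeps the defect below the shortest lattice vector.
  set r : ℝ := min (1 / (4 * (M * L))) (1 / (L + 2)) with hr
  have hr0 : 0 < r := by positivity
  refine ⟨r, min ε₂ (min (s / (B + 1)) (1 / (4 * M * K + K + 1))), hr0, by positivity,
    fun ε hε g hg hcomm => ?_⟩
  have hεb := hε.trans_le (min_le_left _ _)
  have hεs := hε.trans_le ((min_le_right _ _).trans (min_le_left _ _))
  have hεK := hε.trans_le ((min_le_right _ _).trans (min_le_right _ _))
  rw [lt_div_iff₀ (by positivity)] at hεs hεK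
  have hε0 := abs_nonneg ε
  have hMK : 0 ≤ M * K := by positivity
  have hεMK : 0 ≤ |ε| * (M * K) := by positivity
  have hεK' : 0 ≤ |ε| * K := by positivity
  have hεK1 : |ε| * K ≤ 1 := by nlinarith
  have hεK2 : M * (|ε| * K) ≤ 1 / 4 := by nlinarith
  have hr1 : M * (L * r) ≤ 1 / 4 := by
    have : r ≤ 1 / (4 * (M * L)) := min_le_left _ _
    rw [le_div_iff₀ (by positivity)] at this
    linarith
  have hr2 : L * r + 2 * r ≤ 1 := by
    have : r ≤ 1 / (L + 2) := min_le_right _ _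
    rw [le_div_iff₀ (by positivity)] at this
    linarith
  set τ := Equiv.ofBijective _ (hbij ε hεb) with hτ
  have hτa : ∀ ψ, τ ψ = perturbed A F ε ψ := fun ψ => rfl
  obtain ⟨e, he, heM⟩ := hlin τ fun ψ => (dist_perturbed_le A hFB ε ψ).trans (by nlinarith)
  set u : Bdd (Torus d) (E d) := Hol.mk g (isHol_of_bound hg) with hu
  have hug : ∀ ψ, u ψ = g ψ := fun ψ => rfl
  have hFg : ∀ ψ, ‖ε • (F (ψ + proj d (g ψ)) - F ψ)‖ ≤ |ε| * K * ‖g ψ‖ := by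
    intro ψ
    rw [norm_smul, Real.norm_eq_abs, mul_assoc]
    refine mul_le_mul_of_nonneg_left ((hF _ _).trans ?_) hε0
    rw [dist_self_add_left]
    exact mul_le_mul_of_nonneg_left (norm_proj_le _) hK
  -- Commutation gives this identity modulo the lattice. The left side has norm at most one, so it
  -- is zero; no continuity of `g` is needed.
  have heq : ∀ ψ, A.incr ψ (g ψ) + ε • (F (ψ + proj d (g ψ)) - F ψ) - g (τ ψ) = 0 := by
    intro ψ
    apply lattice_small
    · have := hcomm ψ
      rw [hτa, map_sub, map_add, A.proj_incr, smul_sub, map_sub, sub_eq_zero]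
      rw [← sub_eq_iff_eq_add'] at this
      rw [← this, perturbed, perturbed]
      abel
    · have h1 : ‖A.incr ψ (g ψ)‖ ≤ L * r := by
        have := hL1 ψ (g ψ) 0
        rw [A.incr_zero, sub_zero, sub_zero] at this
        exact this.trans (mul_le_mul_of_nonneg_left (hg ψ) hL.le)
      have h2 : ‖ε • (F (ψ + proj d (g ψ)) - F ψ)‖ ≤ r :=
        (hFg ψ).trans ((mul_le_of_le_one_left (norm_nonneg _) hεK1).trans (hg ψ))
      refine (norm_sub_le _ _).trans ((add_le_add (norm_add_le _ _) (hg _)).trans ?_)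
      linarith
  have hbound : ‖e u‖ ≤ (L * r + |ε| * K) * ‖u‖ := by
    refine Bdd.norm_le (by positivity) fun ψ => ?_
    rw [he, hug, hug]
    have h1 := heq ψ
    rw [sub_eq_zero] at h1
    have h2 : A.D ψ (g ψ) - g (τ ψ) =
        -((A.incr ψ (g ψ) - A.D ψ (g ψ)) + ε • (F (ψ + proj d (g ψ)) - F ψ)) := by
      rw [← h1]
      abel
    rw [h2, norm_neg, add_mul]
    have h3 := hL2 ψ r (g ψ) 0 (hg ψ) (by simpa using hr0.le)
    rw [A.incr_zero, map_zero, sub_zero, sub_zero, sub_zero] at h3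
    have h4 : ‖g ψ‖ ≤ ‖u‖ := u.norm_apply_le ψ
    refine (norm_add_le _ _).trans (add_le_add (h3.trans ?_) ((hFg ψ).trans ?_))
    · exact mul_le_mul_of_nonneg_left h4 (by positivity)
    · exact mul_le_mul_of_nonneg_left h4 hεK'
  have hu0 : ‖u‖ ≤ 1 / 2 * ‖u‖ := by
    refine (heM u).trans ((mul_le_mul_of_nonneg_left hbound hM.le).trans ?_)
    rw [← mul_assoc]
    refine mul_le_mul_of_nonneg_right ?_ (norm_nonneg _)
    linarith
  intro ψ
  have h5 : ‖g ψ‖ ≤ ‖u‖ := u.norm_apply_le ψ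
  have h6 := norm_nonneg (g ψ)
  exact norm_eq_zero.1 (by linarith)

/-- A map close to an invertible linear map is locally onto. -/
theorem exists_preimage_of_approx_linear {Y : Type*} [NormedAddCommGroup Y] [NormedSpace ℝ Y]
    [CompleteSpace Y] {f : Y → Y} (hf0 : f 0 = 0) (e : Y ≃L[ℝ] Y) {M c q : ℝ} (hM : 0 < M)
    (hc : 0 ≤ c) (hq : 0 < q) (heM : ∀ k, ‖k‖ ≤ M * ‖e k‖)
    (hf : ∀ k k', ‖k‖ ≤ q → ‖k'‖ ≤ q → ‖(f k - e k) - (f k' - e k')‖ ≤ c * ‖k - k'‖)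
    (hMc : M * c ≤ 1 / 2) {y : Y} (hy : ‖y‖ ≤ q / (2 * M)) : ∃ k, ‖k‖ ≤ q ∧ f k = y := by
  have happ : ApproximatesLinearOn f (e : Y →L[ℝ] Y) (Metric.closedBall 0 q) ⟨c, hc⟩ := by
    intro k hk k' hk'
    rw [mem_closedBall_zero_iff] at hk hk'
    refine le_trans (le_of_eq ?_) (hf k k' hk hk')
    congr 1
    change f k - f k' - e (k - k') = _
    rw [map_sub]
    abel
  set inv : (e : Y →L[ℝ] Y).NonlinearRightInverse :=
    { toFun := e.symm
      nnnorm := ⟨M, hM.le⟩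
      bound' := fun y => by
        have := heM (e.symm y)
        rwa [e.apply_symm_apply] at this
      right_inv' := fun y => e.apply_symm_apply y } with hinv
  have hsurj := happ.surjOn_closedBall_of_nonlinearRightInverse inv hq.le subset_rfl
  obtain ⟨k, hk, hky⟩ := hsurj (show y ∈ Metric.closedBall (f 0) _ by
    rw [hf0, mem_closedBall_zero_iff]
    change ‖y‖ ≤ (M⁻¹ - c) * q
    have : c ≤ M⁻¹ / 2 := by
      rw [inv_eq_one_div, div_div, le_div_iff₀ (by positivity)]
      linarith
    calc ‖y‖ ≤ q / (2 * M) := hy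
      _ = M⁻¹ / 2 * q := by field_simp
      _ ≤ (M⁻¹ - c) * q := mul_le_mul_of_nonneg_right (by linarith) hq.le)
  exact ⟨k, mem_closedBall_zero_iff.1 hk, hky⟩

/-- A small perturbation of an Anosov diffeomorphism is semiconjugate to it by a map near the
identity. -/
theorem IsAnosov.exists_semiconj {A : AnalyticDiffeo d} (hA : IsAnosov A)
    {F : Torus d → E d} {K B : ℝ} (hK : 0 ≤ K) (hF : ∀ ψ φ, ‖F ψ - F φ‖ ≤ K * dist ψ φ)
    (hB : 0 ≤ B) (hFB : ∀ ψ, ‖F ψ‖ ≤ B) {r : ℝ} (hr : 0 < r) :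
    ∃ ε₁ : ℝ, 0 < ε₁ ∧ ∀ ε : ℝ, |ε| < ε₁ → ∃ k : Torus d → E d, (∀ ψ, ‖k ψ‖ ≤ r) ∧
      ∀ ψ, A.toPerm (ψ + proj d (k ψ)) =
        perturbed A F ε ψ + proj d (k (perturbed A F ε ψ)) := by
  obtain ⟨s, M, hs, hM, hlin⟩ := hA.exists_uniform_equiv
  obtain ⟨ε₂, hε₂, hbij⟩ := exists_perturbed_bijective A hK hF
  obtain ⟨L, hL, hL1, hL2⟩ := A.exists_incr_bound
  -- On the ball of radius `q` the remainder has Lipschitz constant `L q ≤ 1 / (2 M)`, so its image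
  -- contains the ball of radius `q / (2 M)`. The bound on `ε` puts `εF` there.
  set q : ℝ := min r (1 / (2 * (M * L))) with hq
  have hq0 : 0 < q := by positivity
  refine ⟨min ε₂ (min (s / (B + 1)) (q / (2 * M * (B + 1)))), by positivity, fun ε hε => ?_⟩
  have hεb := hε.trans_le (min_le_left _ _)
  have hεs := hε.trans_le ((min_le_right _ _).trans (min_le_left _ _))
  have hεB := hε.trans_le ((min_le_right _ _).trans (min_le_right _ _))
  rw [lt_div_iff₀ (by positivity)] at hεs hεB
  have hε0 := abs_nonneg ε
  have hq1 : M * (L * q) ≤ 1 / 2 := by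
    have : q ≤ 1 / (2 * (M * L)) := min_le_right _ _
    rw [le_div_iff₀ (by positivity)] at this
    linarith
  set τ := Equiv.ofBijective _ (hbij ε hεb) with hτ
  have hτa : ∀ ψ, τ ψ = perturbed A F ε ψ := fun ψ => rfl
  obtain ⟨e, he, heM⟩ := hlin τ fun ψ => (dist_perturbed_le A hFB ε ψ).trans (by nlinarith)
  have hincr : ∀ ψ v, ‖A.incr ψ v‖ ≤ L * ‖v‖ := by
    intro ψ v
    have := hL1 ψ v 0
    rwa [A.incr_zero, sub_zero, sub_zero] at this
  have hhol : ∀ k : Bdd (Torus d) (E d), IsHol (fun _ _ : Torus d => (2 : ℝ≥0))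
      (fun ψ => A.incr ψ (k ψ) - k (τ ψ)) := fun k =>
    isHol_of_bound (C := L * ‖k‖ + ‖k‖) fun ψ => (norm_sub_le _ _).trans (add_le_add
      ((hincr _ _).trans (mul_le_mul_of_nonneg_left (k.norm_apply_le _) hL.le))
      (k.norm_apply_le _))
  -- The unknown `k` solves `incr k - k ∘ τ = εF` with `τ = A_ε`. On bounded functions `k ↦ k ∘ τ`
  -- is in general not norm continuous in `ε`, so instead of an implicit function argument in `ε`
  -- the equation is solved for each `ε` separately, with the uniform bound `M`.
  set f : Bdd (Torus d) (E d) → Bdd (Torus d) (E d) := fun k => Hol.mk _ (hhol k) with hf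
  have hfa : ∀ k ψ, f k ψ = A.incr ψ (k ψ) - k (τ ψ) := fun k ψ => rfl
  have hf0 : f 0 = 0 := by
    ext1 ψ
    rw [hfa, Hol.zero_apply, Hol.zero_apply, A.incr_zero, sub_zero]
  have happ : ∀ k k', ‖k‖ ≤ q → ‖k'‖ ≤ q →
      ‖(f k - e k) - (f k' - e k')‖ ≤ L * q * ‖k - k'‖ := by
    intro k k' hk hk'
    refine Bdd.norm_le (by positivity) fun ψ => ?_
    rw [Hol.sub_apply, Hol.sub_apply, Hol.sub_apply, hfa, hfa, he, he, sub_sub_sub_cancel_right,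
      sub_sub_sub_cancel_right]
    refine (hL2 ψ q _ _ ((k.norm_apply_le ψ).trans hk) ((k'.norm_apply_le ψ).trans hk')).trans ?_
    exact mul_le_mul_of_nonneg_left ((k - k').norm_apply_le ψ) (by positivity)
  set y : Bdd (Torus d) (E d) := Hol.mk (fun ψ => ε • F ψ)
    ((isHol_of_bound hFB).smul ε) with hy
  have hyn : ‖y‖ ≤ q / (2 * M) := by
    have h1 : ‖y‖ ≤ |ε| * B := Bdd.norm_le (by positivity) fun ψ => by
      change ‖ε • F ψ‖ ≤ _
      rw [norm_smul, Real.norm_eq_abs]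
      exact mul_le_mul_of_nonneg_left (hFB ψ) hε0
    refine h1.trans ?_
    rw [le_div_iff₀ (by positivity)]
    nlinarith [mul_nonneg hε0 hM.le]
  obtain ⟨k, hk, hky⟩ := exists_preimage_of_approx_linear hf0 e hM (by positivity) hq0 heM happ
    hq1 hyn
  refine ⟨k, fun ψ => (k.norm_apply_le ψ).trans (hk.trans (min_le_left _ _)), fun ψ => ?_⟩
  have h1 : A.incr ψ (k ψ) - k (τ ψ) = ε • F ψ := congrArg (fun v : Bdd (Torus d) (E d) => v ψ) hky
  have h2 := congrArg (proj d) h1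
  rw [map_sub, A.proj_incr, hτa] at h2
  rw [sub_eq_iff_eq_add, sub_eq_iff_eq_add] at h2
  change _ = A.toPerm ψ + proj d (ε • F ψ) + _
  rw [h2]
  abel

/-- A continuous map near the identity that semiconjugates an Anosov diffeomorphism to a small
perturbation is a homeomorphism. -/
theorem IsAnosov.exists_isHomeomorph {A : AnalyticDiffeo d} (hA : IsAnosov A)
    {F : Torus d → E d} {K B : ℝ} (hK : 0 ≤ K) (hF : ∀ ψ φ, ‖F ψ - F φ‖ ≤ K * dist ψ φ)
    (hB : 0 ≤ B) (hFB : ∀ ψ, ‖F ψ‖ ≤ B) :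
    ∃ r ε₁ : ℝ, 0 < r ∧ 0 < ε₁ ∧ ∀ ε : ℝ, |ε| < ε₁ → ∀ h : Torus d → E d, Continuous h →
      (∀ ψ, ‖h ψ‖ ≤ r) →
      (∀ ψ, A.toPerm ψ + proj d (h (A.toPerm ψ)) = perturbed A F ε (ψ + proj d (h ψ))) →
      IsHomeomorph fun ψ => ψ + proj d (h ψ) := by
  obtain ⟨r, ε₁, hr, hε₁, huniq⟩ := hA.exists_commuting_eq_id hK hF hB hFB
  obtain ⟨ε₂, hε₂, hsemi⟩ := hA.exists_semiconj hK hF hB hFB (half_pos hr)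
  refine ⟨r / 2, min ε₁ ε₂, half_pos hr, lt_min hε₁ hε₂, fun ε hε h hc hb hconj => ?_⟩
  obtain ⟨k, hkb, hk⟩ := hsemi ε (hε.trans_le (min_le_right _ _))
  set H : Torus d → Torus d := fun ψ => ψ + proj d (h ψ) with hH
  set J : Torus d → Torus d := fun ψ => ψ + proj d (k ψ) with hJ
  have hp0 : ∀ ψ, perturbed A F 0 ψ = A.toPerm ψ := fun ψ => by simp [perturbed]
  have hHA : ∀ ψ, H (A.toPerm ψ) = perturbed A F ε (H ψ) := hconj
  have hJA : ∀ ψ, A.toPerm (J ψ) = J (perturbed A F ε ψ) := hk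
  have hsum : ∀ v w : E d, ‖v‖ ≤ r / 2 → ‖w‖ ≤ r / 2 → ‖v + w‖ ≤ r := fun v w hv hw =>
    (norm_add_le _ _).trans (by linarith)
  have hJH' : ∀ ψ, ψ + proj d (h ψ + k (H ψ)) = J (H ψ) := fun ψ => by
    rw [map_add, ← add_assoc]
  have hHJ' : ∀ ψ, ψ + proj d (k ψ + h (J ψ)) = H (J ψ) := fun ψ => by
    rw [map_add, ← add_assoc]
  -- `J ∘ H` is near the identity and commutes with `A`, the perturbed map for `ε = 0`.
  have hJH : ∀ ψ, J (H ψ) = ψ := by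
    have := huniq 0 (by simpa using hε₁) (fun ψ => h ψ + k (H ψ))
      (fun ψ => hsum _ _ (hb _) (hkb _)) (fun ψ => by
        rw [hp0, hp0, hJH', hJH', hHA, hJA])
    intro ψ
    rw [← hJH', this, map_zero, add_zero]
  -- `H ∘ J` is near the identity and commutes with `A_ε`.
  have hHJ : ∀ ψ, H (J ψ) = ψ := by
    have := huniq ε (hε.trans_le (min_le_left _ _)) (fun ψ => k ψ + h (J ψ))
      (fun ψ => hsum _ _ (hkb _) (hb _)) (fun ψ => by
        rw [hHJ', hHJ', ← hJA, hHA])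
    intro ψ
    rw [← hHJ', this, map_zero, add_zero]
  rw [isHomeomorph_iff_continuous_bijective]
  refine ⟨continuous_id.add ((continuous_proj d).comp hc), ?_⟩
  exact Function.bijective_iff_has_inverse.2 ⟨J, hJH, hHJ⟩

end Homeomorphism

end AnosovTorus
end

open scoped NNReal ENNReal
noncomputable section
namespace AnosovTorus

/-! ### Growth along the invariant bundles and consequences of the gap condition -/

section Splitting

theorem coc_add {X G : Type*} [NormedAddCommGroup G] [NormedSpace ℝ G] (σ : X → X)
    (a : X → G →L[ℝ] G) (m n : ℕ) (x : X) :
    coc σ a (m + n) x = coc σ a m (σ^[n] x) ∘L coc σ a n x := by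
  induction n generalizing x with
  | zero => rfl
  | succ n ih =>
    rw [← add_assoc, coc, ih, coc, Function.iterate_succ_apply, ContinuousLinearMap.comp_assoc]

theorem cocInv_add {X G : Type*} [NormedAddCommGroup G] [NormedSpace ℝ G] (σ : X → X)
    (a : X → G →L[ℝ] G) (m n : ℕ) (x : X) :
    cocInv σ a (m + n) x = cocInv σ a n x ∘L cocInv σ a m (σ^[n] x) := by
  induction n generalizing x with
  | zero => rfl
  | succ n ih =>
    rw [← add_assoc, cocInv, ih, cocInv, Function.iterate_succ_apply,
      ContinuousLinearMap.comp_assoc]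

namespace InvariantSplitting

variable {d k : ℕ} {A : AnalyticDiffeo d} (S : InvariantSplitting A k)

theorem iSupIndep (ψ : Torus d) : _root_.iSupIndep fun i => S.V i ψ :=
  (S.isInternal ψ).submodule_iSupIndep

theorem iSup_eq_top (ψ : Torus d) : ⨆ i, S.V i ψ = ⊤ := (S.isInternal ψ).submodule_iSup_eq_top

/-- The projector onto `V_i(ψ)` as an endomorphism of the tangent space. -/
def pr (i : Fin k) (ψ : Torus d) : E d →L[ℝ] E d := obl (fun j => S.V j ψ) i

theorem pr_mem (i : Fin k) (ψ : Torus d) (x : E d) : S.pr i ψ x ∈ S.V i ψ :=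
  obl_mem (fun j => S.V j ψ) i x

theorem sum_pr_apply (ψ : Torus d) (x : E d) : ∑ i, S.pr i ψ x = x := sum_obl (S.iSup_eq_top ψ) x

theorem sum_pr (ψ : Torus d) : ∑ i, S.pr i ψ = 1 := by
  ext1 x
  rw [sum_apply, S.sum_pr_apply]
  rfl

theorem pr_apply_self {i : Fin k} {ψ : Torus d} {x : E d} (hx : x ∈ S.V i ψ) : S.pr i ψ x = x :=
  obl_apply_self (S.iSupIndep ψ) (S.iSup_eq_top ψ) hx

theorem pr_apply_of_ne {i j : Fin k} (hij : i ≠ j) {ψ : Torus d} {x : E d} (hx : x ∈ S.V j ψ) :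
    S.pr i ψ x = 0 :=
  obl_apply_of_ne (S.iSupIndep ψ) (S.iSup_eq_top ψ) hij hx

theorem pr_mul_pr (i j : Fin k) (ψ : Torus d) :
    S.pr i ψ * S.pr j ψ = if i = j then S.pr i ψ else 0 := by
  ext1 x
  change S.pr i ψ (S.pr j ψ x) = _
  split_ifs with h
  · subst h
    exact S.pr_apply_self (S.pr_mem i ψ x)
  · exact S.pr_apply_of_ne h (S.pr_mem j ψ x)

/-- This links the projector of the statement, whose codomain varies with `ψ`, to an endomorphism
field that can be treated as a Hölder function. -/
theorem coe_P (i : Fin k) (ψ : Torus d) (x : E d) : (S.P i ψ x : E d) = S.pr i ψ x := by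
  have hsum : x = S.pr i ψ x + ∑ j ∈ Finset.univ.erase i, S.pr j ψ x := by
    rw [Finset.add_sum_erase _ (fun j => S.pr j ψ x) (Finset.mem_univ i), S.sum_pr_apply]
  have hmem : ∑ j ∈ Finset.univ.erase i, S.pr j ψ x ∈ ⨆ j ≠ i, S.V j ψ := by
    refine Submodule.sum_mem _ fun j hj => ?_
    exact Submodule.mem_iSup_of_mem j (Submodule.mem_iSup_of_mem (Finset.ne_of_mem_erase hj)
      (S.pr_mem j ψ x))
  have hP : ∀ y, S.P i ψ y = (S.V i ψ).projectionOnto (⨆ j ≠ i, S.V j ψ) (S.isCompl i ψ) y :=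
    fun y => rfl
  have h1 : S.P i ψ (S.pr i ψ x) = ⟨S.pr i ψ x, S.pr_mem i ψ x⟩ := by
    rw [hP]
    exact Submodule.projectionOnto_apply_left (S.isCompl i ψ) ⟨S.pr i ψ x, S.pr_mem i ψ x⟩
  have h2 : S.P i ψ (∑ j ∈ Finset.univ.erase i, S.pr j ψ x) = 0 := by
    rw [hP]
    exact Submodule.projectionOnto_apply_right (S.isCompl i ψ) ⟨_, hmem⟩
  conv_lhs => rw [hsum]
  rw [map_add, h1, h2, add_zero]

theorem block_eq_zero {i j : Fin k} {ψ φ : Torus d} {M : E d →L[ℝ] E d}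
    (h : S.pr i φ * M * S.pr j ψ = 0) : S.block i j ψ φ M = 0 := by
  ext1 x
  apply Subtype.ext
  change (S.P i φ (M x) : E d) = 0
  rw [S.coe_P]
  have := DFunLike.congr_fun h (x : E d)
  change S.pr i φ (M (S.pr j ψ x)) = 0 at this
  rwa [S.pr_apply_self x.2] at this

theorem D_mem {i : Fin k} {ψ : Torus d} {x : E d} (hx : x ∈ S.V i ψ) :
    A.D ψ x ∈ S.V i (A.toPerm ψ) := by
  rw [← S.invariant i ψ]
  exact Submodule.mem_map_of_mem (f := (A.D ψ : E d →ₗ[ℝ] E d)) hx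

theorem pr_mul_D (i : Fin k) (ψ : Torus d) :
    S.pr i (A.toPerm ψ) * A.D ψ = A.D ψ * S.pr i ψ :=
  obl_comp_of_map_le (S.iSup_eq_top ψ) (S.iSupIndep _) (S.iSup_eq_top _)
    (fun _ _ hx => S.D_mem hx) i

theorem Dinv_mul_D (ψ : Torus d) : A.Dinv ψ * A.D ψ = 1 := A.Dinv_comp_D ψ

theorem D_mul_Dinv (ψ : Torus d) : A.D ψ * A.Dinv ψ = 1 := A.D_comp_Dinv ψ

theorem pr_coc (i : Fin k) (n : ℕ) (ψ : Torus d) :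
    S.pr i (A.toPerm^[n] ψ) ∘L coc A.toPerm A.D n ψ = coc A.toPerm A.D n ψ ∘L S.pr i ψ :=
  coc_equivariant (S.pr_mul_D i) n ψ

theorem pr_cocInv (i : Fin k) (n : ℕ) (ψ : Torus d) :
    S.pr i ψ ∘L cocInv A.toPerm A.Dinv n ψ =
      cocInv A.toPerm A.Dinv n ψ ∘L S.pr i (A.toPerm^[n] ψ) :=
  cocInv_equivariant A.Dinv_comp_D A.D_comp_Dinv (S.pr_mul_D i) n ψ

theorem coc_mem {i : Fin k} {n : ℕ} {ψ : Torus d} {x : E d} (hx : x ∈ S.V i ψ) :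
    coc A.toPerm A.D n ψ x ∈ S.V i (A.toPerm^[n] ψ) := by
  have := DFunLike.congr_fun (S.pr_coc i n ψ) x
  change S.pr i _ (coc A.toPerm A.D n ψ x) = coc A.toPerm A.D n ψ (S.pr i ψ x) at this
  rw [S.pr_apply_self hx] at this
  rw [← this]
  exact S.pr_mem _ _ _

theorem cocInv_mem {i : Fin k} {n : ℕ} {ψ : Torus d} {x : E d}
    (hx : x ∈ S.V i (A.toPerm^[n] ψ)) : cocInv A.toPerm A.Dinv n ψ x ∈ S.V i ψ := by
  have := DFunLike.congr_fun (S.pr_cocInv i n ψ) x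
  change S.pr i _ (cocInv A.toPerm A.Dinv n ψ x) =
    cocInv A.toPerm A.Dinv n ψ (S.pr i _ x) at this
  rw [S.pr_apply_self hx] at this
  rw [← this]
  exact S.pr_mem _ _ _

/-- The growth of the derivative cocycle along `V_i`. -/
def growth (i : Fin k) (n : ℕ) (ψ : Torus d) : ℝ :=
  -- An orthogonal projection has norm at most one, so this is the norm of the restriction to
  -- `V_i(ψ)`, written in a fixed space of operators where continuity in `ψ` is visible.
  ‖coc A.toPerm A.D n ψ ∘L (S.V i ψ).starProjection‖

/-- The growth of the inverse of the derivative cocycle along `V_i`. -/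
def growthInv (i : Fin k) (n : ℕ) (ψ : Torus d) : ℝ :=
  ‖cocInv A.toPerm A.Dinv n ψ ∘L (S.V i (A.toPerm^[n] ψ)).starProjection‖

theorem norm_coc_le {i : Fin k} {n : ℕ} {ψ : Torus d} {x : E d} (hx : x ∈ S.V i ψ) :
    ‖coc A.toPerm A.D n ψ x‖ ≤ S.growth i n ψ * ‖x‖ := by
  have := (coc A.toPerm A.D n ψ ∘L (S.V i ψ).starProjection).le_opNorm x
  rwa [ContinuousLinearMap.comp_apply, Submodule.starProjection_eq_self_iff.2 hx] at this

theorem norm_cocInv_le {i : Fin k} {n : ℕ} {ψ : Torus d} {x : E d}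
    (hx : x ∈ S.V i (A.toPerm^[n] ψ)) :
    ‖cocInv A.toPerm A.Dinv n ψ x‖ ≤ S.growthInv i n ψ * ‖x‖ := by
  have := (cocInv A.toPerm A.Dinv n ψ ∘L (S.V i (A.toPerm^[n] ψ)).starProjection).le_opNorm x
  rwa [ContinuousLinearMap.comp_apply, Submodule.starProjection_eq_self_iff.2 hx] at this

theorem growth_nonneg (i : Fin k) (n : ℕ) (ψ : Torus d) : 0 ≤ S.growth i n ψ := norm_nonneg _

theorem growthInv_nonneg (i : Fin k) (n : ℕ) (ψ : Torus d) : 0 ≤ S.growthInv i n ψ :=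
  norm_nonneg _

theorem growth_le {i : Fin k} {n : ℕ} {ψ : Torus d} {C : ℝ} (hC : 0 ≤ C)
    (h : ∀ x ∈ S.V i ψ, ‖coc A.toPerm A.D n ψ x‖ ≤ C * ‖x‖) : S.growth i n ψ ≤ C := by
  refine ContinuousLinearMap.opNorm_le_bound _ hC fun x => ?_
  refine (h _ (Submodule.starProjection_apply_mem _ x)).trans ?_
  exact mul_le_mul_of_nonneg_left (Submodule.norm_starProjection_apply_le _ x) hC

theorem growthInv_le {i : Fin k} {n : ℕ} {ψ : Torus d} {C : ℝ} (hC : 0 ≤ C)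
    (h : ∀ x ∈ S.V i (A.toPerm^[n] ψ), ‖cocInv A.toPerm A.Dinv n ψ x‖ ≤ C * ‖x‖) :
    S.growthInv i n ψ ≤ C := by
  refine ContinuousLinearMap.opNorm_le_bound _ hC fun x => ?_
  refine (h _ (Submodule.starProjection_apply_mem _ x)).trans ?_
  exact mul_le_mul_of_nonneg_left (Submodule.norm_starProjection_apply_le _ x) hC

theorem growth_add_le (i : Fin k) (m n : ℕ) (ψ : Torus d) :
    S.growth i (m + n) ψ ≤ S.growth i m (A.toPerm^[n] ψ) * S.growth i n ψ := by
  refine S.growth_le (mul_nonneg (S.growth_nonneg _ _ _) (S.growth_nonneg _ _ _)) fun x hx => ?_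
  rw [coc_add, mul_assoc]
  exact (S.norm_coc_le (S.coc_mem hx)).trans
    (mul_le_mul_of_nonneg_left (S.norm_coc_le hx) (S.growth_nonneg _ _ _))

theorem growthInv_add_le (i : Fin k) (m n : ℕ) (ψ : Torus d) :
    S.growthInv i (m + n) ψ ≤ S.growthInv i n ψ * S.growthInv i m (A.toPerm^[n] ψ) := by
  refine S.growthInv_le (mul_nonneg (S.growthInv_nonneg _ _ _) (S.growthInv_nonneg _ _ _))
    fun x hx => ?_
  rw [Function.iterate_add_apply] at hx
  rw [cocInv_add, mul_assoc]
  exact (S.norm_cocInv_le (S.cocInv_mem hx)).trans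
    (mul_le_mul_of_nonneg_left (S.norm_cocInv_le hx) (S.growthInv_nonneg _ _ _))

/-- A nonzero vector of `V_i(ψ)` returns to itself under the cocycle and its inverse; here the
bundles must be nonzero. -/
theorem one_le_growth_mul (i : Fin k) (n : ℕ) (ψ : Torus d) :
    1 ≤ S.growthInv i n ψ * S.growth i n ψ := by
  have hpos : 0 < Module.finrank ℝ (S.V i ψ) := by
    rw [S.finrank_eq]
    exact S.dim_pos i
  obtain ⟨x, hx⟩ := Module.finrank_pos_iff_exists_ne_zero.1 hpos
  have hx0 : 0 < ‖(x : E d)‖ := norm_pos_iff.2 fun h => hx (Subtype.ext h)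
  have h1 := DFunLike.congr_fun (cocInv_comp_coc (σ := A.toPerm) A.Dinv_comp_D n ψ) (x : E d)
  rw [ContinuousLinearMap.comp_apply, ContinuousLinearMap.id_apply] at h1
  have h2 : ‖(x : E d)‖ ≤ S.growthInv i n ψ * (S.growth i n ψ * ‖(x : E d)‖) := by
    conv_lhs => rw [← h1]
    exact (S.norm_cocInv_le (S.coc_mem x.2)).trans
      (mul_le_mul_of_nonneg_left (S.norm_coc_le x.2) (S.growthInv_nonneg _ _ _))
  rw [← mul_assoc] at h2
  exact le_of_mul_le_mul_right (by rwa [one_mul]) hx0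

theorem coe_restrPow (i : Fin k) (n : ℕ) (ψ : Torus d) (x : S.V i ψ) :
    (S.restrPow i n ψ x : E d) = coc A.toPerm A.D n ψ x := by
  induction n generalizing ψ with
  | zero => rfl
  | succ n ih =>
    change (S.restrPow i n (A.toPerm ψ) (S.restr i ψ x) : E d) = _
    rw [ih, coc, ContinuousLinearMap.comp_apply]
    congr 1
    change (S.P i (A.toPerm ψ) (A.D ψ x) : E d) = _
    rw [S.coe_P, S.pr_apply_self (S.D_mem x.2)]

theorem growth_le_norm_restrPow (i : Fin k) (n : ℕ) (ψ : Torus d) :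
    S.growth i n ψ ≤ ‖S.restrPow i n ψ‖ :=
  S.growth_le (ContinuousLinearMap.opNorm_nonneg _) fun x hx => by
    rw [← S.coe_restrPow i n ψ ⟨x, hx⟩]
    exact (S.restrPow i n ψ).le_opNorm ⟨x, hx⟩

/-- `ContinuousLinearMap.inverse` is zero on maps that are not invertible, so the restricted cocycle
is first shown to be an equivalence. -/
theorem growthInv_le_norm_inverse (i : Fin k) (n : ℕ) (ψ : Torus d) :
    S.growthInv i n ψ ≤ ‖(S.restrPow i n ψ).inverse‖ := by
  have hinv := cocInv_comp_coc (σ := A.toPerm) A.Dinv_comp_D n ψ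
  have hinv' := coc_comp_cocInv (σ := A.toPerm) A.D_comp_Dinv n ψ
  have hinj : LinearMap.ker (S.restrPow i n ψ : S.V i ψ →ₗ[ℝ] S.V i (A.toPerm^[n] ψ)) = ⊥ := by
    rw [LinearMap.ker_eq_bot']
    intro x hx
    have h0 : coc A.toPerm A.D n ψ (x : E d) = 0 := by
      rw [← S.coe_restrPow]
      exact congrArg Subtype.val hx
    have h1 := DFunLike.congr_fun hinv (x : E d)
    rw [ContinuousLinearMap.comp_apply, h0, map_zero] at h1
    exact Subtype.ext h1.symm
  have hsurj : LinearMap.range (S.restrPow i n ψ : S.V i ψ →ₗ[ℝ] S.V i (A.toPerm^[n] ψ)) = ⊤ := by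
    rw [LinearMap.range_eq_top]
    intro y
    refine ⟨⟨cocInv A.toPerm A.Dinv n ψ y, S.cocInv_mem y.2⟩, Subtype.ext ?_⟩
    refine (S.coe_restrPow i n ψ _).trans ?_
    exact DFunLike.congr_fun hinv' (y : E d)
  set e := ContinuousLinearEquiv.ofBijective (S.restrPow i n ψ) hinj hsurj with he
  have hee : S.restrPow i n ψ = (e : S.V i ψ →L[ℝ] S.V i (A.toPerm^[n] ψ)) := rfl
  refine S.growthInv_le (ContinuousLinearMap.opNorm_nonneg _) fun x hx => ?_
  rw [hee, ContinuousLinearMap.inverse_equiv]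
  set y := e.symm ⟨x, hx⟩ with hy
  have h1 : coc A.toPerm A.D n ψ (y : E d) = x := by
    rw [← S.coe_restrPow]
    exact congrArg Subtype.val (e.apply_symm_apply ⟨x, hx⟩)
  have h2 : cocInv A.toPerm A.Dinv n ψ x = y := by
    rw [← h1]
    exact DFunLike.congr_fun hinv (y : E d)
  rw [h2]
  exact (e.symm : S.V i (A.toPerm^[n] ψ) →L[ℝ] S.V i ψ).le_opNorm ⟨x, hx⟩

theorem continuous_starProjection (i : Fin k) : Continuous fun ψ => (S.V i ψ).starProjection := by
  obtain ⟨β, hβ, h⟩ := S.holder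
  obtain ⟨C, hC⟩ := h i
  exact hC.continuous hβ

theorem continuous_growth (i : Fin k) (n : ℕ) : Continuous (S.growth i n) := by
  obtain ⟨K, -, hAL, -⟩ := A.exists_lipschitz
  have h1 : Continuous (coc A.toPerm A.D n) :=
    ((A.isHol_D one_pos le_rfl).coc (wt_le_of_lipschitz hAL one_pos) n).continuous one_pos
  exact (h1.clm_comp (S.continuous_starProjection i)).norm

theorem continuous_growthInv (i : Fin k) (n : ℕ) : Continuous (S.growthInv i n) := by
  obtain ⟨K, -, hAL, -⟩ := A.exists_lipschitz
  have h1 : Continuous (cocInv A.toPerm A.Dinv n) :=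
    ((A.isHol_Dinv one_pos le_rfl).cocInv (wt_le_of_lipschitz hAL one_pos) n).continuous one_pos
  exact (h1.clm_comp ((S.continuous_starProjection i).comp (A.continuous_toPerm.iterate n))).norm

-- The product of growths is continuous on the compact torus, so its strict bound at the single time
-- `N₀ + 1` is a bound by some `κ < 1`.
open Filter Topology in
theorem HasGaps.exists_uniform {S : InvariantSplitting A k} (hS : S.HasGaps) :
    ∃ (n : ℕ) (κ : ℝ), 0 ≤ κ ∧ κ < 1 ∧ 0 < n ∧ ∀ (i : ℕ) (hi : i + 1 < k) (ψ : Torus d),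
      S.growth ⟨i, Nat.lt_of_succ_lt hi⟩ n ψ * S.growthInv ⟨i + 1, hi⟩ n ψ ≤ κ := by
  obtain ⟨N₀, h⟩ := hS
  have key : ∀ i : Fin k, ∃ κ : ℝ, κ < 1 ∧ ∀ (hi : (i : ℕ) + 1 < k) (ψ : Torus d),
      S.growth i (N₀ + 1) ψ * S.growthInv ⟨i + 1, hi⟩ (N₀ + 1) ψ ≤ κ := by
    intro i
    by_cases hi : (i : ℕ) + 1 < k
    · have hc : Continuous fun ψ => S.growth i (N₀ + 1) ψ * S.growthInv ⟨i + 1, hi⟩ (N₀ + 1) ψ :=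
        (S.continuous_growth _ _).mul (S.continuous_growthInv _ _)
      obtain ⟨φ, -, hφ⟩ := isCompact_univ.exists_isMaxOn Set.univ_nonempty hc.continuousOn
      refine ⟨_, ?_, fun _ ψ => hφ (Set.mem_univ ψ)⟩
      refine lt_of_le_of_lt ?_ (h (N₀ + 1) (Nat.lt_succ_self _) i hi φ)
      exact mul_le_mul (S.growth_le_norm_restrPow _ _ _) (S.growthInv_le_norm_inverse _ _ _)
        (S.growthInv_nonneg _ _ _) (ContinuousLinearMap.opNorm_nonneg _)
    · exact ⟨0, one_pos, fun hi' => absurd hi' hi⟩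
  choose κ hκ hb using key
  -- A number just below one dominates the finitely many `κ i` and zero; this also covers an empty
  -- index set.
  have h1 : ∀ᶠ x in 𝓝[<] (1 : ℝ), ∀ i, κ i ≤ x :=
    eventually_all.2 fun i => (eventually_gt_nhds (hκ i)).filter_mono nhdsWithin_le_nhds |>.mono
      fun x hx => le_of_lt hx
  have h2 : ∀ᶠ x in 𝓝[<] (1 : ℝ), 0 ≤ x :=
    ((eventually_gt_nhds one_pos).filter_mono nhdsWithin_le_nhds).mono fun x hx => le_of_lt hx
  obtain ⟨x, hx1, hx2, hx3⟩ := (h1.and (h2.and self_mem_nhdsWithin)).exists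
  exact ⟨N₀ + 1, x, hx2, hx3, Nat.succ_pos _, fun i hi ψ =>
    (hb ⟨i, Nat.lt_of_succ_lt hi⟩ hi ψ).trans (hx1 _)⟩

/-- The gap condition between neighbours gives arbitrarily large gaps between any two of the
bundles. -/
theorem HasGaps.exists_growth_mul_le {S : InvariantSplitting A k} (hS : S.HasGaps) {δ : ℝ}
    (hδ : 0 < δ) (N₁ : ℕ) : ∃ N : ℕ, N₁ ≤ N ∧ ∀ (i j : Fin k), i < j → ∀ ψ,
      S.growth i N ψ * S.growthInv j N ψ ≤ δ := by
  obtain ⟨n, κ, hκ0, hκ1, hn, h⟩ := hS.exists_uniform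
  obtain ⟨m₀, hm₀⟩ := exists_pow_lt_of_lt_one hδ hκ1
  set m := max m₀ N₁ with hm
  have hmδ : κ ^ m ≤ δ :=
    (pow_le_pow_of_le_one hκ0 hκ1.le (le_max_left _ _)).trans hm₀.le
  -- Growth is submultiplicative along orbits, so the gap after `n * m` steps is `κ ^ m`.
  have hpow : ∀ (m : ℕ) (i : ℕ) (hi : i + 1 < k) (ψ : Torus d),
      S.growth ⟨i, Nat.lt_of_succ_lt hi⟩ (n * m) ψ * S.growthInv ⟨i + 1, hi⟩ (n * m) ψ ≤ κ ^ m := by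
    intro m i hi
    induction m with
    | zero =>
      intro ψ
      have h1 : S.growth ⟨i, Nat.lt_of_succ_lt hi⟩ 0 ψ ≤ 1 :=
        S.growth_le zero_le_one fun x _ => by simp [coc]
      have h2 : S.growthInv ⟨i + 1, hi⟩ 0 ψ ≤ 1 :=
        S.growthInv_le zero_le_one fun x _ => by simp [cocInv]
      rw [mul_zero, pow_zero]
      exact mul_le_one₀ h1 (S.growthInv_nonneg _ _ _) h2
    | succ m ih =>
      intro ψ
      rw [mul_add, mul_one, add_comm]
      have h1 := S.growth_add_le ⟨i, Nat.lt_of_succ_lt hi⟩ n (n * m) ψ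
      have h2 := S.growthInv_add_le ⟨i + 1, hi⟩ n (n * m) ψ
      refine (mul_le_mul h1 h2 (S.growthInv_nonneg _ _ _)
        (mul_nonneg (S.growth_nonneg _ _ _) (S.growth_nonneg _ _ _))).trans ?_
      have h3 := mul_le_mul (h i hi (A.toPerm^[n * m] ψ)) (ih ψ)
        (mul_nonneg (S.growth_nonneg _ _ _) (S.growthInv_nonneg _ _ _)) hκ0
      refine le_trans (le_of_eq ?_) (h3.trans (le_of_eq (pow_succ' _ _).symm))
      ring
  refine ⟨n * m, (le_max_right _ _).trans (Nat.le_mul_of_pos_left m hn), ?_⟩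
  -- For bundles that are not neighbours, the product for `(i, j)` and `(j, j + 1)` contains the
  -- factor `growthInv j * growth j ≥ 1`, which may be dropped.
  have hchain : ∀ (i j : ℕ) (hj : j < k) (hij : i < j) (ψ : Torus d),
      S.growth ⟨i, hij.trans hj⟩ (n * m) ψ * S.growthInv ⟨j, hj⟩ (n * m) ψ ≤ κ ^ m := by
    intro i j
    induction j with
    | zero => intro _ hij; exact absurd hij (Nat.not_lt_zero _)
    | succ j ih =>
      intro hj hij ψ
      rcases (Nat.lt_succ_iff.1 hij).eq_or_lt with rfl | hlt
      · exact hpow m i hj ψ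
      · have h1 := ih (Nat.lt_of_succ_lt hj) hlt ψ
        have h2 := hpow m j hj ψ
        have h3 := S.one_le_growth_mul ⟨j, Nat.lt_of_succ_lt hj⟩ (n * m) ψ
        have h4 := mul_le_mul h1 h2
          (mul_nonneg (S.growth_nonneg _ _ _) (S.growthInv_nonneg _ _ _)) (pow_nonneg hκ0 m)
        have h5 : κ ^ m * κ ^ m ≤ κ ^ m :=
          mul_le_of_le_one_left (pow_nonneg hκ0 m) (pow_le_one₀ hκ0 hκ1.le)
        have h6 : 0 ≤ S.growth ⟨i, hij.trans hj⟩ (n * m) ψ * S.growthInv ⟨j + 1, hj⟩ (n * m) ψ :=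
          mul_nonneg (S.growth_nonneg _ _ _) (S.growthInv_nonneg _ _ _)
        have h7 := mul_le_mul_of_nonneg_left h3 h6
        refine le_trans ?_ (h4.trans h5)
        rw [mul_one] at h7
        refine h7.trans (le_of_eq ?_)
        ring
  intro i j hij ψ
  exact (hchain i j j.2 hij ψ).trans hmδ

end InvariantSplitting

end Splitting

end AnosovTorus
end

open scoped NNReal ENNReal
noncomputable section
namespace AnosovTorus

/-! ### The dichotomy of the differential acting on matrices by conjugation -/

section SchurMultipliers

variable {d k : ℕ}

theorem norm_cocInv_le {X G : Type*} [NormedAddCommGroup G] [NormedSpace ℝ G] {σ : X → X}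
    {a : X → G →L[ℝ] G} {K : ℝ} (hK : 1 ≤ K) (ha : ∀ x, ‖a x‖ ≤ K) (n : ℕ) (x : X) :
    ‖cocInv σ a n x‖ ≤ K ^ n := by
  induction n generalizing x with
  | zero => simpa [cocInv] using ContinuousLinearMap.norm_id_le
  | succ n ih =>
    rw [pow_succ']
    exact (ContinuousLinearMap.opNorm_comp_le _ _).trans
      (mul_le_mul (ha x) (ih _) (norm_nonneg _) (by positivity))

theorem isHol_of_memHolder {G : Type*} [NormedAddCommGroup G] [NormedSpace ℝ G] {f : Torus d → G} {β : ℝ≥0}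
    (hβ : 0 < β) (hf : MemHolder β f) : IsHol (wt d (min β 1)) f := by
  obtain ⟨C, hC⟩ := hf
  obtain ⟨B, hB, hb⟩ := exists_norm_bound (hC.continuous hβ)
  obtain ⟨D, hD, hd⟩ := exists_dist_bound d
  have hβ' : (0 : ℝ) < β := hβ
  set α : ℝ := min β 1 with hα
  have hα0 : 0 < α := lt_min hβ' one_pos
  have hαβ : α ≤ β := min_le_left _ _
  have hD0 : 0 ≤ D ^ ((β : ℝ) - α) := by positivity
  refine ⟨B + C * D ^ ((β : ℝ) - α), fun ψ => (hb ψ).trans ?_, fun ψ φ => ?_⟩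
  · have : 0 ≤ C * D ^ ((β : ℝ) - α) := by positivity
    linarith
  · rw [coe_wt, ← dist_eq_norm]
    have h1 : dist (f ψ) (f φ) ≤ C * dist ψ φ ^ (β : ℝ) := hC.dist_le ψ φ
    have h2 : dist ψ φ ^ (β : ℝ) ≤ D ^ ((β : ℝ) - α) * dist ψ φ ^ α := by
      have : (β : ℝ) = ((β : ℝ) - α) + α := by ring
      conv_lhs => rw [this]
      rw [Real.rpow_add_of_nonneg dist_nonneg (by linarith) hα0.le]
      exact mul_le_mul_of_nonneg_right
        (Real.rpow_le_rpow dist_nonneg (hd ψ φ) (by linarith)) (by positivity)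
    have h3 : 0 ≤ dist ψ φ ^ α := by positivity
    have h4 := mul_le_mul_of_nonneg_left h2 C.coe_nonneg
    have h5 : 0 ≤ B * dist ψ φ ^ α := by positivity
    linarith

/-- Two-sided multiplication `w ↦ x w y`. -/
def sandwich (R : Type*) [NormedRing R] [NormedAlgebra ℝ R] : R →L[ℝ] R →L[ℝ] R →L[ℝ] R :=
  ContinuousLinearMap.mulLeftRight ℝ R

namespace InvariantSplitting

set_option maxSynthPendingDepth 5

variable {A : AnalyticDiffeo d} (S : InvariantSplitting A k)

theorem exists_isHol_pr : ∃ α : ℝ, 0 < α ∧ α ≤ 1 ∧ ∀ i, IsHol (wt d α) (S.pr i) := by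
  obtain ⟨β, hβ, h⟩ := S.holder
  have hβ' : (0 : ℝ) < β := hβ
  have hα : 0 < min (β : ℝ) 1 := lt_min hβ' one_pos
  refine ⟨min β 1, hα, min_le_right _ _, fun i => ?_⟩
  have h1 : ∀ i, IsHol (wt d (min β 1)) fun ψ => (S.V i ψ).starProjection :=
    fun i => isHol_of_memHolder hβ (h i)
  have h2 : IsHol (wt d (min β 1)) fun ψ => projSum fun i => S.V i ψ :=
    IsHol.sum Finset.univ fun i _ => h1 i
  exact (h1 i).mul (h2.ringInverse hα fun ψ => isUnit_projSum (S.iSup_eq_top ψ))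

theorem Dinv_mul_pr (i : Fin k) (ψ : Torus d) :
    A.Dinv ψ * S.pr i (A.toPerm ψ) = S.pr i ψ * A.Dinv ψ := by
  calc A.Dinv ψ * S.pr i (A.toPerm ψ)
      = A.Dinv ψ * S.pr i (A.toPerm ψ) * (A.D ψ * A.Dinv ψ) := by rw [D_mul_Dinv, mul_one]
    _ = A.Dinv ψ * (S.pr i (A.toPerm ψ) * A.D ψ) * A.Dinv ψ := by simp only [mul_assoc]
    _ = (A.Dinv ψ * A.D ψ) * S.pr i ψ * A.Dinv ψ := by rw [S.pr_mul_D]; simp only [mul_assoc]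
    _ = S.pr i ψ * A.Dinv ψ := by rw [Dinv_mul_D, one_mul]

/-- The Schur multiplier: the blocks of a matrix in the splitting at `ψ` are multiplied by the
numbers `θ i j`. -/
def schur (θ : Fin k → Fin k → ℝ) (ψ : Torus d) : (E d →L[ℝ] E d) →L[ℝ] (E d →L[ℝ] E d) :=
  ∑ i, ∑ j, θ i j • sandwich (E d →L[ℝ] E d) (S.pr i ψ) (S.pr j ψ)

theorem schur_apply (θ : Fin k → Fin k → ℝ) (ψ : Torus d) (w : E d →L[ℝ] E d) :
    S.schur θ ψ w = ∑ i, ∑ j, θ i j • (S.pr i ψ * w * S.pr j ψ) := by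
  simp only [schur, sum_apply]
  rfl

theorem pr_mul_schur_mul_pr (θ : Fin k → Fin k → ℝ) (ψ : Torus d) (w : E d →L[ℝ] E d)
    (a b : Fin k) : S.pr a ψ * S.schur θ ψ w * S.pr b ψ =
      θ a b • (S.pr a ψ * w * S.pr b ψ) := by
  have h : ∀ i j, S.pr a ψ * (S.pr i ψ * w * S.pr j ψ) * S.pr b ψ =
      if a = i then (if j = b then S.pr a ψ * w * S.pr b ψ else 0) else 0 := by
    intro i j
    calc S.pr a ψ * (S.pr i ψ * w * S.pr j ψ) * S.pr b ψ
        = (S.pr a ψ * S.pr i ψ) * w * (S.pr j ψ * S.pr b ψ) := by simp only [mul_assoc]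
      _ = _ := by
        rw [S.pr_mul_pr, S.pr_mul_pr]
        split_ifs with h1 h2
        · rw [h2]
        · rw [mul_zero]
        · rw [zero_mul, zero_mul]
        · rw [zero_mul, zero_mul]
  rw [schur_apply]
  simp only [Finset.mul_sum, Finset.sum_mul, mul_smul_comm, smul_mul_assoc, h]
  simp

theorem schur_schur (θ θ' : Fin k → Fin k → ℝ) (ψ : Torus d) (w : E d →L[ℝ] E d) :
    S.schur θ ψ (S.schur θ' ψ w) = S.schur (fun i j => θ i j * θ' i j) ψ w := by
  rw [S.schur_apply θ, S.schur_apply fun i j => θ i j * θ' i j]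
  simp only [pr_mul_schur_mul_pr, smul_smul]

theorem schur_one (ψ : Torus d) (w : E d →L[ℝ] E d) : S.schur (fun _ _ => 1) ψ w = w := by
  rw [schur_apply]
  simp only [one_smul, ← Finset.mul_sum, ← Finset.sum_mul, S.sum_pr, one_mul, mul_one]

theorem schur_sub (θ θ' : Fin k → Fin k → ℝ) (ψ : Torus d) (w : E d →L[ℝ] E d) :
    S.schur (fun i j => θ i j - θ' i j) ψ w = S.schur θ ψ w - S.schur θ' ψ w := by
  simp only [schur_apply, sub_smul, Finset.sum_sub_distrib]

theorem schur_conj (θ : Fin k → Fin k → ℝ) (ψ : Torus d) (w : E d →L[ℝ] E d) :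
    S.schur θ (A.toPerm ψ) (A.D ψ * w * A.Dinv ψ) = A.D ψ * S.schur θ ψ w * A.Dinv ψ := by
  simp only [schur_apply, Finset.mul_sum, Finset.sum_mul, mul_smul_comm, smul_mul_assoc]
  refine Finset.sum_congr rfl fun i _ => Finset.sum_congr rfl fun j _ => ?_
  congr 1
  calc S.pr i (A.toPerm ψ) * (A.D ψ * w * A.Dinv ψ) * S.pr j (A.toPerm ψ)
      = (S.pr i (A.toPerm ψ) * A.D ψ) * w * (A.Dinv ψ * S.pr j (A.toPerm ψ)) := by
        simp only [mul_assoc]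
    _ = _ := by rw [S.pr_mul_D, S.Dinv_mul_pr]; simp only [mul_assoc]

theorem schur_conj_inv (θ : Fin k → Fin k → ℝ) (ψ : Torus d) (w : E d →L[ℝ] E d) :
    S.schur θ ψ (A.Dinv ψ * w * A.D ψ) = A.Dinv ψ * S.schur θ (A.toPerm ψ) w * A.D ψ := by
  simp only [schur_apply, Finset.mul_sum, Finset.sum_mul, mul_smul_comm, smul_mul_assoc]
  refine Finset.sum_congr rfl fun i _ => Finset.sum_congr rfl fun j _ => ?_
  congr 1
  calc S.pr i ψ * (A.Dinv ψ * w * A.D ψ) * S.pr j ψ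
      = (S.pr i ψ * A.Dinv ψ) * w * (A.D ψ * S.pr j ψ) := by simp only [mul_assoc]
    _ = _ := by rw [← S.pr_mul_D, ← S.Dinv_mul_pr]; simp only [mul_assoc]

theorem schur_conj_cocInv (θ : Fin k → Fin k → ℝ) (n : ℕ) (ψ : Torus d) (w : E d →L[ℝ] E d) :
    S.schur θ ψ (cocInv A.toPerm A.Dinv n ψ * w * coc A.toPerm A.D n ψ) =
      cocInv A.toPerm A.Dinv n ψ * S.schur θ (A.toPerm^[n] ψ) w * coc A.toPerm A.D n ψ := by
  induction n generalizing ψ with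
  | zero => rfl
  | succ n ih =>
    have h1 : ∀ v, cocInv A.toPerm A.Dinv (n + 1) ψ * v * coc A.toPerm A.D (n + 1) ψ =
        A.Dinv ψ * (cocInv A.toPerm A.Dinv n (A.toPerm ψ) * v * coc A.toPerm A.D n (A.toPerm ψ)) *
          A.D ψ := fun v => rfl
    rw [h1, h1, schur_conj_inv, ih, Function.iterate_succ_apply]

/-- There are `k ^ 2` blocks, and in each the factors `L` and `R` meet only one projector, so growth
can be estimated bundle by bundle. -/
theorem norm_mul_schur_mul_le (θ : Fin k → Fin k → ℝ) (ψ : Torus d) (L R w : E d →L[ℝ] E d)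
    {δ : ℝ} (h : ∀ i j, |θ i j| * (‖L * S.pr i ψ‖ * ‖S.pr j ψ * R‖) ≤ δ) :
    ‖L * S.schur θ ψ w * R‖ ≤ k ^ 2 * δ * ‖w‖ := by
  simp only [schur_apply, Finset.mul_sum, Finset.sum_mul, mul_smul_comm, smul_mul_assoc]
  have h1 : ∀ i j, ‖θ i j • (L * (S.pr i ψ * w * S.pr j ψ) * R)‖ ≤ δ * ‖w‖ := by
    intro i j
    have : L * (S.pr i ψ * w * S.pr j ψ) * R = (L * S.pr i ψ) * w * (S.pr j ψ * R) := by
      simp only [mul_assoc]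
    rw [this, norm_smul, Real.norm_eq_abs]
    calc |θ i j| * ‖(L * S.pr i ψ) * w * (S.pr j ψ * R)‖
        ≤ |θ i j| * (‖L * S.pr i ψ‖ * ‖w‖ * ‖S.pr j ψ * R‖) := by
          refine mul_le_mul_of_nonneg_left ?_ (abs_nonneg _)
          exact (norm_mul_le _ _).trans
            (mul_le_mul_of_nonneg_right (norm_mul_le _ _) (norm_nonneg _))
      _ = |θ i j| * (‖L * S.pr i ψ‖ * ‖S.pr j ψ * R‖) * ‖w‖ := by ring
      _ ≤ δ * ‖w‖ := mul_le_mul_of_nonneg_right (h i j) (norm_nonneg _)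
  refine (norm_sum_le _ _).trans ?_
  have h2 : ∀ i : Fin k, ‖∑ j, θ i j • (L * (S.pr i ψ * w * S.pr j ψ) * R)‖ ≤ k * (δ * ‖w‖) := by
    intro i
    refine (norm_sum_le_of_le _ fun j _ => h1 i j).trans (le_of_eq ?_)
    simp
  refine (Finset.sum_le_sum fun i _ => h2 i).trans (le_of_eq ?_)
  simp
  ring

/-- The weights that multiply the diagonal blocks by `c`. -/
def diagWeight (k : ℕ) (c : ℝ) (i j : Fin k) : ℝ := if i = j then c else 1

/-- Conjugation by the differential, followed by multiplication of the diagonal blocks by `c`. -/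
def ad (c : ℝ) (ψ : Torus d) : (E d →L[ℝ] E d) →L[ℝ] (E d →L[ℝ] E d) :=
  -- The gap condition says nothing about the diagonal blocks. They are a free normalization in the
  -- block diagonalization, so the factor `c` may be chosen to contract them.
  sandwich (E d →L[ℝ] E d) (A.D ψ) (A.Dinv ψ) ∘L S.schur (diagWeight k c) ψ

/-- The inverse of `ad`. -/
def adInv (c : ℝ) (ψ : Torus d) : (E d →L[ℝ] E d) →L[ℝ] (E d →L[ℝ] E d) :=
  S.schur (diagWeight k c⁻¹) ψ ∘L sandwich (E d →L[ℝ] E d) (A.Dinv ψ) (A.D ψ)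

theorem ad_apply (c : ℝ) (ψ : Torus d) (w : E d →L[ℝ] E d) :
    S.ad c ψ w = A.D ψ * S.schur (diagWeight k c) ψ w * A.Dinv ψ := rfl

theorem adInv_apply (c : ℝ) (ψ : Torus d) (w : E d →L[ℝ] E d) :
    S.adInv c ψ w = S.schur (diagWeight k c⁻¹) ψ (A.Dinv ψ * w * A.D ψ) := rfl

theorem diagWeight_mul_inv {c : ℝ} (hc : c ≠ 0) (i j : Fin k) :
    diagWeight k c i j * diagWeight k c⁻¹ i j = 1 := by
  unfold diagWeight
  split_ifs
  · exact mul_inv_cancel₀ hc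
  · exact mul_one 1

theorem conj_cancel (ψ : Torus d) (w : E d →L[ℝ] E d) :
    A.Dinv ψ * (A.D ψ * w * A.Dinv ψ) * A.D ψ = w := by
  calc _ = (A.Dinv ψ * A.D ψ) * w * (A.Dinv ψ * A.D ψ) := by simp only [mul_assoc]
    _ = w := by rw [Dinv_mul_D, one_mul, mul_one]

theorem conj_cancel' (ψ : Torus d) (w : E d →L[ℝ] E d) :
    A.D ψ * (A.Dinv ψ * w * A.D ψ) * A.Dinv ψ = w := by
  calc _ = (A.D ψ * A.Dinv ψ) * w * (A.D ψ * A.Dinv ψ) := by simp only [mul_assoc]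
    _ = w := by rw [D_mul_Dinv, one_mul, mul_one]

theorem adInv_comp_ad {c : ℝ} (hc : c ≠ 0) (ψ : Torus d) :
    S.adInv c ψ ∘L S.ad c ψ = ContinuousLinearMap.id ℝ (E d →L[ℝ] E d) := by
  ext1 w
  change S.adInv c ψ (S.ad c ψ w) = w
  rw [ad_apply, adInv_apply, conj_cancel, schur_schur]
  simp only [mul_comm (diagWeight k c⁻¹ _ _), diagWeight_mul_inv hc]
  exact S.schur_one ψ w

theorem ad_comp_adInv {c : ℝ} (hc : c ≠ 0) (ψ : Torus d) :
    S.ad c ψ ∘L S.adInv c ψ = ContinuousLinearMap.id ℝ (E d →L[ℝ] E d) := by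
  ext1 w
  change S.ad c ψ (S.adInv c ψ w) = w
  rw [ad_apply, adInv_apply, schur_schur]
  simp only [diagWeight_mul_inv hc]
  rw [S.schur_one, conj_cancel']

/-- Multipliers with constant weights commute with conjugation by `DA`, because the splitting is
invariant. All weights can therefore be collected in one multiplier. -/
theorem coc_ad_apply (c : ℝ) (n : ℕ) (ψ : Torus d) (w : E d →L[ℝ] E d) :
    coc A.toPerm (S.ad c) n ψ w = coc A.toPerm A.D n ψ *
      S.schur (fun i j => diagWeight k c i j ^ n) ψ w * cocInv A.toPerm A.Dinv n ψ := by
  induction n generalizing ψ w with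
  | zero =>
    simp only [pow_zero]
    rw [S.schur_one]
    rfl
  | succ n ih =>
    change coc A.toPerm (S.ad c) n (A.toPerm ψ) (S.ad c ψ w) = _
    rw [ih, ad_apply, schur_conj, schur_schur]
    simp only [← pow_succ]
    rfl

theorem cocInv_adInv_apply (c : ℝ) (n : ℕ) (ψ : Torus d) (w : E d →L[ℝ] E d) :
    cocInv A.toPerm (S.adInv c) n ψ w = S.schur (fun i j => diagWeight k c⁻¹ i j ^ n) ψ
      (cocInv A.toPerm A.Dinv n ψ * w * coc A.toPerm A.D n ψ) := by
  induction n generalizing ψ w with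
  | zero =>
    simp only [pow_zero]
    rw [S.schur_one]
    rfl
  | succ n ih =>
    change S.adInv c ψ (cocInv A.toPerm (S.adInv c) n (A.toPerm ψ) w) = _
    rw [ih, adInv_apply, ← schur_conj_inv, schur_schur]
    simp only [← pow_succ']
    rfl

/-- The weights of the projection to the blocks on and above the diagonal. -/
def upperWeight (k : ℕ) (i j : Fin k) : ℝ := if i ≤ j then 1 else 0

theorem norm_coc_mul_pr_le {p : ℝ} (hp : ∀ i ψ, ‖S.pr i ψ‖ ≤ p) (i : Fin k) (n : ℕ)
    (ψ : Torus d) : ‖coc A.toPerm A.D n ψ * S.pr i ψ‖ ≤ S.growth i n ψ * p := by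
  have hp0 := (norm_nonneg _).trans (hp i ψ)
  refine ContinuousLinearMap.opNorm_le_bound _ (mul_nonneg (S.growth_nonneg _ _ _) hp0) fun x => ?_
  rw [mul_assoc]
  refine (S.norm_coc_le (S.pr_mem i ψ x)).trans ?_
  exact mul_le_mul_of_nonneg_left (ContinuousLinearMap.le_of_opNorm_le _ (hp i ψ) x)
    (S.growth_nonneg _ _ _)

theorem norm_cocInv_mul_pr_le {p : ℝ} (hp : ∀ i ψ, ‖S.pr i ψ‖ ≤ p) (i : Fin k) (n : ℕ)
    (ψ : Torus d) :
    ‖cocInv A.toPerm A.Dinv n ψ * S.pr i (A.toPerm^[n] ψ)‖ ≤ S.growthInv i n ψ * p := by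
  have hp0 := (norm_nonneg _).trans (hp i ψ)
  refine ContinuousLinearMap.opNorm_le_bound _ (mul_nonneg (S.growthInv_nonneg _ _ _) hp0)
    fun x => ?_
  rw [mul_assoc]
  refine (S.norm_cocInv_le (S.pr_mem i _ x)).trans ?_
  exact mul_le_mul_of_nonneg_left (ContinuousLinearMap.le_of_opNorm_le _ (hp i _) x)
    (S.growthInv_nonneg _ _ _)

/-- The gap condition gives a dichotomy for the action of the differential on matrices, with the
diagonal blocks contracted. -/
theorem HasGaps.exists_hasDichotomy {S : InvariantSplitting A k} (hS : S.HasGaps) :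
    ∃ (c : ℝ) (N : ℕ), 0 < c ∧
      HasDichotomy A.toPerm (S.ad c) (S.adInv c) (S.schur (upperWeight k)) N (1 / 16) := by
  obtain ⟨α, hα, -, hpr⟩ := S.exists_isHol_pr
  have hp : ∃ p : ℝ, 1 ≤ p ∧ ∀ i ψ, ‖S.pr i ψ‖ ≤ p := by
    choose C hC h using fun i => exists_norm_bound ((hpr i).continuous hα)
    refine ⟨1 + ∑ i, C i, ?_, fun i ψ => (h i ψ).trans ?_⟩
    · have : 0 ≤ ∑ i, C i := Finset.sum_nonneg fun i _ => zero_le_one.trans (hC i)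
      linarith
    · have := Finset.single_le_sum (f := C) (fun i _ => zero_le_one.trans (hC i))
        (Finset.mem_univ i)
      linarith
  obtain ⟨p, hp1, hp⟩ := hp
  obtain ⟨K₁, hK₁, hD⟩ := exists_norm_bound ((A.isHol_D one_pos le_rfl).continuous one_pos)
  obtain ⟨K₂, hK₂, hD'⟩ := exists_norm_bound ((A.isHol_Dinv one_pos le_rfl).continuous one_pos)
  have hp0 : 0 < p := by positivity
  -- Chosen so that `k ^ 2` blocks, each carrying two projectors of norm at most `p`, add up to at
  -- most `1 / 16`.
  set δ : ℝ := 1 / (16 * (k ^ 2 + 1) * p ^ 2) with hδ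
  have hδ0 : 0 < δ := by positivity
  obtain ⟨N₁, hN₁⟩ := exists_pow_lt_of_lt_one hδ0 (show (1 / 2 : ℝ) < 1 by norm_num)
  obtain ⟨N, hN, hgap⟩ := hS.exists_growth_mul_le hδ0 N₁
  -- In `N` steps conjugation grows by at most `(K₁ K₂) ^ N`, so the diagonal blocks decay at least
  -- like `(1 / 2) ^ N`.
  set c : ℝ := 1 / (2 * (K₁ * K₂)) with hc
  have hc0 : 0 < c := by positivity
  have hdiag : ∀ i ψ, c ^ N * (S.growth i N ψ * S.growthInv i N ψ) ≤ δ := by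
    intro i ψ
    have h1 : S.growth i N ψ ≤ K₁ ^ N := S.growth_le (by positivity) fun x _ =>
      ContinuousLinearMap.le_of_opNorm_le _ (AnosovTorus.norm_coc_le hK₁ hD N ψ) x
    have h2 : S.growthInv i N ψ ≤ K₂ ^ N := S.growthInv_le (by positivity) fun x _ =>
      ContinuousLinearMap.le_of_opNorm_le _ (AnosovTorus.norm_cocInv_le hK₂ hD' N ψ) x
    calc c ^ N * (S.growth i N ψ * S.growthInv i N ψ) ≤ c ^ N * (K₁ ^ N * K₂ ^ N) :=
          mul_le_mul_of_nonneg_left (mul_le_mul h1 h2 (S.growthInv_nonneg _ _ _) (by positivity))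
            (by positivity)
      _ = (1 / 2) ^ N := by
          rw [← mul_pow, ← mul_pow, hc]
          congr 1
          field_simp
      _ ≤ (1 / 2) ^ N₁ := pow_le_pow_of_le_one (by norm_num) (by norm_num) hN
      _ ≤ δ := hN₁.le
  have hfin : ∀ w : E d →L[ℝ] E d, k ^ 2 * (δ * p ^ 2) * ‖w‖ ≤ 1 / 16 * ‖w‖ := by
    intro w
    refine mul_le_mul_of_nonneg_right ?_ (norm_nonneg _)
    have : δ * p ^ 2 = 1 / (16 * (k ^ 2 + 1)) := by
      rw [hδ]
      field_simp
    rw [this, mul_one_div, div_le_div_iff₀ (by positivity) (by norm_num)]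
    nlinarith
  have hmul : ∀ (t : ℝ) (i j : Fin k) (ψ : Torus d), 0 ≤ t →
      t * (S.growth i N ψ * S.growthInv j N ψ) ≤ δ →
      t * ((S.growth i N ψ * p) * (S.growthInv j N ψ * p)) ≤ δ * p ^ 2 := by
    intro t i j ψ _ h
    calc _ = t * (S.growth i N ψ * S.growthInv j N ψ) * p ^ 2 := by ring
      _ ≤ _ := mul_le_mul_of_nonneg_right h (by positivity)
  refine ⟨c, N, hc0, HasDichotomy.of_equivariant (S.adInv_comp_ad hc0.ne')
    (S.ad_comp_adInv hc0.ne') (fun ψ => ?_) (fun ψ => ?_) (fun ψ => ?_)⟩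
  · ext1 w
    change S.schur (upperWeight k) (A.toPerm ψ) (S.ad c ψ w) =
      S.ad c ψ (S.schur (upperWeight k) ψ w)
    rw [ad_apply, ad_apply, schur_conj, schur_schur, schur_schur]
    simp only [mul_comm]
  · refine ContinuousLinearMap.opNorm_le_bound _ (by norm_num) fun w => ?_
    change ‖coc A.toPerm (S.ad c) N ψ (S.schur (upperWeight k) ψ w)‖ ≤ _
    rw [coc_ad_apply, schur_schur]
    refine (S.norm_mul_schur_mul_le _ ψ _ _ w fun i j => ?_).trans (hfin w)
    have e1 := S.norm_coc_mul_pr_le hp i N ψ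
    have e2 : ‖S.pr j ψ * cocInv A.toPerm A.Dinv N ψ‖ ≤ S.growthInv j N ψ * p := by
      have := S.pr_cocInv j N ψ
      change S.pr j ψ * cocInv A.toPerm A.Dinv N ψ = cocInv A.toPerm A.Dinv N ψ * _ at this
      rw [this]
      exact S.norm_cocInv_mul_pr_le hp j N ψ
    have e3 := mul_le_mul e1 e2 (norm_nonneg _) (mul_nonneg (S.growth_nonneg i N ψ) hp0.le)
    refine (mul_le_mul_of_nonneg_left e3 (abs_nonneg _)).trans (hmul _ i j ψ (abs_nonneg _) ?_)
    -- The block `V_j → V_i` is multiplied by at most `growth i * growthInv j`: the gap handles `i <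
    -- j`, the factor `c ^ N` handles `i = j`, and the projector removes `i > j`.
    rcases lt_trichotomy i j with h | h | h
    · rw [diagWeight, if_neg h.ne, upperWeight, if_pos h.le, one_pow, mul_one, abs_one, one_mul]
      exact hgap i j h ψ
    · subst h
      rw [diagWeight, if_pos rfl, upperWeight, if_pos le_rfl, mul_one,
        abs_of_pos (pow_pos hc0 N)]
      exact hdiag i ψ
    · rw [upperWeight, if_neg (not_le.2 h), mul_zero, abs_zero, zero_mul]
      exact hδ0.le
  · refine ContinuousLinearMap.opNorm_le_bound _ (by norm_num) fun w => ?_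
    change ‖cocInv A.toPerm (S.adInv c) N ψ (w - S.schur (upperWeight k) (A.toPerm^[N] ψ) w)‖ ≤ _
    have hw : w - S.schur (upperWeight k) (A.toPerm^[N] ψ) w =
        S.schur (fun i j => 1 - upperWeight k i j) (A.toPerm^[N] ψ) w := by
      rw [schur_sub, schur_one]
    rw [hw, cocInv_adInv_apply, schur_conj_cocInv, schur_schur]
    refine (S.norm_mul_schur_mul_le _ _ _ _ w fun i j => ?_).trans (hfin w)
    have e1 := S.norm_cocInv_mul_pr_le hp i N ψ
    have e2 : ‖S.pr j (A.toPerm^[N] ψ) * coc A.toPerm A.D N ψ‖ ≤ S.growth j N ψ * p := by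
      have := S.pr_coc j N ψ
      change S.pr j _ * coc A.toPerm A.D N ψ = coc A.toPerm A.D N ψ * _ at this
      rw [this]
      exact S.norm_coc_mul_pr_le hp j N ψ
    have e3 := mul_le_mul e1 e2 (norm_nonneg _) (mul_nonneg (S.growthInv_nonneg i N ψ) hp0.le)
    rw [mul_comm (S.growthInv i N ψ * p)] at e3
    refine (mul_le_mul_of_nonneg_left e3 (abs_nonneg _)).trans (hmul _ j i ψ (abs_nonneg _) ?_)
    -- The complementary projector keeps only `i > j`, where the inverse conjugation is contracted
    -- by the gap with the indices exchanged.
    by_cases h : i ≤ j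
    · rw [upperWeight, if_pos h, sub_self, mul_zero, abs_zero, zero_mul]
      exact hδ0.le
    · have h' := not_le.1 h
      rw [diagWeight, if_neg h'.ne', upperWeight, if_neg h, sub_zero, one_pow, mul_one, abs_one,
        one_mul]
      exact hgap j i h' ψ

theorem isHol_schur {α : ℝ} (h : ∀ i, IsHol (wt d α) (S.pr i)) (θ : Fin k → Fin k → ℝ) :
    IsHol (wt d α) (S.schur θ) :=
  IsHol.sum _ fun i _ => IsHol.sum _ fun j _ => ((h i).bilin (sandwich (E d →L[ℝ] E d)) (h j)).smul _

theorem isHol_ad {α : ℝ} (hα : 0 < α) (hα1 : α ≤ 1) (h : ∀ i, IsHol (wt d α) (S.pr i)) (c : ℝ) :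
    IsHol (wt d α) (S.ad c) :=
  ((A.isHol_D hα hα1).bilin (sandwich (E d →L[ℝ] E d)) (A.isHol_Dinv hα hα1)).mul (S.isHol_schur h _)

theorem isHol_adInv {α : ℝ} (hα : 0 < α) (hα1 : α ≤ 1) (h : ∀ i, IsHol (wt d α) (S.pr i))
    (c : ℝ) : IsHol (wt d α) (S.adInv c) :=
  (S.isHol_schur h _).mul ((A.isHol_Dinv hα hα1).bilin (sandwich (E d →L[ℝ] E d)) (A.isHol_D hα hα1))

end InvariantSplitting

end SchurMultipliers

end AnosovTorus
end

open scoped NNReal ENNReal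
noncomputable section
namespace AnosovTorus

/-! ### Block diagonalization by the implicit function theorem -/

section BlockDiagonalization

variable {d k : ℕ}

namespace Hol

variable {X G : Type*} {ω : X → X → ℝ≥0} [NormedAddCommGroup G] [NormedSpace ℝ G]

instance : NormedAddCommGroup (Hol ω G) := inferInstance

instance : NormedSpace ℝ (Hol ω G) := inferInstance

instance : SeminormedAddCommGroup (Hol ω G) := inferInstance

instance : AddCommGroup (Hol ω G) := inferInstance

instance : AddCommMonoid (Hol ω G) := inferInstance

instance : Module ℝ (Hol ω G) := inferInstance

instance : TopologicalSpace (Hol ω G) := inferInstance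

instance : IsTopologicalAddGroup (Hol ω G) := inferInstance

instance : ContinuousConstSMul ℝ (Hol ω G) := inferInstance

end Hol

theorem analyticAt_clm {Y Z : Type*} [NormedAddCommGroup Y] [NormedSpace ℝ Y]
    [NormedAddCommGroup Z] [NormedSpace ℝ Z] (L : Y →L[ℝ] Y) {f : Z → Y} {z : Z}
    (hf : AnalyticAt ℝ f z) : AnalyticAt ℝ (fun x => L (f x)) z :=
  (L.analyticAt _).comp hf

theorem analyticAt_bilin {Y Z : Type*} [NormedAddCommGroup Y] [NormedSpace ℝ Y]
    [NormedAddCommGroup Z] [NormedSpace ℝ Z] (m : Y →L[ℝ] Y →L[ℝ] Y) {f g : Z → Y} {z : Z}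
    (hf : AnalyticAt ℝ f z) (hg : AnalyticAt ℝ g z) : AnalyticAt ℝ (fun x => m (f x) (g x)) z :=
  (m.analyticAt_bilinear _).comp₂ hf hg

-- The abstract form of the block equation, with `u = 1`, `t = DA⁻¹`, `Q` the off-diagonal part,
-- `P₁` and `P₃` the off-diagonal and diagonal parts at `Aψ`, `P₂ v = od v ∘ A`, and `R` the
-- normalization. By `he` the equation at `ε = 0` is linear, so its derivative there is `e`.
open Filter Topology in
theorem exists_analytic_curve_bilinear {Y : Type*} [NormedAddCommGroup Y] [NormedSpace ℝ Y]
    [CompleteSpace Y] (m : Y →L[ℝ] Y →L[ℝ] Y) (u t : Y) (P₁ P₂ P₃ Q R : Y →L[ℝ] Y) {B : ℝ → Y}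
    (hB : AnalyticAt ℝ B 0) (e : Y ≃L[ℝ] Y)
    (he : ∀ v, P₁ (m (m (B 0) (u + Q v)) t) - m (P₂ v) (P₃ (m (m (B 0) (u + Q v)) t)) + R v =
      e v) :
    ∃ v w : ℝ → Y, AnalyticAt ℝ v 0 ∧ AnalyticAt ℝ w 0 ∧ v 0 = 0 ∧
      (∀ ε, w ε = m (m (B ε) (u + Q (v ε))) t) ∧
      (∀ᶠ ε in 𝓝 (0 : ℝ), P₁ (w ε) - m (P₂ (v ε)) (P₃ (w ε)) + R (v ε) = 0) ∧
      (∀ᶠ ε in 𝓝 (0 : ℝ), ‖Q (v ε)‖ < 1) ∧ ∀ᶠ ε in 𝓝 (0 : ℝ), ‖P₃ (w 0) - P₃ (w ε)‖ < 1 := by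
  set W : ℝ × Y → Y := fun q => m (m (B q.1) (u + Q q.2)) t with hW
  have hfst : AnalyticAt ℝ (fun q : ℝ × Y => B q.1) 0 :=
    AnalyticAt.comp (g := B) (by exact hB) analyticAt_fst
  have hsnd : AnalyticAt ℝ (fun q : ℝ × Y => q.2) 0 := analyticAt_snd
  have hWa : AnalyticAt ℝ W 0 :=
    analyticAt_bilin m (analyticAt_bilin m hfst (analyticAt_const.add (analyticAt_clm Q hsnd))) analyticAt_const
  set Φ : ℝ × Y → Y := fun q => P₁ (W q) - m (P₂ q.2) (P₃ (W q)) + R q.2 with hΦ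
  have hΦa : AnalyticAt ℝ Φ 0 :=
    ((analyticAt_clm P₁ hWa).sub (analyticAt_bilin m (analyticAt_clm P₂ hsnd) (analyticAt_clm P₃ hWa))).add (analyticAt_clm R hsnd)
  have hΦe : ∀ v, Φ (0, v) = e v := he
  have hΦ0 : Φ 0 = 0 := (hΦe 0).trans (map_zero e)
  have hder : HasFDerivAt (fun y => Φ (0, y)) (e : Y →L[ℝ] Y) 0 := by
    rw [funext hΦe]
    exact e.hasFDerivAt
  obtain ⟨v, hva, hv0, hv⟩ := exists_analytic_curve hΦa hΦ0 e hder
  have hwa : AnalyticAt ℝ (fun ε => m (m (B ε) (u + Q (v ε))) t) 0 :=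
    analyticAt_bilin m (analyticAt_bilin m hB (analyticAt_const.add (analyticAt_clm Q hva)))
      analyticAt_const
  refine ⟨v, fun ε => m (m (B ε) (u + Q (v ε))) t, hva, hwa, hv0, fun _ => rfl, hv, ?_, ?_⟩
  · have : Tendsto (fun ε => ‖Q (v ε)‖) (𝓝 0) (𝓝 ‖Q (v 0)‖) :=
      (analyticAt_clm Q hva).continuousAt.norm
    rw [hv0, map_zero, norm_zero] at this
    exact this.eventually (gt_mem_nhds one_pos)
  · have h1 := (continuousAt_const (y := P₃ (m (m (B 0) (u + Q (v 0))) t))).sub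
      (analyticAt_clm P₃ hwa).continuousAt
    have h2 : Tendsto (fun ε => ‖P₃ (m (m (B 0) (u + Q (v 0))) t) -
        P₃ (m (m (B ε) (u + Q (v ε))) t)‖) (𝓝 0) (𝓝 ‖P₃ (m (m (B 0) (u + Q (v 0))) t) -
        P₃ (m (m (B 0) (u + Q (v 0))) t)‖) := h1.norm
    rw [sub_self, norm_zero] at h2
    exact h2.eventually (gt_mem_nhds one_pos)

namespace InvariantSplitting

set_option maxSynthPendingDepth 5

variable {A : AnalyticDiffeo d} (S : InvariantSplitting A k)

/-- The diagonal part of a matrix in the splitting at `ψ`. -/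
def dg (ψ : Torus d) : (E d →L[ℝ] E d) →L[ℝ] (E d →L[ℝ] E d) :=
  S.schur (fun i j => if i = j then 1 else 0) ψ

/-- The off-diagonal part of a matrix in the splitting at `ψ`. -/
def od (ψ : Torus d) : (E d →L[ℝ] E d) →L[ℝ] (E d →L[ℝ] E d) := S.schur (diagWeight k 0) ψ

theorem schur_diagWeight (c : ℝ) (ψ : Torus d) (w : E d →L[ℝ] E d) :
    S.schur (diagWeight k c) ψ w = S.od ψ w + c • S.dg ψ w := by
  simp only [od, dg, schur_apply, Finset.smul_sum, ← Finset.sum_add_distrib, smul_smul, ← add_smul]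
  refine Finset.sum_congr rfl fun i _ => Finset.sum_congr rfl fun j _ => ?_
  congr 1
  unfold diagWeight
  split_ifs <;> simp

theorem od_add_dg (ψ : Torus d) (w : E d →L[ℝ] E d) : S.od ψ w + S.dg ψ w = w := by
  have h1 := S.schur_diagWeight 1 ψ w
  have h2 : diagWeight k 1 = fun _ _ => 1 := by
    funext i j
    simp [diagWeight]
  rw [h2, schur_one, one_smul] at h1
  exact h1.symm

theorem dg_one (ψ : Torus d) : S.dg ψ 1 = 1 := by
  rw [dg, schur_apply]
  have : ∀ i j, (if i = j then (1 : ℝ) else 0) • (S.pr i ψ * 1 * S.pr j ψ) =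
      if i = j then S.pr i ψ else 0 := by
    intro i j
    rw [mul_one, S.pr_mul_pr]
    split_ifs <;> simp
  simp only [this]
  simp [S.sum_pr]

theorem od_one (ψ : Torus d) : S.od ψ 1 = 0 := by
  have := S.od_add_dg ψ 1
  rw [dg_one] at this
  exact left_eq_add.1 (by rw [add_comm]; exact this.symm)

theorem od_od (ψ : Torus d) (w : E d →L[ℝ] E d) : S.od ψ (S.od ψ w) = S.od ψ w := by
  rw [od, schur_schur]
  congr 2
  funext i j
  unfold diagWeight
  split_ifs <;> simp

theorem od_dg (ψ : Torus d) (w : E d →L[ℝ] E d) : S.od ψ (S.dg ψ w) = 0 := by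
  have h1 := S.od_add_dg ψ w
  have h2 := congrArg (S.od ψ) h1
  rw [map_add, od_od] at h2
  exact left_eq_add.1 h2.symm

theorem dg_od (ψ : Torus d) (w : E d →L[ℝ] E d) : S.dg ψ (S.od ψ w) = 0 := by
  have h1 := S.od_add_dg ψ (S.od ψ w)
  rw [od_od] at h1
  exact left_eq_add.1 h1.symm

theorem dg_mul_pr (ψ : Torus d) (w : E d →L[ℝ] E d) (b : Fin k) :
    S.dg ψ w * S.pr b ψ = S.pr b ψ * w * S.pr b ψ := by
  calc S.dg ψ w * S.pr b ψ = (∑ a, S.pr a ψ) * S.dg ψ w * S.pr b ψ := by rw [S.sum_pr, one_mul]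
    _ = ∑ a, (if a = b then (1 : ℝ) else 0) • (S.pr a ψ * w * S.pr b ψ) := by
        rw [Finset.sum_mul, Finset.sum_mul]
        exact Finset.sum_congr rfl fun a _ => S.pr_mul_schur_mul_pr _ ψ w a b
    _ = _ := by simp

theorem pr_mul_dg_mul_pr {i j : Fin k} (hij : i ≠ j) (ψ : Torus d) (w : E d →L[ℝ] E d) :
    S.pr i ψ * S.dg ψ w * S.pr j ψ = 0 := by
  rw [dg, pr_mul_schur_mul_pr, if_neg hij, zero_smul]

theorem dg_od_mul_dg (ψ : Torus d) (v w : E d →L[ℝ] E d) :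
    S.dg ψ (S.od ψ v * S.dg ψ w) = 0 := by
  rw [dg, schur_apply]
  refine Finset.sum_eq_zero fun i _ => Finset.sum_eq_zero fun j _ => ?_
  split_ifs with h
  · subst h
    have h1 : S.pr i ψ * S.od ψ v * S.pr i ψ = 0 := by
      rw [od, pr_mul_schur_mul_pr, diagWeight, if_pos rfl, zero_smul]
    have h2 := S.dg_mul_pr ψ w i
    rw [dg] at h2
    rw [mul_assoc, mul_assoc, h2, ← mul_assoc, ← mul_assoc, ← mul_assoc, h1, zero_mul, zero_mul,
      smul_zero]
  · rw [zero_smul]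

theorem od_od_mul_dg (ψ : Torus d) (v w : E d →L[ℝ] E d) :
    S.od ψ (S.od ψ v * S.dg ψ w) = S.od ψ v * S.dg ψ w := by
  have := S.od_add_dg ψ (S.od ψ v * S.dg ψ w)
  rwa [dg_od_mul_dg, add_zero] at this

/-- The off-diagonal part of the equation loses the normalizing term `dg z`, and `od v * dg w` is
already off-diagonal. What remains is `od w = od v * dg w`. -/
theorem eq_mul_dg_of_equation {φ : Torus d} {v w z : E d →L[ℝ] E d}
    (h : S.od φ w - S.od φ v * S.dg φ w + S.dg φ z = 0) : w = (1 + S.od φ v) * S.dg φ w := by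
  have h1 := congrArg (S.od φ) h
  rw [map_add, map_sub, od_od, od_od_mul_dg, od_dg, add_zero, map_zero, sub_eq_zero] at h1
  rw [add_mul, one_mul, ← h1, add_comm]
  exact (S.od_add_dg φ w).symm

/-- At `ε = 0` one has `w = 1 + od (DA v DA⁻¹)`, so `dg w = 1` and the quadratic term becomes
linear. The off-diagonal equation and the normalization then combine to `ad c v - v ∘ A`. -/
theorem linear_part (c : ℝ) (ψ : Torus d) (v v' : E d →L[ℝ] E d) :
    S.od (A.toPerm ψ) (A.D ψ * (1 + S.od ψ v) * A.Dinv ψ) -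
      S.od (A.toPerm ψ) v' * S.dg (A.toPerm ψ) (A.D ψ * (1 + S.od ψ v) * A.Dinv ψ) +
      S.dg (A.toPerm ψ) (c • (A.D ψ * v * A.Dinv ψ) - v') = S.ad c ψ v - v' := by
  have h1 : A.D ψ * (1 + S.od ψ v) * A.Dinv ψ =
      1 + S.od (A.toPerm ψ) (A.D ψ * v * A.Dinv ψ) := by
    rw [mul_add, add_mul, mul_one, D_mul_Dinv, od, od, schur_conj]
  rw [h1, map_add, map_add, od_one, dg_one, od_od, dg_od, zero_add, add_zero, mul_one, map_sub,
    map_smul, ad_apply, ← schur_conj, schur_diagWeight]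
  conv_rhs => rw [← S.od_add_dg (A.toPerm ψ) v']
  abel

/-- Conjugation by the differential. -/
def conjD (A : AnalyticDiffeo d) (ψ : Torus d) : (E d →L[ℝ] E d) →L[ℝ] (E d →L[ℝ] E d) :=
  sandwich (E d →L[ℝ] E d) (A.D ψ) (A.Dinv ψ)

theorem isHol_conjD (A : AnalyticDiffeo d) {α : ℝ} (hα : 0 < α) (hα1 : α ≤ 1) :
    IsHol (wt d α) (conjD A) :=
  (A.isHol_D hα hα1).bilin (sandwich (E d →L[ℝ] E d)) (A.isHol_Dinv hα hα1)

end InvariantSplitting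

namespace InvariantSplitting

variable {A : AnalyticDiffeo d}

set_option maxHeartbeats 1000000 in
open Filter Topology in
/-- Block diagonalization of an analytic curve of cocycles through the differential of `A`. -/
theorem HasGaps.exists_block_curves {S : InvariantSplitting A k} (hS : S.HasGaps) :
    ∃ β₁ : ℝ, 0 < β₁ ∧ β₁ ≤ 1 ∧ ∀ β : ℝ, 0 < β → β ≤ β₁ →
      ∀ B : ℝ → Hol (wt d β) (E d →L[ℝ] E d), AnalyticAt ℝ B 0 → (∀ ψ, B 0 ψ = A.D ψ) →
      ∃ 𝓥 𝓛 : ℝ → Hol (wt d β) (E d →L[ℝ] E d), AnalyticAt ℝ 𝓥 0 ∧ AnalyticAt ℝ 𝓛 0 ∧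
        (∀ ψ, 𝓥 0 ψ = 1) ∧ ∀ᶠ ε in 𝓝 (0 : ℝ), ∀ ψ,
          IsUnit (𝓥 ε ψ) ∧ IsUnit (𝓛 ε ψ) ∧
          (∀ i j, i ≠ j → S.pr i (A.toPerm ψ) * 𝓛 ε ψ * S.pr j ψ = 0) ∧
          B ε ψ * 𝓥 ε ψ = 𝓥 ε (A.toPerm ψ) * 𝓛 ε ψ := by
  obtain ⟨α, hα, hα1, hpr⟩ := S.exists_isHol_pr
  obtain ⟨c, N, hc, hdich⟩ := hS.exists_hasDichotomy
  obtain ⟨β₁, hβ₁, hβ₁α, he⟩ := exists_equiv_of_hasDichotomy A hα hα1 (S.isHol_ad hα hα1 hpr c)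
    (S.isHol_adInv hα hα1 hpr c) ((S.isHol_schur hpr _).continuous hα)
    (S.adInv_comp_ad hc.ne') (S.ad_comp_adInv hc.ne') hdich
  refine ⟨β₁, hβ₁, hβ₁α.trans hα1, fun β hβ hβ' B hB hB0 => ?_⟩
  have hβα := hβ'.trans hβ₁α
  have hβ1 := hβα.trans hα1
  obtain ⟨e, hea⟩ := he β hβ hβ'
  obtain ⟨K, -, hAL, -⟩ := A.exists_lipschitz
  have hwt := fun ψ φ => wt_le_of_lipschitz hAL hβ ψ φ
  have hod : IsHol (wt d β) S.od := S.isHol_schur (fun i => (hpr i).of_le hβ hβα hα1) _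
  have hdg : IsHol (wt d β) S.dg := S.isHol_schur (fun i => (hpr i).of_le hβ hβα hα1) _
  obtain ⟨m, hma⟩ : ∃ m : Hol (wt d β) (E d →L[ℝ] E d) →L[ℝ] Hol (wt d β) (E d →L[ℝ] E d) →L[ℝ] Hol (wt d β) (E d →L[ℝ] E d), ∀ f g ψ, m f g ψ = f ψ * g ψ :=
    ⟨Hol.bilin (wt d β) (ContinuousLinearMap.compL ℝ (E d) (E d) (E d)), fun _ _ _ => rfl⟩
  obtain ⟨C, hCa⟩ : ∃ C : Hol (wt d β) (E d →L[ℝ] E d) →L[ℝ] Hol (wt d β) (E d →L[ℝ] E d), ∀ f ψ, C f ψ = f (A.toPerm ψ) :=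
    ⟨Hol.compCLM (E d →L[ℝ] E d) A.toPerm (K ^ β) hwt, fun _ _ => rfl⟩
  obtain ⟨OD, hODa⟩ : ∃ L : Hol (wt d β) (E d →L[ℝ] E d) →L[ℝ] Hol (wt d β) (E d →L[ℝ] E d), ∀ f ψ, L f ψ = S.od ψ (f ψ) :=
    ⟨Hol.mulCLM S.od hod, fun _ _ => rfl⟩
  obtain ⟨ODA, hODAa⟩ : ∃ L : Hol (wt d β) (E d →L[ℝ] E d) →L[ℝ] Hol (wt d β) (E d →L[ℝ] E d), ∀ f ψ, L f ψ = S.od (A.toPerm ψ) (f ψ) :=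
    ⟨Hol.mulCLM (fun ψ => S.od (A.toPerm ψ)) (hod.comp hwt), fun _ _ => rfl⟩
  obtain ⟨DGA, hDGAa⟩ : ∃ L : Hol (wt d β) (E d →L[ℝ] E d) →L[ℝ] Hol (wt d β) (E d →L[ℝ] E d), ∀ f ψ, L f ψ = S.dg (A.toPerm ψ) (f ψ) :=
    ⟨Hol.mulCLM (fun ψ => S.dg (A.toPerm ψ)) (hdg.comp hwt), fun _ _ => rfl⟩
  obtain ⟨Dh, hDha⟩ : ∃ f : Hol (wt d β) (E d →L[ℝ] E d), ∀ ψ, f ψ = A.D ψ :=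
    ⟨Hol.mk A.D (A.isHol_D hβ hβ1), fun _ => rfl⟩
  obtain ⟨Dih, hDiha⟩ : ∃ f : Hol (wt d β) (E d →L[ℝ] E d), ∀ ψ, f ψ = A.Dinv ψ :=
    ⟨Hol.mk A.Dinv (A.isHol_Dinv hβ hβ1), fun _ => rfl⟩
  obtain ⟨one, honea⟩ : ∃ f : Hol (wt d β) (E d →L[ℝ] E d), ∀ ψ, f ψ = 1 := ⟨Hol.mk (fun _ => 1) (IsHol.const _), fun _ => rfl⟩
  obtain ⟨conj, hconja⟩ : ∃ L : Hol (wt d β) (E d →L[ℝ] E d) →L[ℝ] Hol (wt d β) (E d →L[ℝ] E d), ∀ f ψ, L f ψ = A.D ψ * f ψ * A.Dinv ψ :=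
    ⟨Hol.mulCLM (conjD A) (isHol_conjD A hβ hβ1), fun _ _ => rfl⟩
  obtain ⟨COD, hCODa⟩ : ∃ L : Hol (wt d β) (E d →L[ℝ] E d) →L[ℝ] Hol (wt d β) (E d →L[ℝ] E d), ∀ f ψ,
      L f ψ = S.od (A.toPerm ψ) (f (A.toPerm ψ)) :=
    ⟨C ∘L OD, fun f ψ => by rw [ContinuousLinearMap.comp_apply, hCa, hODa]⟩
  -- This term fixes the diagonal part of the unknown, which `1 + od v` ignores, and makes the
  -- linear part an isomorphism of the whole space.
  obtain ⟨R, hRa⟩ : ∃ L : Hol (wt d β) (E d →L[ℝ] E d) →L[ℝ] Hol (wt d β) (E d →L[ℝ] E d), ∀ f ψ, L f ψ =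
      S.dg (A.toPerm ψ) (c • (A.D ψ * f ψ * A.Dinv ψ) - f (A.toPerm ψ)) :=
    ⟨DGA ∘L (c • conj - C), fun f ψ => by
      rw [ContinuousLinearMap.comp_apply, hDGAa, sub_apply,
        smul_apply, Hol.sub_apply, Hol.smul_apply, hconja, hCa]⟩
  obtain ⟨v, w, hva, hwa, hv0, hw, heq, hs1, hs2⟩ := exists_analytic_curve_bilinear m one Dih ODA COD
    DGA OD R hB e (fun f => by
      ext1 ψ
      rw [hea, ← S.linear_part c ψ (f ψ) (f (A.toPerm ψ))]
      rw [Hol.add_apply, Hol.sub_apply, hODAa, hma, hma, hma, hDGAa, hma, hma, hRa,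
        hCODa, Hol.add_apply, hODa, honea, hB0, hDiha])
  have hwD : ∀ ε ψ, w ε ψ = B ε ψ * (1 + S.od ψ (v ε ψ)) * A.Dinv ψ := fun ε ψ => by
    rw [hw, hma, hma, Hol.add_apply, hODa, honea, hDiha]
  -- Hence `dg w` stays within distance one of the identity for small `ε`, which makes `𝓛`
  -- invertible.
  have hw0 : DGA (w 0) = one := by
    ext1 ψ
    rw [hDGAa, hwD, hB0, hv0, Hol.zero_apply, map_zero, add_zero, mul_one, D_mul_Dinv, dg_one,
      honea]
  -- `𝓥 = 1 + od v` and `𝓛 = (dg w) DA`. With `w = B 𝓥 DA⁻¹`, the solved equation `w = (𝓥 ∘ A) (dg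
  -- w)` is the asserted identity.
  refine ⟨fun ε => one + OD (v ε), fun ε => m (DGA (w ε)) Dh, analyticAt_const.add (analyticAt_clm OD hva),
    analyticAt_clm (m.flip Dh) (analyticAt_clm DGA hwa), fun ψ => ?_, ?_⟩
  · rw [Hol.add_apply, hODa, honea, hv0, Hol.zero_apply, map_zero, add_zero]
  rw [hw0] at hs2
  filter_upwards [heq, hs1, hs2] with ε h1 h2 h3 ψ
  have hDu : IsUnit (A.D ψ) := ⟨⟨A.D ψ, A.Dinv ψ, D_mul_Dinv ψ, Dinv_mul_D ψ⟩, rfl⟩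
  have h4 := congrArg (fun f : Hol (wt d β) (E d →L[ℝ] E d) => f ψ) h1
  simp only [Hol.add_apply, Hol.sub_apply, Hol.zero_apply] at h4
  rw [hODAa, hma, hDGAa, hRa, hCODa] at h4
  have h5 := S.eq_mul_dg_of_equation h4
  have hV : ∀ φ, (one + OD (v ε)) φ = 1 + S.od φ (v ε φ) := fun φ => by
    rw [Hol.add_apply, hODa, honea]
  have hL : m (DGA (w ε)) Dh ψ = S.dg (A.toPerm ψ) (w ε ψ) * A.D ψ := by
    rw [hma, hDGAa, hDha]
  refine ⟨?_, ?_, fun i j hij => ?_, ?_⟩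
  · rw [hV]
    have : ‖-S.od ψ (v ε ψ)‖ < 1 := by
      rw [norm_neg, ← hODa]
      exact ((OD (v ε)).norm_apply_le ψ).trans_lt h2
    have := isUnit_one_sub_of_norm_lt_one this
    rwa [sub_neg_eq_add] at this
  · rw [hL]
    refine IsUnit.mul ?_ hDu
    have : ‖1 - S.dg (A.toPerm ψ) (w ε ψ)‖ < 1 := by
      have := (one - DGA (w ε)).norm_apply_le ψ
      rw [Hol.sub_apply, honea, hDGAa] at this
      exact this.trans_lt h3
    have := isUnit_one_sub_of_norm_lt_one this
    rwa [sub_sub_cancel] at this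
  · rw [hL, mul_assoc, mul_assoc, ← S.pr_mul_D, ← mul_assoc, ← mul_assoc,
      pr_mul_dg_mul_pr _ hij, zero_mul]
  · rw [hL, hV, hV, ← mul_assoc, ← h5, hwD, mul_assoc, mul_assoc, Dinv_mul_D, mul_one]

end InvariantSplitting

end BlockDiagonalization

end AnosovTorus
end

open scoped NNReal ENNReal
noncomputable section
namespace AnosovTorus

/-! ### From curves in Hölder spaces to the analytic families of the statement -/

section Assembly

variable {d k : ℕ}

theorem IsQuasiperiodic.fderiv_out {G : Type*} [NormedAddCommGroup G] [NormedSpace ℝ G]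
    {f : E d → G} (h : IsQuasiperiodic f) (x : E d) :
    _root_.fderiv ℝ f (Quotient.out (proj d x)) = _root_.fderiv ℝ f x := by
  have hl : Quotient.out (proj d x) - x ∈ lattice d := proj_eq_proj_iff.1 (proj_out (proj d x))
  have := h.fderiv_add hl x
  rwa [add_sub_cancel] at this

theorem IsQuasiperiodic.exists_hol_fderiv {f : E d → E d} (h : IsQuasiperiodic f)
    (hf : AnalyticOnNhd ℝ f Set.univ) {β : ℝ} (hβ : 0 < β) (hβ1 : β ≤ 1) :
    ∃ u : Hol (wt d β) (E d →L[ℝ] E d), ∀ x, u (proj d x) = _root_.fderiv ℝ f x := by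
  obtain ⟨K, hK, -, hL⟩ := h.fderiv.exists_lipschitz hf.fderiv
  refine ⟨Hol.mk (fun ψ => _root_.fderiv ℝ f (Quotient.out ψ))
    (isHol_of_lipschitz hK (fun ψ φ => ?_) hβ hβ1), h.fderiv_out⟩
  rw [← dist_eq_norm]
  refine dist_le_of_proj (f := fun ψ => _root_.fderiv ℝ f (Quotient.out ψ)) hK (fun x y => ?_) ψ φ
  rw [h.fderiv_out, h.fderiv_out, dist_eq_norm]
  exact hL x y

/-- Meant for the differential of `A_ε` along the conjugacy: `N₁`, `N₂` give increments of the
differentials, and `u₁`, `u₂` are their values at the undisplaced point. -/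
theorem exists_analytic_family {Y Z : Type*} [NormedAddCommGroup Y] [NormedSpace ℝ Y]
    [NormedAddCommGroup Z] [NormedSpace ℝ Z] {N₁ N₂ : Y → Z} (hN₁ : AnalyticAt ℝ N₁ 0)
    (hN₂ : AnalyticAt ℝ N₂ 0) (u₁ u₂ : Z) {h : ℝ → Y} (hh : AnalyticAt ℝ h 0) (hh0 : h 0 = 0) :
    ∃ B : ℝ → Z, AnalyticAt ℝ B 0 ∧ B 0 = N₁ 0 + u₁ ∧
      ∀ ε, B ε = N₁ (h ε) + u₁ + ε • (N₂ (h ε) + u₂) := by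
  refine ⟨fun ε => N₁ (h ε) + u₁ + ε • (N₂ (h ε) + u₂), ?_, by simp [hh0], fun _ => rfl⟩
  have h1 : AnalyticAt ℝ (fun ε => N₁ (h ε)) 0 :=
    AnalyticAt.comp (g := N₁) (by rwa [hh0]) hh
  have h2 : AnalyticAt ℝ (fun ε => N₂ (h ε)) 0 :=
    AnalyticAt.comp (g := N₂) (by rwa [hh0]) hh
  exact (h1.add analyticAt_const).add (analyticAt_id.smul (h2.add analyticAt_const))

theorem eventually_norm_lt {Y : Type*} [NormedAddCommGroup Y] [NormedSpace ℝ Y] {h : ℝ → Y}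
    (hh : AnalyticAt ℝ h 0) (hh0 : h 0 = 0) {r : ℝ} (hr : 0 < r) :
    ∀ᶠ ε in nhds (0 : ℝ), ‖h ε‖ < r := by
  have : Filter.Tendsto (fun ε => ‖h ε‖) (nhds 0) (nhds ‖h 0‖) := hh.continuousAt.norm
  rw [hh0, norm_zero] at this
  exact this.eventually (gt_mem_nhds hr)

theorem fderiv_perturbedLift (A : AnalyticDiffeo d) {F : Torus d → E d}
    (hF : AnalyticOnNhd ℝ (fun x => F (proj d x)) Set.univ) (ε : ℝ) (x : E d) :
    fderiv ℝ (perturbedLift A F ε) x =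
      fderiv ℝ A.lift x + ε • fderiv ℝ (fun x => F (proj d x)) x := by
  have h1 := (A.differentiable_lift x).hasFDerivAt
  have h2 := (hF x (Set.mem_univ x)).differentiableAt.hasFDerivAt
  exact (h1.add (h2.const_smul ε)).fderiv

theorem continuous_perturbedLift (A : AnalyticDiffeo d) {F : Torus d → E d}
    (hF : AnalyticOnNhd ℝ (fun x => F (proj d x)) Set.univ) (ε : ℝ) :
    Continuous (perturbedLift A F ε) :=
  A.continuous_lift.add ((continuousOn_univ.1 hF.continuousOn).const_smul ε)

/-- The differentials of the perturbed maps along a curve of displacements form an analytic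
curve. -/
theorem exists_derivative_curve (A : AnalyticDiffeo d) {F : Torus d → E d}
    (hF : AnalyticOnNhd ℝ (fun x => F (proj d x)) Set.univ) {β : ℝ} (hβ : 0 < β) (hβ1 : β ≤ 1)
    {h : ℝ → Hol (wt d β) (E d)} (hh : AnalyticAt ℝ h 0) (hh0 : h 0 = 0) :
    ∃ B : ℝ → Hol (wt d β) (E d →L[ℝ] E d), AnalyticAt ℝ B 0 ∧ (∀ ψ, B 0 ψ = A.D ψ) ∧
      ∀ᶠ ε in nhds (0 : ℝ), ∀ x,
        B ε (proj d x) = fderiv ℝ (perturbedLift A F ε) (x + h ε (proj d x)) := by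
  obtain ⟨N₁, r₁, hr₁, hN₁, hN₁a, -⟩ :=
    A.isQuasiperiodic_lift.fderiv.exists_nemytskii A.analytic_lift.fderiv hβ hβ1
  obtain ⟨N₂, r₂, hr₂, hN₂, hN₂a, -⟩ :=
    (isQuasiperiodic_comp_proj F).fderiv.exists_nemytskii hF.fderiv hβ hβ1
  obtain ⟨u₁, hu₁⟩ := A.isQuasiperiodic_lift.exists_hol_fderiv A.analytic_lift hβ hβ1
  obtain ⟨u₂, hu₂⟩ := (isQuasiperiodic_comp_proj F).exists_hol_fderiv hF hβ hβ1
  obtain ⟨B, hB, hB0, hBa⟩ := exists_analytic_family hN₁ hN₂ u₁ u₂ hh hh0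
  refine ⟨B, hB, fun ψ => ?_, ?_⟩
  · obtain ⟨x, rfl⟩ := proj_surjective d ψ
    rw [hB0, Hol.add_apply, hu₁, A.D_proj,
      hN₁a 0 (by rwa [norm_zero]), Hol.zero_apply, add_zero, sub_self, zero_add]
  · filter_upwards [eventually_norm_lt hh hh0 (lt_min hr₁ hr₂)] with ε hε x
    rw [hBa, Hol.add_apply, Hol.add_apply, Hol.smul_apply, Hol.add_apply, hu₁, hu₂,
      hN₁a _ (hε.trans_le (min_le_left _ _)), hN₂a _ (hε.trans_le (min_le_right _ _)),
      sub_add_cancel, sub_add_cancel, fderiv_perturbedLift A hF]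

theorem holderWith_of_dist_le {X Y : Type*} [PseudoMetricSpace X] [PseudoMetricSpace Y]
    {f : X → Y} {C β : ℝ≥0} (h : ∀ x y, dist (f x) (f y) ≤ C * dist x y ^ (β : ℝ)) :
    HolderWith C β f := by
  intro x y
  rw [edist_nndist, edist_nndist, ← ENNReal.coe_rpow_of_nonneg _ β.coe_nonneg]
  exact_mod_cast h x y

/-- The Hölder norms with smaller exponents are bounded by the one of `Hol`. -/
theorem exists_holderENorm_le (d : ℕ) : ∃ D : ℝ, 1 ≤ D ∧ ∀ {G : Type} [NormedAddCommGroup G]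
    [NormedSpace ℝ G] {β₀ : ℝ} {β : ℝ≥0} (_ : 0 < β) (_ : β ≤ β₀) (_ : β₀ ≤ 1)
    (u : Hol (wt d β₀) G), holderENorm β u ≤ ENNReal.ofReal (D * ‖u‖) := by
  obtain ⟨D, hD, h⟩ := exists_wt_le d
  refine ⟨1 + D, by linarith, fun {G} _ _ {β₀ β} hβ hβ0 hβ1 u => ?_⟩
  have hDu : 0 ≤ D * ‖u‖ := by positivity
  rw [add_mul, one_mul, ENNReal.ofReal_add (norm_nonneg _) hDu]
  refine add_le_add (iSup_le fun ψ => ?_) ?_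
  · rw [← ofReal_norm]
    exact ENNReal.ofReal_le_ofReal (u.norm_apply_le ψ)
  · have : HolderWith (D * ‖u‖).toNNReal β u := by
      refine holderWith_of_dist_le fun ψ φ => ?_
      rw [Real.coe_toNNReal _ hDu, dist_eq_norm]
      refine (u.norm_sub_le ψ φ).trans ?_
      rw [coe_wt]
      calc ‖u‖ * dist ψ φ ^ β₀ ≤ ‖u‖ * (D * dist ψ φ ^ (β : ℝ)) :=
            mul_le_mul_of_nonneg_left (h β β₀ hβ hβ0 hβ1 ψ φ) (norm_nonneg _)
        _ = D * ‖u‖ * dist ψ φ ^ (β : ℝ) := by ring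
    exact this.eHolderNorm_le

theorem memHolder_add_proj {β : ℝ≥0} (hβ : 0 < β) (hβ1 : (β : ℝ) ≤ 1)
    (u : Hol (wt d β) (E d)) : MemHolder β fun ψ => ψ + proj d (u ψ) := by
  obtain ⟨D, hD, h⟩ := exists_wt_le d
  have h0 : 0 ≤ D + ‖u‖ := by positivity
  refine ⟨(D + ‖u‖).toNNReal, holderWith_of_dist_le fun ψ φ => ?_⟩
  rw [Real.coe_toNNReal _ h0, add_mul]
  refine (dist_add_add_le _ _ _ _).trans (add_le_add ?_ ?_)
  · have := h β 1 hβ hβ1 le_rfl ψ φ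
    rwa [Real.rpow_one] at this
  · rw [dist_eq_norm, ← map_sub, ← coe_wt]
    exact (norm_proj_le _).trans (u.norm_sub_le ψ φ)

/-- An analytic curve of Hölder functions is an analytic family in the sense of
`IsAnalyticHolder`. -/
theorem exists_isAnalyticHolder {G : Type} [NormedAddCommGroup G] [NormedSpace ℝ G] {β₀ : ℝ}
    (hβ₀ : β₀ ≤ 1) {y : ℝ → Hol (wt d β₀) G} (hy : AnalyticAt ℝ y 0) :
    ∃ r : ℝ, 0 < r ∧ ∀ r' : ℝ, 0 < r' → r' ≤ r → ∀ β : ℝ≥0, 0 < β → β ≤ β₀ →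
      IsAnalyticHolder β r' fun ε ψ => y ε ψ := by
  obtain ⟨c, r, C, hr, hC, hc, hsum⟩ := exists_coeff_of_analyticAt hy
  obtain ⟨D, hD, hn⟩ := exists_holderENorm_le d
  refine ⟨r, hr, fun r' hr' hle β hβ hββ₀ => ⟨fun n => c n, D * C, fun n => ?_, fun ε hε ψ => ?_⟩⟩
  · refine (hn hβ hββ₀ hβ₀ (c n)).trans (ENNReal.ofReal_le_ofReal ?_)
    rw [mul_div_assoc]
    refine mul_le_mul_of_nonneg_left ((hc n).trans ?_) (by linarith)
    exact div_le_div_of_nonneg_left hC.le (by positivity) (pow_le_pow_left₀ hr'.le hle n)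
  · exact (hsum ε (hε.trans_le hle)).mapL (Hol.evalCLM (wt d β₀) G ψ)

theorem isInvertible_of_isUnit {f : E d →L[ℝ] E d} (hf : IsUnit f) : f.IsInvertible := by
  obtain ⟨u, rfl⟩ := hf
  exact ⟨ContinuousLinearEquiv.unitsEquiv ℝ (E d) u, rfl⟩

theorem exists_pos_forall_abs_lt {p : ℝ → Prop} (h : ∀ᶠ ε in nhds (0 : ℝ), p ε) :
    ∃ δ : ℝ, 0 < δ ∧ ∀ ε : ℝ, |ε| < δ → p ε := by
  obtain ⟨δ, hδ, hp⟩ := Metric.eventually_nhds_iff.1 h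
  exact ⟨δ, hδ, fun ε hε => hp (by rwa [Real.dist_0_eq_abs])⟩

/-- Structural stability with an analytic curve of conjugacies in one space of Hölder functions. -/
theorem exists_isConjugacy {A : AnalyticDiffeo d} (hA : IsAnosov A) {F : Torus d → E d}
    (hF : AnalyticOnNhd ℝ (fun x => F (proj d x)) Set.univ) {β₀ : ℝ≥0} (hβ₀ : 0 < β₀)
    (hβ₀1 : (β₀ : ℝ) ≤ 1) {h : ℝ → Hol (wt d β₀) (E d)} (hh : AnalyticAt ℝ h 0) (hh0 : h 0 = 0)
    (heq : ∀ᶠ ε in nhds (0 : ℝ), ∀ x, perturbedLift A F ε (x + h ε (proj d x)) =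
      A.lift x + h ε (A.toPerm (proj d x))) :
    ∃ ε₀ : ℝ, 0 < ε₀ ∧ IsConjugacy A F ε₀ fun ε ψ => ψ + proj d (h ε ψ) := by
  obtain ⟨K, hK, hFL⟩ := exists_lipschitz_of_analytic hF
  have hFc : IsHol (wt d 1) F := isHol_of_lipschitz hK hFL one_pos le_rfl
  obtain ⟨M, hM, hFB, -⟩ := hFc.exists_pos
  obtain ⟨r, ε₁, hr, hε₁, hhomeo⟩ := hA.exists_isHomeomorph hK hFL hM.le hFB
  obtain ⟨c, ρ, C, hρ, hC, hc, hsum⟩ := exists_coeff_of_analyticAt hh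
  obtain ⟨D, hD, hn⟩ := exists_holderENorm_le d
  obtain ⟨δ, hδ, hev⟩ := exists_pos_forall_abs_lt (heq.and (eventually_norm_lt hh hh0 hr))
  -- `δ` for the equation and the smallness of `h`, `ε₁` for the homeomorphism, `ρ` for the
  -- convergence of the series.
  refine ⟨min δ (min ε₁ ρ), by positivity, fun ε hε => ?_, fun n => c n, ?_, fun ε hε ψ => ?_,
    β₀, hβ₀, fun β hβ hββ₀ => ?_⟩
  · have hε1 := hε.trans_le (min_le_left _ _)
    have hε2 := hε.trans_le ((min_le_right _ _).trans (min_le_left _ _))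
    obtain ⟨h1, h2⟩ := hev ε hε1
    have h3 : ∀ ψ, A.toPerm ψ + proj d (h ε (A.toPerm ψ)) =
        perturbed A F ε (ψ + proj d (h ε ψ)) := by
      intro ψ
      obtain ⟨x, rfl⟩ := proj_surjective d ψ
      rw [← map_add, ← proj_perturbedLift, h1, map_add, A.proj_lift]
    exact ⟨hhomeo ε hε2 _ ((h ε).isHol.continuous (by exact_mod_cast hβ₀))
      (fun ψ => ((h ε).norm_apply_le ψ).trans h2.le) h3,
      ⟨β₀, hβ₀, memHolder_add_proj hβ₀ hβ₀1 (h ε)⟩, h3⟩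
  · have h1 := hsum 0 (by rwa [abs_zero])
    rw [hh0] at h1
    have h2 := hasSum_single (f := fun n => (0 : ℝ) ^ n • c n) 0
      (fun n hn => by rw [zero_pow hn, zero_smul])
    have h3 := h2.unique h1
    rw [pow_zero, one_smul] at h3
    change (c 0 : Torus d → E d) = 0
    rw [h3]
    rfl
  · have hε3 := hε.trans_le ((min_le_right _ _).trans (min_le_right _ _))
    exact ⟨h ε ψ, (hsum ε hε3).mapL (Hol.evalCLM (wt d β₀) (E d) ψ), rfl⟩
  · refine ⟨(1 + D * C) / ρ, by positivity, fun n hn1 => ?_⟩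
    refine (hn hβ (by exact_mod_cast hββ₀.le) hβ₀1 (c n)).trans (ENNReal.ofReal_le_ofReal ?_)
    have hDC : 0 ≤ D * C := by positivity
    calc D * ‖c n‖ ≤ D * (C / ρ ^ n) := mul_le_mul_of_nonneg_left (hc n) (by linarith)
      _ = D * C / ρ ^ n := by ring
      _ ≤ (1 + D * C) ^ n / ρ ^ n := by
          refine div_le_div_of_nonneg_right ?_ (by positivity)
          refine le_trans ?_ (le_self_pow₀ (by linarith) (by omega))
          linarith
      _ = ((1 + D * C) / ρ) ^ n := (div_pow _ _ _).symm

end Assembly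

end AnosovTorus
end

/-! ### The main theorem -/

theorem mainTheorem1 {d k : ℕ} (A : AnalyticDiffeo d) (hA : IsAnosov A)
    (F : Torus d → E d) (hF : AnalyticOnNhd ℝ (fun x => F (proj d x)) Set.univ)
    (S : InvariantSplitting A k) (hS : S.HasGaps) :
    ∃ (ε₀ : ℝ) (H : ℝ → Torus d → Torus d), 0 < ε₀ ∧ IsConjugacy A F ε₀ H ∧
      ∃ βbar : ℝ≥0, 0 < βbar ∧ ∀ β : ℝ≥0, 0 < β → β < βbar →
        ∃ εbar : ℝ, 0 < εbar ∧ εbar ≤ ε₀ ∧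
          ∃ 𝓥 𝓛 : ℝ → Torus d → (E d →L[ℝ] E d),
            IsAnalyticHolder β εbar 𝓥 ∧ IsAnalyticHolder β εbar 𝓛 ∧
            (∀ i j : Fin k, i ≠ j → ∀ ψ, S.block i j ψ ψ (𝓥 0 ψ) = 0) ∧
            ∀ ε : ℝ, |ε| < εbar → ∀ ψ : Torus d,
              (𝓥 ε ψ).IsInvertible ∧ (𝓛 ε ψ).IsInvertible ∧
              (∀ i j : Fin k, i ≠ j → S.block i j ψ (A.toPerm ψ) (𝓛 ε ψ) = 0) ∧
              torusDeriv (perturbedLift A F ε) (H ε ψ) ∘L 𝓥 ε ψ =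
                𝓥 ε (A.toPerm ψ) ∘L 𝓛 ε ψ := by
  obtain ⟨β₁, hβ₁, hβ₁1, hconj⟩ := exists_conjugacy_curve A hA F hF
  obtain ⟨β₂, hβ₂, hβ₂1, hblock⟩ := hS.exists_block_curves
  -- Both curves are built once, at a common exponent `β₀`; every smaller exponent inherits the
  -- bounds, so `H` does not depend on `β` and `β₀` serves as `βbar`.
  obtain ⟨β₀, hβ₀⟩ : ∃ β₀ : ℝ≥0, (β₀ : ℝ) = min β₁ β₂ :=
    ⟨(min β₁ β₂).toNNReal, Real.coe_toNNReal _ (le_min hβ₁.le hβ₂.le)⟩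
  have hβ₀0 : (0 : ℝ) < β₀ := by
    rw [hβ₀]
    exact lt_min hβ₁ hβ₂
  have hβ₀1 : (β₀ : ℝ) ≤ 1 := by
    rw [hβ₀]
    exact (min_le_left _ _).trans hβ₁1
  obtain ⟨h, hh, hh0, heq⟩ := hconj β₀ hβ₀0 (hβ₀.le.trans (min_le_left _ _))
  obtain ⟨ε₀, hε₀, hH⟩ := exists_isConjugacy hA hF (by exact_mod_cast hβ₀0) hβ₀1 hh hh0 heq
  obtain ⟨B, hB, hB0, hBa⟩ := exists_derivative_curve A hF hβ₀0 hβ₀1 hh hh0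
  obtain ⟨𝓥, 𝓛, h𝓥, h𝓛, h𝓥0, hev⟩ := hblock β₀ hβ₀0 (hβ₀.le.trans (min_le_right _ _)) B hB hB0
  obtain ⟨r₁, hr₁, hr₁a⟩ := exists_isAnalyticHolder hβ₀1 h𝓥
  obtain ⟨r₂, hr₂, hr₂a⟩ := exists_isAnalyticHolder hβ₀1 h𝓛
  obtain ⟨δ, hδ, hδa⟩ := exists_pos_forall_abs_lt (hBa.and hev)
  refine ⟨ε₀, fun ε ψ => ψ + proj d (h ε ψ), hε₀, hH, β₀, by exact_mod_cast hβ₀0,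
    fun β hβ hββ₀ => ?_⟩
  have hββ₀' : (β : ℝ) ≤ β₀ := by exact_mod_cast hββ₀.le
  have hpos : 0 < min (min ε₀ δ) (min r₁ r₂) := by positivity
  refine ⟨min (min ε₀ δ) (min r₁ r₂), hpos, (min_le_left _ _).trans (min_le_left _ _),
    fun ε ψ => 𝓥 ε ψ, fun ε ψ => 𝓛 ε ψ,
    hr₁a _ hpos ((min_le_right _ _).trans (min_le_left _ _)) β hβ hββ₀',
    hr₂a _ hpos ((min_le_right _ _).trans (min_le_right _ _)) β hβ hββ₀',
    fun i j hij ψ => S.block_eq_zero ?_, fun ε hε ψ => ?_⟩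
  · change S.pr i ψ * 𝓥 0 ψ * S.pr j ψ = 0
    rw [h𝓥0, mul_one, S.pr_mul_pr, if_neg hij]
  · obtain ⟨h1, h2⟩ := hδa ε (hε.trans_le ((min_le_left _ _).trans (min_le_right _ _)))
    obtain ⟨h3, h4, h5, h6⟩ := h2 ψ
    refine ⟨isInvertible_of_isUnit h3, isInvertible_of_isUnit h4,
      fun i j hij => S.block_eq_zero (h5 i j hij), ?_⟩
    obtain ⟨x, rfl⟩ := proj_surjective d ψ
    have h7 := torusDeriv_proj _ (continuous_perturbedLift A hF ε) _ (proj_perturbedLift A F ε)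
      (x + h ε (proj d x))
    rw [map_add, ← h1 x] at h7
    rw [h7]
    exact h6
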